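/- **Setting.** Let $\Theta$ be a signature containing $0,1,+$ and $-$ (truncated subtraction), and $\mathcal E$ a set of equations between index terms together with an interpretation of the symbols of $\Theta$ as partial functions on $\mathbb N$ in which $0,1,+,-$ have their usual meaning and all the equations hold. *Index terms* are $I,J,K::=a\mid f(I_1,\dots,I_n)\mid\sum_{a<I}J\mid \mathrm{fc}_a^{I,J}K$. Under an assignment of natural numbers to index variables they have a possibly undefined value in $\mathbb N$; $\mathrm{fc}_a^{I,J}K$ is the number of nodes of the forest of $J$ trees, nodes being numbered in pre-order from $I$ and node $a$ having $K$ children: $\mathrm{fc}_a^{I,0}K=0$ and $\mathrm{fc}_a^{I,J+1}K=F+1+\mathrm{fc}_a^{I+1+F,\;K\{I+F/a\}}K$ with $F=\mathrm{fc}_a^{I,J}K$. A constraint $I\le J$ is true under an assignment if both sides are defined and the inequality holds ($I<J$ means $I+1\le J$; $I=J$ means $I\le J$ and $J\le I$; $I\Downarrow$ means $I\le I$). For a finite set $\varphi$ of index variables and a set $\Phi$ of constraints over $\varphi$, $\varphi;\Phi\vdash I\le J$ means that every assignment to $\varphi$ satisfying $\Phi$ satisfies $I\le J$. **Types.** Linear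 types $A,B::=\sigma\multimap\tau$; modal types $\sigma,\tau::=[a<I]A\mid\mathsf{Nat}[I,J]$. Partial sums: $[a<I]A\{a/c\}\uplus[b<J]A\{I+b/c\}=[c<I+J]A$, $\mathsf{Nat}[I,J]\uplus\mathsf{Nat}[I,J]=\mathsf{Nat}[I,J]$; $\sum_{a<I}[b<J]A\{b+\sum_{d<a}J\{d/a\}/c\}=[c<\sum_{a<I}J]A$, and $\sum_{a<I}\mathsf{Nat}[J,K]=\mathsf{Nat}[J,K]$ for $a$ not free in $J,K$. Contexts $\Gamma,\Delta$ are partial maps from term variables to modal types; sums are taken variable by variable (keeping the type of a variable declared in only one summand). Subtyping: $\mathsf{Nat}[I,J]\sqsubseteq\mathsf{Nat}[K,H]$ if $K\le I$ and $J\le H$; $\sigma\multimap\tau\sqsubseteq\sigma'\multimap\tau'$ if $\sigma'\sqsubseteq\sigma$ and $\tau\sqsubseteq\tau'$; $[a<I]A\sqsubseteq[a<J]B$ if $J\le I$ and $A\sqsubseteq B$ under the additional constraint $a<J$ (all under $\varphi;\Phi$). $\Delta\sqsubseteq\Gamma$ if $\Delta(x)\sqsubseteq\Gamma(x)$ for every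 $x$ declared in $\Gamma$. Judgements are only formed when their weight $I$ and types $\sigma$ (also those in contexts) are well defined: $\varphi;\Phi\vdash I\Downarrow$ and $\varphi;\Phi\vdash\sigma\sqsubseteq\sigma$. **Terms.** Values $v::=\underline n\mid\lambda x.t\mid\mathsf{fix}\,x.t$; terms $t,u,s::=x\mid v\mid tu\mid\mathsf s(t)\mid\mathsf p(t)\mid\mathsf{ifz}\ t\ \mathsf{then}\ u\ \mathsf{else}\ s$. The judgement $\varphi;\Phi;\Gamma\vdash_K t:\tau$ ("$t$ has type $\tau$ and weight $K$") is generated by the following rules ($\varphi;\Phi$ is left out where it does not change): - $\Gamma,x:\sigma\vdash_0x:\sigma$; $\;\Gamma\vdash_0\underline n:\mathsf{Nat}[n,n]$; from $\Gamma\vdash_Mt:\mathsf{Nat}[I,J]$ infer $\Gamma\vdash_M\mathsf s(t):\mathsf{Nat}[I+1,J+1]$ and $\Gamma\vdash_M\mathsf p(t):\mathsf{Nat}[I-1,J-1]$; - from $\Gamma\vdash_It:\sigma$, $\Delta\sqsubseteq\Gamma$, $\sigma\sqsubseteq\tau$, $I\le J$ infer $\Delta\vdash_Jt:\tau$; - from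 $a,\varphi;a<I,\Phi;\Gamma,x:\sigma\vdash_Kt:\tau$ infer $\sum_{a<I}\Gamma\vdash_{I+\sum_{a<I}K}\lambda x.t:[a<I](\sigma\multimap\tau)$; - from $\Gamma\vdash_Kt:[a<1](\sigma\multimap\tau)$ and $\Delta\vdash_Hu:\sigma\{0/a\}$ infer $\Gamma\uplus\Delta\vdash_{K+H}tu:\tau\{0/a\}$; - from $\Gamma\vdash_Mt:\mathsf{Nat}[J,K]$, from $\Delta\vdash_Nu:\tau$ under the additional constraint $J\le0$, and from $\Delta\vdash_Ns:\tau$ under the additional constraint $K\ge1$, infer $\Gamma\uplus\Delta\vdash_{M+N}\mathsf{ifz}\ t\ \mathsf{then}\ u\ \mathsf{else}\ s:\tau$; - with $H=\mathrm{fc}_b^{0,K}I$: from $b,\varphi;b<H,\Phi;\Gamma,x:[a<I]A\vdash_Jt:[a<1]B$ and $a,b,\varphi;a<I,b<H,\Phi\vdash B\{0/a\}\{\mathrm{fc}_b^{b+1,a}I+b+1/b\}\sqsubseteq A$ infer $\sum_{b<H}\Gamma\vdash_{H+\sum_{b<H}J}\mathsf{fix}\,x.t:[a<K]B\{0/a\}\{\mathrm{fc}_b^{0,a}I/b\}$.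 **Machine.** Closures $c=t[\rho]$, value closures $\mathbf v=v[\rho]$, environments $\rho::=\emptyset\mid(x\mapsto\mathbf v)\cdot\rho$, stacks $\pi::=\diamond\mid\mathsf{fun}(\mathbf v,\pi)\mid\mathsf{arg}(c,\pi)\mid\mathsf{ifz}(t,u,\rho,\pi)\mid\mathsf s(\pi)\mid\mathsf p(\pi)$, processes $P=c\star\pi$. The steps $\succ$ of the CEK machine are $\mathbf v\star\mathsf{arg}(c,\pi)\succ c\star\mathsf{fun}(\mathbf v,\pi)$; $\mathbf v\star\mathsf{fun}((\lambda x.t)[\rho],\pi)\succ t[(x\mapsto\mathbf v)\cdot\rho]\star\pi$; $\mathbf v\star\mathsf{fun}((\mathsf{fix}\,x.t)[\rho],\pi)\succ t[(x\mapsto(\mathsf{fix}\,x.t)[\rho])\cdot\rho]\star\mathsf{arg}(\mathbf v,\pi)$; $\underline0[\rho']\star\mathsf{ifz}(t,u,\rho,\pi)\succ t[\rho]\star\pi$; $\;\underline{n+1}[\rho']\star\mathsf{ifz}(t,u,\rho,\pi)\succ u[\rho]\star\pi$; $\underline n[\rho]\star\mathsf s(\pi)\succ\underline{n+1}[\emptyset]\star\pi$;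 $\;\underline n[\rho]\star\mathsf p(\pi)\succ\underline{n-1}[\emptyset]\star\pi$ (with $0-1=0$); $x[\rho]\star\pi\succ\rho(x)\star\pi$; $\;(tu)[\rho]\star\pi\succ t[\rho]\star\mathsf{arg}(u[\rho],\pi)$; $\;\mathsf s(t)[\rho]\star\pi\succ t[\rho]\star\mathsf s(\pi)$; $\;\mathsf p(t)[\rho]\star\pi\succ t[\rho]\star\mathsf p(\pi)$; $\;(\mathsf{ifz}\ t\ \mathsf{then}\ u\ \mathsf{else}\ s)[\rho]\star\pi\succ t[\rho]\star\mathsf{ifz}(u,s,\rho,\pi)$. **Typing of processes** (under $\varphi;\Phi$). Closures: if $x_1:\sigma_1,\dots,x_k:\sigma_k\vdash_Kt:\tau$ and $\vdash_{J_i}\mathbf v_i:\sigma_i$ for all $i$, then $\vdash_{K+\sum_iJ_i}t[x_1\mapsto\mathbf v_1;\dots;x_k\mapsto\mathbf v_k]:\tau$. Stacks ($\vdash_I\pi:(\sigma,\tau)$, "$\pi$ is acceptable for $\sigma$ with type $\tau$ and cost $I$"): $\vdash_0\diamond:(\tau,\tau)$; if $\vdash_I\pi:(\sigma,\tau)$,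 $\sigma'\sqsubseteq\sigma$, $\tau\sqsubseteq\tau'$, $I\le J$, then $\vdash_J\pi:(\sigma',\tau')$; if $\vdash_Jc:\sigma\{0/a\}$ and $\vdash_K\pi:(\tau\{0/a\},\tau')$, then $\vdash_{J+K}\mathsf{arg}(c,\pi):([a<1](\sigma\multimap\tau),\tau')$; if $\vdash_J\mathbf v:[a<1](\sigma\multimap\tau)$ and $\vdash_K\pi:(\tau\{0/a\},\tau')$, then $\vdash_{J+K}\mathsf{fun}(\mathbf v,\pi):(\sigma\{0/a\},\tau')$; if $\vdash_Jt[\rho]:\sigma$ under the additional constraint $M\le0$, $\vdash_Ju[\rho]:\sigma$ under the additional constraint $N\ge1$, and $\vdash_K\pi:(\sigma,\tau)$, then $\vdash_{J+K}\mathsf{ifz}(t,u,\rho,\pi):(\mathsf{Nat}[M,N],\tau)$; if $\vdash_I\pi:(\mathsf{Nat}[M+1,N+1],\tau)$, then $\vdash_I\mathsf s(\pi):(\mathsf{Nat}[M,N],\tau)$; if $\vdash_I\pi:(\mathsf{Nat}[M-1,N-1],\tau)$, then $\vdash_I\mathsf p(\pi):(\mathsf{Nat}[M,N],\tau)$. Processes: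 if $\vdash_J\pi:(\sigma,\tau)$ and $\vdash_Kc:\sigma$, then $\vdash_{J+K}c\star\pi:\tau$. **Sizes.** The size $|t|$ of a term is defined by $|x|=|\underline n|=2$, and the size of any other term is $2$ plus the sum of the sizes of its immediate subterms. The multiplicative size $\|t\|$ is $0$ on values, $2$ on variables, and $2$ plus the sum of the multiplicative sizes of the immediate subterms on other terms. Put $\|t[\rho]\|=\|t\|$ and $\|c\star\pi\|=\|c\|+\|\pi\|$, where $\|\diamond\|=0$, $\|\mathsf{fun}(\mathbf v,\pi)\|=\|\mathbf v\|+\|\pi\|$, $\|\mathsf{arg}(c,\pi)\|=\|c\|+\|\pi\|+1$, $\|\mathsf{ifz}(t,u,\rho,\pi)\|=\|t\|+\|u\|+\|\pi\|+1$, $\|\mathsf s(\pi)\|=\|\mathsf p(\pi)\|=\|\pi\|+1$. **Proposition (Weighted Subject Reduction).** Assume $P\succ R$ and $\varphi;\Phi\vdash_I P:\tau$. Then there is an index term $J$ over $\varphi$ such that $\varphi;\Phi\vdash_J R:\tau$ and - either $\varphi;\Phi\vdash I=J$ and $\|P\|>\|R\|$, - or $\varphi;\Phi\vdash I>J$ and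 $\|P\|+|s|>\|R\|$ for some term $s$ appearing in $P$. -/

import Mathlib

universe u

namespace DlPCF

/-! ## Index terms -/

/-- An untyped signature: `Sym k` is the type of function symbols of arity `k`.
The symbols `0`, `1` (arity `0`), `+` and (truncated) `-` (arity `2`) are always present. -/
structure Signature where
  Sym : ℕ → Type u
  zero : Sym 0
  one : Sym 0
  add : Sym 2
  monus : Sym 2

/-- Index terms whose free index variables are among `n` variables (de Bruijn indices).
In `sum I J`, the bounded sum `∑_{a < I} J`, the variable `a` is index `0` of `J`.
In `fc I J K`, the forest cardinality of `J` trees described by `K` with nodes numbered from `I`,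
the bound variable (the node) is index `0` of `K`. -/
inductive Ix (Θ : Signature.{u}) : ℕ → Type u
  | var {n : ℕ} (i : Fin n) : Ix Θ n
  | app {n k : ℕ} (f : Θ.Sym k) (args : Fin k → Ix Θ n) : Ix Θ n
  | sum {n : ℕ} (I : Ix Θ n) (J : Ix Θ (n + 1)) : Ix Θ n
  | fc {n : ℕ} (I J : Ix Θ n) (K : Ix Θ (n + 1)) : Ix Θ n

variable {Θ : Signature.{u}}

namespace Ix

instance {n : ℕ} : Zero (Ix Θ n) := ⟨app Θ.zero ![]⟩
instance {n : ℕ} : One (Ix Θ n) := ⟨app Θ.one ![]⟩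
instance {n : ℕ} : Add (Ix Θ n) := ⟨fun I J => app Θ.add ![I, J]⟩
instance {n : ℕ} : Sub (Ix Θ n) := ⟨fun I J => app Θ.monus ![I, J]⟩

/-- The index term `1 + 1 + ⋯ + 1` (`k` times), which is `0` for `k = 0`. -/
def numeral {n : ℕ} : ℕ → Ix Θ n
  | 0 => 0
  | 1 => 1
  | k + 2 => numeral (k + 1) + 1

/-- Extension of a renaming under a binder. -/
def liftRen {n m : ℕ} (r : Fin n → Fin m) : Fin (n + 1) → Fin (m + 1) :=
  Fin.cases 0 (fun i => (r i).succ)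

/-- Renaming of the free index variables. -/
def rename : {n m : ℕ} → (Fin n → Fin m) → Ix Θ n → Ix Θ m
  | _, _, r, var i => var (r i)
  | _, _, r, app f args => app f (fun i => rename r (args i))
  | _, _, r, sum I J => sum (rename r I) (rename (liftRen r) J)
  | _, _, r, fc I J K => fc (rename r I) (rename r J) (rename (liftRen r) K)

/-- Weakening by a fresh index variable (which becomes index `0`). -/
def wk {n : ℕ} (I : Ix Θ n) : Ix Θ (n + 1) := rename Fin.succ I

/-- Extension of a substitution under a binder. -/
def liftSub {n m : ℕ} (s : Fin n → Ix Θ m) : Fin (n + 1) → Ix Θ (m + 1) :=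
  Fin.cases (var 0) (fun i => wk (s i))

/-- Simultaneous capture-avoiding substitution of index terms for index variables. -/
def subst : {n m : ℕ} → (Fin n → Ix Θ m) → Ix Θ n → Ix Θ m
  | _, _, s, var i => s i
  | _, _, s, app f args => app f (fun i => subst s (args i))
  | _, _, s, sum I J => sum (subst s I) (subst (liftSub s) J)
  | _, _, s, fc I J K => fc (subst s I) (subst s J) (subst (liftSub s) K)

end Ix

/-- An interpretation of the function symbols as partial functions on the natural numbers,
in which `0`, `1`, `+` and `-` have their usual meaning. -/
structure Interp (Θ : Signature.{u}) where
  fn : {k : ℕ} → Θ.Sym k → (Fin k → ℕ) →. ℕ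
  fn_zero : ∀ v, fn Θ.zero v = Part.some 0
  fn_one : ∀ v, fn Θ.one v = Part.some 1
  fn_add : ∀ v, fn Θ.add v = Part.some (v 0 + v 1)
  fn_monus : ∀ v, fn Θ.monus v = Part.some (v 0 - v 1)

/-- `ForestCard K i j r`: the forest of `j` trees whose nodes are numbered in pre-order from `i`,
and in which `k` is a value of `K` at `b` when node `b` has `k` children, has `r` nodes. This is
the least relation closed under the two defining equations of forest cardinalities, so that no
`r` exists when the forest is infinite or `K` is undefined at one of its nodes. -/
inductive ForestCard (K : ℕ → ℕ → Prop) : ℕ → ℕ → ℕ → Prop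
  | zero (i : ℕ) : ForestCard K i 0 0
  | succ {i j r k s : ℕ} : ForestCard K i j r → K (i + r) k → ForestCard K (i + 1 + r) k s →
      ForestCard K i (j + 1) (r + 1 + s)

/-- `I.Eval 𝓘 ρ m`: the meaning of `I` under the assignment `ρ` is defined and equal to `m`. -/
def Ix.Eval (𝓘 : Interp Θ) : {n : ℕ} → Ix Θ n → (Fin n → ℕ) → ℕ → Prop
  | _, .var i, ρ, m => m = ρ i
  | _, .app f args, ρ, m => ∃ v, (∀ i, (args i).Eval 𝓘 ρ (v i)) ∧ m ∈ 𝓘.fn f v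
  | _, .sum I J, ρ, m => ∃ k, I.Eval 𝓘 ρ k ∧
      ∃ v : ℕ → ℕ, (∀ a < k, J.Eval 𝓘 (Fin.cons a ρ) (v a)) ∧ m = ∑ a ∈ Finset.range k, v a
  | _, .fc I J K, ρ, m => ∃ i j, I.Eval 𝓘 ρ i ∧ J.Eval 𝓘 ρ j ∧
      ForestCard (fun b k => K.Eval 𝓘 (Fin.cons b ρ) k) i j m

/-- An equational program: a set of equations between index terms, together with the semantics it
gives to the function symbols, an interpretation in which all equations hold (for every
assignment, both sides are undefined, or both are defined and equal). When the equations have a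
unique solution this is that solution; uniqueness itself is not required. -/
structure EqProgram (Θ : Signature.{u}) where
  eqs : (n : ℕ) → Set (Ix Θ n × Ix Θ n)
  sem : Interp Θ
  sound : ∀ (n : ℕ), ∀ e ∈ eqs n, ∀ (ρ : Fin n → ℕ) (m : ℕ), e.1.Eval sem ρ m ↔ e.2.Eval sem ρ m

/-! ## Constraints and semantic entailment -/

/-- The constraint `lhs ≤ rhs`. -/
structure Constraint (Θ : Signature.{u}) (n : ℕ) where
  lhs : Ix Θ n
  rhs : Ix Θ n

/-- The constraint `I ≤ J`. -/
def cle {n : ℕ} (I J : Ix Θ n) : Constraint Θ n := ⟨I, J⟩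

/-- The constraint `I < J`, that is `I + 1 ≤ J`. -/
def clt {n : ℕ} (I J : Ix Θ n) : Constraint Θ n := ⟨I + 1, J⟩

/-- A constraint is true in `ρ` when both sides are defined and the first is at most the second. -/
def Constraint.Holds (ℰ : EqProgram Θ) {n : ℕ} (c : Constraint Θ n) (ρ : Fin n → ℕ) : Prop :=
  ∃ p q, c.lhs.Eval ℰ.sem ρ p ∧ c.rhs.Eval ℰ.sem ρ q ∧ p ≤ q

/-- An index context: a set of constraints on the `n` index variables in scope. -/
abbrev ICtx (Θ : Signature.{u}) (n : ℕ) := Set (Constraint Θ n)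

/-- `φ; Φ ⊢ c`: every assignment that satisfies `Φ` satisfies `c`. -/
def Entails (ℰ : EqProgram Θ) {n : ℕ} (Φ : ICtx Θ n) (c : Constraint Θ n) : Prop :=
  ∀ ρ : Fin n → ℕ, (∀ d ∈ Φ, d.Holds ℰ ρ) → c.Holds ℰ ρ

/-- `φ; Φ ⊢ I = J`. -/
def EntailsEq (ℰ : EqProgram Θ) {n : ℕ} (Φ : ICtx Θ n) (I J : Ix Θ n) : Prop :=
  Entails ℰ Φ (cle I J) ∧ Entails ℰ Φ (cle J I)

/-- `φ; Φ ⊢ I⇓`, the index term `I` is well defined; this abbreviates `φ; Φ ⊢ I ≤ I`. -/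
def IxDefined (ℰ : EqProgram Θ) {n : ℕ} (Φ : ICtx Θ n) (I : Ix Θ n) : Prop :=
  Entails ℰ Φ (cle I I)

/-- The index context `a < I, Φ` over the variables `a, φ`. -/
def ICtx.below {n : ℕ} (I : Ix Θ n) (Φ : ICtx Θ n) : ICtx Θ (n + 1) :=
  insert (clt (.var 0) I.wk) ((fun c => ⟨c.lhs.wk, c.rhs.wk⟩) '' Φ)

/-! ## Types -/

/-- Modal types: `nat I J` is `Nat[I, J]`, and `fn I σ τ` is `[a < I](σ ⊸ τ)`, where `a` is the
index variable `0` of `σ` and `τ`. (A linear type is always an arrow, see `LTy`.) -/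
inductive MTy (Θ : Signature.{u}) : ℕ → Type u
  | nat {n : ℕ} (I J : Ix Θ n) : MTy Θ n
  | fn {n : ℕ} (I : Ix Θ n) (σ τ : MTy Θ (n + 1)) : MTy Θ n

/-- Linear types `dom ⊸ cod`. -/
structure LTy (Θ : Signature.{u}) (n : ℕ) where
  dom : MTy Θ n
  cod : MTy Θ n

/-- The modal type `[a < I] A`. -/
abbrev MTy.bang {n : ℕ} (I : Ix Θ n) (A : LTy Θ (n + 1)) : MTy Θ n := .fn I A.dom A.cod

/-- Substitution of index terms in modal types. -/
def MTy.subst : {n m : ℕ} → (Fin n → Ix Θ m) → MTy Θ n → MTy Θ m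
  | _, _, s, .nat I J => .nat (I.subst s) (J.subst s)
  | _, _, s, .fn I σ τ =>
      .fn (I.subst s) (MTy.subst (Ix.liftSub s) σ) (MTy.subst (Ix.liftSub s) τ)

/-- Substitution of index terms in linear types. -/
def LTy.subst {n m : ℕ} (s : Fin n → Ix Θ m) (A : LTy Θ n) : LTy Θ m :=
  ⟨A.dom.subst s, A.cod.subst s⟩

/-- The substitution that replaces variable `0` by `I` and any other variable `i + 1` by the
variable `r i`. -/
def Ix.single {n m : ℕ} (I : Ix Θ m) (r : Fin n → Fin m) : Fin (n + 1) → Ix Θ m :=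
  Fin.cases I (fun i => .var (r i))

/-- `σ{0/a}` for the variable `a` of index `0`. -/
def MTy.at0 {n : ℕ} (σ : MTy Θ (n + 1)) : MTy Θ n := σ.subst (Ix.single 0 id)

/-- `A{0/a}` for the variable `a` of index `0`. -/
def LTy.at0 {n : ℕ} (A : LTy Θ (n + 1)) : LTy Θ n := A.subst (Ix.single 0 id)

/-- Weakening of a modal type by a fresh index variable (which becomes index `0`). -/
def MTy.wk {n : ℕ} (σ : MTy Θ n) : MTy Θ (n + 1) := σ.subst (fun i => .var i.succ)

/-- `MSum σ τ υ`: the sum `σ ⊎ τ` is defined and is `υ`. Up to the names of bound variables,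
`[a < I] A{a/c} ⊎ [b < J] A{I + b/c} = [c < I + J] A` and
`Nat[I, J] ⊎ Nat[I, J] = Nat[I, J]`. -/
inductive MSum {n : ℕ} : MTy Θ n → MTy Θ n → MTy Θ n → Prop
  | nat (I J : Ix Θ n) : MSum (.nat I J) (.nat I J) (.nat I J)
  | bang (I J : Ix Θ n) (A : LTy Θ (n + 1)) :
      MSum (.bang I A) (.bang J (A.subst (Ix.single (I.wk + .var 0) Fin.succ)))
        (.bang (I + J) A)

/-- `BSum I σ υ`: the bounded sum `∑_{a < I} σ` is defined and is `υ`, where `a` is the index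
variable `0` of `σ`. One has
`∑_{a < I} [b < J] A{b + ∑_{d < a} J{d/a} / c} = [c < ∑_{a < I} J] A` (with `a` not free in `A`)
and `∑_{a < I} Nat[J, K] = Nat[J, K]` if `a` is free neither in `J` nor in `K`. -/
inductive BSum {n : ℕ} (I : Ix Θ n) : MTy Θ (n + 1) → MTy Θ n → Prop
  | nat (J K : Ix Θ n) : BSum I (.nat J.wk K.wk) (.nat J K)
  | bang (J : Ix Θ (n + 1)) (A : LTy Θ (n + 1)) :
      BSum I
        (.bang J (A.subst (Ix.single
          (.var 0 + .sum (.var 1) (J.rename (Ix.liftRen (fun i => i.succ.succ))))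
          (fun i => i.succ.succ))))
        (.bang (.sum I J) A)

/-- The subtyping judgement `φ; Φ ⊢ σ ⊑ τ` on modal types (the rule for linear types is
merged into the rule for `[a < I] A`). -/
inductive Subty (ℰ : EqProgram Θ) : {n : ℕ} → ICtx Θ n → MTy Θ n → MTy Θ n → Prop
  | nat {n : ℕ} {Φ : ICtx Θ n} {I J K H : Ix Θ n} :
      Entails ℰ Φ (cle K I) → Entails ℰ Φ (cle J H) → Subty ℰ Φ (.nat I J) (.nat K H)
  | fn {n : ℕ} {Φ : ICtx Θ n} {I J : Ix Θ n} {σ τ σ' τ' : MTy Θ (n + 1)} :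
      Subty ℰ (Φ.below J) σ' σ → Subty ℰ (Φ.below J) τ τ' → Entails ℰ Φ (cle J I) →
      Subty ℰ Φ (.fn I σ τ) (.fn J σ' τ')

/-- The subtyping judgement on linear types. -/
def LSubty (ℰ : EqProgram Θ) {n : ℕ} (Φ : ICtx Θ n) (A B : LTy Θ n) : Prop :=
  Subty ℰ Φ B.dom A.dom ∧ Subty ℰ Φ A.cod B.cod

/-- `φ; Φ ⊢ σ⇓`: the modal type `σ` is well defined, i.e. all the index terms that matter in it are
defined. As for index terms (`I⇓` is `I ≤ I`), this is `σ ⊑ σ`. -/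
def TyDefined (ℰ : EqProgram Θ) {n : ℕ} (Φ : ICtx Θ n) (σ : MTy Θ n) : Prop :=
  Subty ℰ Φ σ σ

/-! ## Terms -/

/-- Terms of PCF up to renaming of bound variables (de Bruijn indices); `lam t` and `fix t` bind
index `0` of `t`. -/
inductive Tm
  | var (x : ℕ)
  | num (k : ℕ)
  | lam (t : Tm)
  | fix (t : Tm)
  | app (t u : Tm)
  | succ (t : Tm)
  | pred (t : Tm)
  | ifz (t u s : Tm)

/-- Values. -/
inductive Val
  | num (k : ℕ)
  | lam (t : Tm)
  | fix (t : Tm)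

/-- Values are terms. -/
def Val.toTm : Val → Tm
  | .num k => .num k
  | .lam t => .lam t
  | .fix t => .fix t

/-- The multiplicative size of a term. -/
def Tm.msize : Tm → ℕ
  | .num _ => 0
  | .lam _ => 0
  | .fix _ => 0
  | .var _ => 2
  | .app t u => t.msize + u.msize + 2
  | .succ t => t.msize + 2
  | .pred t => t.msize + 2
  | .ifz t u s => t.msize + u.msize + s.msize + 2

/-- The size of a term. -/
def Tm.size : Tm → ℕ
  | .num _ => 2
  | .lam t => t.size + 2
  | .fix t => t.size + 2
  | .var _ => 2
  | .app t u => t.size + u.size + 2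
  | .succ t => t.size + 2
  | .pred t => t.size + 2
  | .ifz t u s => t.size + u.size + s.size + 2

/-! ## Typing of terms -/

/-- Typing contexts assign modal types to term variables (partial maps). -/
abbrev Ctx (Θ : Signature.{u}) (n : ℕ) := ℕ → Option (MTy Θ n)

/-- `Γ, x : σ`, where `x` becomes the term variable `0`. -/
def Ctx.cons {n : ℕ} (σ : MTy Θ n) (Γ : Ctx Θ n) : Ctx Θ n
  | 0 => some σ
  | x + 1 => Γ x

/-- The context `x₁ : σ₁, …, xₖ : σₖ`. -/
def Ctx.ofList {n : ℕ} (σs : List (MTy Θ n)) : Ctx Θ n := fun x => σs[x]?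

/-- Sum of two contexts at one variable: types are summed where both contexts are defined. -/
inductive OSum {n : ℕ} : Option (MTy Θ n) → Option (MTy Θ n) → Option (MTy Θ n) → Prop
  | none : OSum none none none
  | left (σ : MTy Θ n) : OSum (some σ) none (some σ)
  | right (σ : MTy Θ n) : OSum none (some σ) (some σ)
  | both {σ τ υ : MTy Θ n} : MSum σ τ υ → OSum (some σ) (some τ) (some υ)

/-- `Γ ⊎ Δ` is defined and is `Ξ`. -/
def Ctx.IsSum {n : ℕ} (Γ Δ Ξ : Ctx Θ n) : Prop := ∀ x, OSum (Γ x) (Δ x) (Ξ x)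

/-- Bounded sum of a context at one variable. -/
inductive OBSum {n : ℕ} (I : Ix Θ n) : Option (MTy Θ (n + 1)) → Option (MTy Θ n) → Prop
  | none : OBSum I none none
  | some {σ : MTy Θ (n + 1)} {υ : MTy Θ n} : BSum I σ υ → OBSum I (some σ) (some υ)

/-- `∑_{a < I} Γ` is defined and is `Ξ`. -/
def Ctx.IsBSum {n : ℕ} (I : Ix Θ n) (Γ : Ctx Θ (n + 1)) (Ξ : Ctx Θ n) : Prop :=
  ∀ x, OBSum I (Γ x) (Ξ x)

/-- Subtyping of contexts: `Δ ⊑ Γ` when `Δ` declares every variable declared by `Γ`, with a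
subtype. -/
def CSubty (ℰ : EqProgram Θ) {n : ℕ} (Φ : ICtx Θ n) (Δ Γ : Ctx Θ n) : Prop :=
  ∀ x τ, Γ x = some τ → ∃ σ, Δ x = some σ ∧ Subty ℰ Φ σ τ

/-- The index terms and types in a typing judgement `φ; Φ; Γ ⊢_K t : τ` are well defined. -/
structure WellDefined (ℰ : EqProgram Θ) {n : ℕ} (Φ : ICtx Θ n) (Γ : Ctx Θ n) (K : Ix Θ n)
    (τ : MTy Θ n) : Prop where
  ctx : ∀ x σ, Γ x = some σ → TyDefined ℰ Φ σ
  weight : IxDefined ℰ Φ K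
  type : TyDefined ℰ Φ τ

/-- `B{0/a}{fc_b(b + 1, a, I) + b + 1 / b}` over the variables `a, b, φ`, where `B` has the
variables `a, b, φ` and `I` has the variables `b, φ` (and is rebound in the forest
cardinality). -/
def LTy.fixChild {n : ℕ} (B : LTy Θ (n + 2)) (I : Ix Θ (n + 1)) : LTy Θ (n + 2) :=
  B.at0.subst (Ix.single
    (.fc (.var 1 + 1) (.var 0) (I.rename (Ix.liftRen (fun i => i.succ.succ))) + .var 1 + 1)
    (fun i => i.succ.succ))

/-- `B{0/a}{fc_b(0, a, I) / b}` over the variables `a, φ`, where `B` has the variables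
`a, b, φ` and `I` has the variables `b, φ`. -/
def LTy.fixRoot {n : ℕ} (B : LTy Θ (n + 2)) (I : Ix Θ (n + 1)) : LTy Θ (n + 1) :=
  B.at0.subst (Ix.single (.fc 0 (.var 0) (I.rename (Ix.liftRen Fin.succ))) Fin.succ)

/-- The typing judgement `φ; Φ; Γ ⊢_K t : τ` of weight `K`. Judgements are only formed when their
index terms and types are well defined, which is the last premise of every rule. -/
inductive HasTy (ℰ : EqProgram Θ) :
    {n : ℕ} → ICtx Θ n → Ctx Θ n → Ix Θ n → Tm → MTy Θ n → Prop
  | ax {n : ℕ} {Φ : ICtx Θ n} {Γ : Ctx Θ n} {x : ℕ} {σ : MTy Θ n} :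
      Γ x = some σ →
      WellDefined ℰ Φ Γ 0 σ →
      HasTy ℰ Φ Γ 0 (.var x) σ
  | subs {n : ℕ} {Φ : ICtx Θ n} {Γ Δ : Ctx Θ n} {I J : Ix Θ n} {t : Tm} {σ τ : MTy Θ n} :
      HasTy ℰ Φ Γ I t σ → CSubty ℰ Φ Δ Γ → Subty ℰ Φ σ τ → Entails ℰ Φ (cle I J) →
      WellDefined ℰ Φ Δ J τ →
      HasTy ℰ Φ Δ J t τ
  | lam {n : ℕ} {Φ : ICtx Θ n} {Γ : Ctx Θ (n + 1)} {Ξ : Ctx Θ n} {I : Ix Θ n}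
      {K : Ix Θ (n + 1)} {t : Tm} {σ τ : MTy Θ (n + 1)} :
      HasTy ℰ (Φ.below I) (Ctx.cons σ Γ) K t τ → Ctx.IsBSum I Γ Ξ →
      WellDefined ℰ Φ Ξ (I + .sum I K) (.fn I σ τ) →
      HasTy ℰ Φ Ξ (I + .sum I K) (.lam t) (.fn I σ τ)
  | app {n : ℕ} {Φ : ICtx Θ n} {Γ Δ Ξ : Ctx Θ n} {K H : Ix Θ n} {t u : Tm}
      {σ τ : MTy Θ (n + 1)} :
      HasTy ℰ Φ Γ K t (.fn 1 σ τ) → HasTy ℰ Φ Δ H u σ.at0 → Ctx.IsSum Γ Δ Ξ →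
      WellDefined ℰ Φ Ξ (K + H) τ.at0 →
      HasTy ℰ Φ Ξ (K + H) (.app t u) τ.at0
  | ifz {n : ℕ} {Φ : ICtx Θ n} {Γ Δ Ξ : Ctx Θ n} {M N J K : Ix Θ n} {t u s : Tm}
      {τ : MTy Θ n} :
      HasTy ℰ Φ Γ M t (.nat J K) →
      HasTy ℰ (insert (cle J 0) Φ) Δ N u τ →
      HasTy ℰ (insert (cle 1 K) Φ) Δ N s τ → Ctx.IsSum Γ Δ Ξ →
      WellDefined ℰ Φ Ξ (M + N) τ →
      HasTy ℰ Φ Ξ (M + N) (.ifz t u s) τ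
  | num {n : ℕ} {Φ : ICtx Θ n} {Γ : Ctx Θ n} {k : ℕ} :
      WellDefined ℰ Φ Γ 0 (.nat (.numeral k) (.numeral k)) →
      HasTy ℰ Φ Γ 0 (.num k) (.nat (.numeral k) (.numeral k))
  | succ {n : ℕ} {Φ : ICtx Θ n} {Γ : Ctx Θ n} {M I J : Ix Θ n} {t : Tm} :
      HasTy ℰ Φ Γ M t (.nat I J) →
      WellDefined ℰ Φ Γ M (.nat (I + 1) (J + 1)) →
      HasTy ℰ Φ Γ M (.succ t) (.nat (I + 1) (J + 1))
  | pred {n : ℕ} {Φ : ICtx Θ n} {Γ : Ctx Θ n} {M I J : Ix Θ n} {t : Tm} :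
      HasTy ℰ Φ Γ M t (.nat I J) →
      WellDefined ℰ Φ Γ M (.nat (I - 1) (J - 1)) →
      HasTy ℰ Φ Γ M (.pred t) (.nat (I - 1) (J - 1))
  | fix {n : ℕ} {Φ : ICtx Θ n} {Γ : Ctx Θ (n + 1)} {Ξ : Ctx Θ n} {K H : Ix Θ n}
      {I J : Ix Θ (n + 1)} {A B : LTy Θ (n + 2)} {t : Tm} :
      H = .fc 0 K I →
      HasTy ℰ (Φ.below H) (Ctx.cons (.bang I A) Γ) J t (.bang 1 B) →
      LSubty ℰ ((Φ.below H).below I) (B.fixChild I) A →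
      Ctx.IsBSum H Γ Ξ →
      WellDefined ℰ Φ Ξ (H + .sum H J) (.bang K (B.fixRoot I)) →
      HasTy ℰ Φ Ξ (H + .sum H J) (.fix t) (.bang K (B.fixRoot I))

/-! ## The CEK machine -/

/-- Environments: `cons v ρ' ρ` is `(x ↦ v[ρ']) · ρ`, which assigns the value closure `v[ρ']` to
the term variable `0` and shifts the variables of `ρ`. -/
inductive Env
  | nil
  | cons (v : Val) (ρ' ρ : Env)

/-- A value closure `val[env]`. -/
structure VClosure where
  val : Val
  env : Env

/-- A closure `tm[env]`. -/
structure Closure where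
  tm : Tm
  env : Env

/-- Value closures are closures. -/
def VClosure.toClosure (v : VClosure) : Closure := ⟨v.val.toTm, v.env⟩

/-- `ρ(x)`. -/
def Env.lookup : Env → ℕ → Option VClosure
  | .nil, _ => none
  | .cons v ρ' _, 0 => some ⟨v, ρ'⟩
  | .cons _ _ ρ, x + 1 => ρ.lookup x

/-- `(x ↦ v) · ρ`. -/
def Env.push (v : VClosure) (ρ : Env) : Env := .cons v.val v.env ρ

/-- Stacks. -/
inductive Stack
  | nil
  | fn (v : VClosure) (π : Stack)
  | arg (c : Closure) (π : Stack)
  | ifz (t u : Tm) (ρ : Env) (π : Stack)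
  | succ (π : Stack)
  | pred (π : Stack)

/-- A process `clo ⋆ stack`. -/
structure Proc where
  clo : Closure
  stack : Stack

/-- One step of the CEK machine. -/
inductive Step : Proc → Proc → Prop
  | arg (v : VClosure) (c : Closure) (π : Stack) :
      Step ⟨v.toClosure, .arg c π⟩ ⟨c, .fn v π⟩
  | beta (v : VClosure) (t : Tm) (ρ : Env) (π : Stack) :
      Step ⟨v.toClosure, .fn ⟨.lam t, ρ⟩ π⟩ ⟨⟨t, .push v ρ⟩, π⟩
  | unfold (v : VClosure) (t : Tm) (ρ : Env) (π : Stack) :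
      Step ⟨v.toClosure, .fn ⟨.fix t, ρ⟩ π⟩
        ⟨⟨t, .push ⟨.fix t, ρ⟩ ρ⟩, .arg v.toClosure π⟩
  | ifZero (ρ' : Env) (t u : Tm) (ρ : Env) (π : Stack) :
      Step ⟨⟨.num 0, ρ'⟩, .ifz t u ρ π⟩ ⟨⟨t, ρ⟩, π⟩
  | ifSucc (ρ' : Env) (k : ℕ) (t u : Tm) (ρ : Env) (π : Stack) :
      Step ⟨⟨.num (k + 1), ρ'⟩, .ifz t u ρ π⟩ ⟨⟨u, ρ⟩, π⟩
  | numSucc (ρ : Env) (k : ℕ) (π : Stack) :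
      Step ⟨⟨.num k, ρ⟩, .succ π⟩ ⟨⟨.num (k + 1), .nil⟩, π⟩
  | numPred (ρ : Env) (k : ℕ) (π : Stack) :
      Step ⟨⟨.num k, ρ⟩, .pred π⟩ ⟨⟨.num (k - 1), .nil⟩, π⟩
  | var {ρ : Env} {x : ℕ} {v : VClosure} (π : Stack) :
      ρ.lookup x = some v → Step ⟨⟨.var x, ρ⟩, π⟩ ⟨v.toClosure, π⟩
  | app (t u : Tm) (ρ : Env) (π : Stack) :
      Step ⟨⟨.app t u, ρ⟩, π⟩ ⟨⟨t, ρ⟩, .arg ⟨u, ρ⟩ π⟩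
  | succ (t : Tm) (ρ : Env) (π : Stack) :
      Step ⟨⟨.succ t, ρ⟩, π⟩ ⟨⟨t, ρ⟩, .succ π⟩
  | pred (t : Tm) (ρ : Env) (π : Stack) :
      Step ⟨⟨.pred t, ρ⟩, π⟩ ⟨⟨t, ρ⟩, .pred π⟩
  | ifz (t u s : Tm) (ρ : Env) (π : Stack) :
      Step ⟨⟨.ifz t u s, ρ⟩, π⟩ ⟨⟨t, ρ⟩, .ifz u s ρ π⟩

/-- The size of a closure is the multiplicative size of its term. -/
def Closure.size (c : Closure) : ℕ := c.tm.msize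

/-- The size of a stack. -/
def Stack.size : Stack → ℕ
  | .nil => 0
  | .fn v π => v.toClosure.size + π.size
  | .arg c π => c.size + π.size + 1
  | .ifz t u _ π => t.msize + u.msize + π.size + 1
  | .succ π => π.size + 1
  | .pred π => π.size + 1

/-- The size of a process. -/
def Proc.size (P : Proc) : ℕ := P.clo.size + P.stack.size

/-- The terms of the closures in an environment (at any depth). -/
def Env.terms : Env → Set Tm
  | .nil => ∅
  | .cons v ρ' ρ => {v.toTm} ∪ ρ'.terms ∪ ρ.terms

/-- The terms appearing in a closure. -/
def Closure.terms (c : Closure) : Set Tm := {c.tm} ∪ c.env.terms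

/-- The terms appearing in a stack. -/
def Stack.terms : Stack → Set Tm
  | .nil => ∅
  | .fn v π => v.toClosure.terms ∪ π.terms
  | .arg c π => c.terms ∪ π.terms
  | .ifz t u ρ π => {t, u} ∪ ρ.terms ∪ π.terms
  | .succ π => π.terms
  | .pred π => π.terms

/-- The terms appearing in a process. (Subterms are not listed separately: they are smaller.) -/
def Proc.terms (P : Proc) : Set Tm := P.clo.terms ∪ P.stack.terms

/-! ## Typing of processes -/

/-- `EnvTy ℰ Φ ρ [σ₁, …, σₖ] W`: the value closures `v₁, …, vₖ` of `ρ` have the types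
`σ₁, …, σₖ` with weights `J₁, …, Jₖ` whose sum is `W`. In `cons`, the first value closure
`v[ρ']` gets the weight `K + W'` by the typing rule for closures (see `CloTy`). -/
inductive EnvTy (ℰ : EqProgram Θ) {n : ℕ} (Φ : ICtx Θ n) :
    Env → List (MTy Θ n) → Ix Θ n → Prop
  | nil : EnvTy ℰ Φ .nil [] 0
  | cons {v : Val} {ρ' ρ : Env} {σs' σs : List (MTy Θ n)} {σ : MTy Θ n} {K W' W : Ix Θ n} :
      HasTy ℰ Φ (Ctx.ofList σs') K v.toTm σ → EnvTy ℰ Φ ρ' σs' W' → EnvTy ℰ Φ ρ σs W →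
      EnvTy ℰ Φ (.cons v ρ' ρ) (σ :: σs) ((K + W') + W)

/-- `φ; Φ ⊢_J c : τ` for closures. -/
inductive CloTy (ℰ : EqProgram Θ) {n : ℕ} (Φ : ICtx Θ n) :
    Ix Θ n → Closure → MTy Θ n → Prop
  | mk {t : Tm} {ρ : Env} {σs : List (MTy Θ n)} {K W : Ix Θ n} {τ : MTy Θ n} :
      HasTy ℰ Φ (Ctx.ofList σs) K t τ → EnvTy ℰ Φ ρ σs W →
      CloTy ℰ Φ (K + W) ⟨t, ρ⟩ τ

/-- The index terms and types in a stack judgement `φ; Φ ⊢_I π : (σ, τ)` are well defined. -/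
structure StackWellDefined (ℰ : EqProgram Θ) {n : ℕ} (Φ : ICtx Θ n) (I : Ix Θ n)
    (σ τ : MTy Θ n) : Prop where
  weight : IxDefined ℰ Φ I
  source : TyDefined ℰ Φ σ
  target : TyDefined ℰ Φ τ

/-- `StackTy ℰ Φ I π σ τ`: the stack `π` is acceptable for `σ` with type `τ` with cost `I`. -/
inductive StackTy (ℰ : EqProgram Θ) {n : ℕ} (Φ : ICtx Θ n) :
    Ix Θ n → Stack → MTy Θ n → MTy Θ n → Prop
  | nil {τ : MTy Θ n} :
      StackWellDefined ℰ Φ 0 τ τ →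
      StackTy ℰ Φ 0 .nil τ τ
  | subs {I J : Ix Θ n} {π : Stack} {σ τ σ' τ' : MTy Θ n} :
      StackTy ℰ Φ I π σ τ → Subty ℰ Φ σ' σ → Subty ℰ Φ τ τ' → Entails ℰ Φ (cle I J) →
      StackWellDefined ℰ Φ J σ' τ' →
      StackTy ℰ Φ J π σ' τ'
  | arg {J K : Ix Θ n} {c : Closure} {π : Stack} {σ τ : MTy Θ (n + 1)} {τ' : MTy Θ n} :
      CloTy ℰ Φ J c σ.at0 → StackTy ℰ Φ K π τ.at0 τ' →
      StackWellDefined ℰ Φ (J + K) (.fn 1 σ τ) τ' →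
      StackTy ℰ Φ (J + K) (.arg c π) (.fn 1 σ τ) τ'
  | fn {J K : Ix Θ n} {v : VClosure} {π : Stack} {σ τ : MTy Θ (n + 1)} {τ' : MTy Θ n} :
      CloTy ℰ Φ J v.toClosure (.fn 1 σ τ) → StackTy ℰ Φ K π τ.at0 τ' →
      StackWellDefined ℰ Φ (J + K) σ.at0 τ' →
      StackTy ℰ Φ (J + K) (.fn v π) σ.at0 τ'
  | ifz {J K M N : Ix Θ n} {t u : Tm} {ρ : Env} {π : Stack} {σ τ : MTy Θ n} :
      CloTy ℰ (insert (cle M 0) Φ) J ⟨t, ρ⟩ σ → CloTy ℰ (insert (cle 1 N) Φ) J ⟨u, ρ⟩ σ →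
      StackTy ℰ Φ K π σ τ →
      StackWellDefined ℰ Φ (J + K) (.nat M N) τ →
      StackTy ℰ Φ (J + K) (.ifz t u ρ π) (.nat M N) τ
  | succ {I M N : Ix Θ n} {π : Stack} {τ : MTy Θ n} :
      StackTy ℰ Φ I π (.nat (M + 1) (N + 1)) τ →
      StackWellDefined ℰ Φ I (.nat M N) τ →
      StackTy ℰ Φ I (.succ π) (.nat M N) τ
  | pred {I M N : Ix Θ n} {π : Stack} {τ : MTy Θ n} :
      StackTy ℰ Φ I π (.nat (M - 1) (N - 1)) τ →
      StackWellDefined ℰ Φ I (.nat M N) τ →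
      StackTy ℰ Φ I (.pred π) (.nat M N) τ

/-- `φ; Φ ⊢_I P : τ` for processes. -/
inductive ProcTy (ℰ : EqProgram Θ) {n : ℕ} (Φ : ICtx Θ n) :
    Ix Θ n → Proc → MTy Θ n → Prop
  | mk {J K : Ix Θ n} {c : Closure} {π : Stack} {σ τ : MTy Θ n} :
      StackTy ℰ Φ J π σ τ → CloTy ℰ Φ K c σ →
      ProcTy ℰ Φ (J + K) ⟨c, π⟩ τ

end DlPCF

namespace DlPCF

variable {Θ : Signature.{u}}

/-! ## Algebra of substitutions -/

namespace Ix

/-! A step takes the typings of the closure and of the stack apart by generation lemmas and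
reassembles them; the question is what happens to weights and to shared environments.

Only `beta` and `unfold` consume weight. An abstraction of type `[a < I] A` weighs `I + ∑_{a<I} K`;
when it is applied, `1 ≤ I`, so the body at `a = 0` weighs at most `∑_{a<I} K`, and the summand `I`
makes the inequality strict (`HasTy.beta`). A fixpoint weighs `H + ∑_{b<H} J`, where `H` counts the
recursive calls as nodes of a forest. A call removes the root `0` of a tree; the remaining fixpoint
is typed by the forest of its children, renumbered from `1`, and the root's contribution to `H` pays
for the step (`HasTy.unfold`). In both cases the new body comes from a value of size exceeding its
multiplicative size. The other steps shrink the process without increasing its weight, and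
`ProcTy.pad` restores equality of weights by raising the cost of the stack.

Steps `app`, `ifz` and `unfold` use one environment twice. Its typing must therefore be divided
along the sums of contexts without exceeding the original weight. This rests on `HasTy.split_val`: a
value whose type lies below `τ₁ ⊎ τ₂` can be typed with both summands, at weights adding up to at
most its own. For an abstraction the interval `a < I₁ + I₂` is cut at `I₁` and the second half is
shifted. For a fixpoint the forest of `K₁ + K₂` trees is cut after the first `K₁`, and the second
part is renumbered. The types of the captured variables split along the same cut, so `EnvTy.split`
can recurse into the environment of the value.

Sums of types are syntactic, whereas reindexing produces index terms that are equal only in value.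
Hence subtyping is shown stable under replacing one substitution by another with the same values
(`SubstAgree`, `Subty.subst₂`), and splitting is always meant up to subtyping (`Split`). -/

@[simp] theorem liftRen_zero {n m : ℕ} (r : Fin n → Fin m) : liftRen r 0 = 0 := rfl
@[simp] theorem liftRen_succ {n m : ℕ} (r : Fin n → Fin m) (i : Fin n) :
    liftRen r i.succ = (r i).succ := rfl
@[simp] theorem liftSub_zero {n m : ℕ} (s : Fin n → Ix Θ m) : liftSub s 0 = var 0 := rfl
@[simp] theorem liftSub_succ {n m : ℕ} (s : Fin n → Ix Θ m) (i : Fin n) :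
    liftSub s i.succ = (s i).wk := rfl
@[simp] theorem liftSub_one {n m : ℕ} (s : Fin (n + 1) → Ix Θ m) : liftSub s 1 = (s 0).wk := rfl
@[simp] theorem single_zero {n m : ℕ} (I : Ix Θ m) (r : Fin n → Fin m) : single I r 0 = I := rfl
@[simp] theorem single_succ {n m : ℕ} (I : Ix Θ m) (r : Fin n → Fin m) (i : Fin n) :
    single I r i.succ = var (r i) := rfl

@[simp] theorem subst_var {n m : ℕ} (s : Fin n → Ix Θ m) (i : Fin n) :
    subst s (var i) = s i := rfl
@[simp] theorem subst_sum {n m : ℕ} (s : Fin n → Ix Θ m) (I : Ix Θ n) (J : Ix Θ (n + 1)) :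
    subst s (sum I J) = sum (subst s I) (subst (liftSub s) J) := rfl
@[simp] theorem subst_fc {n m : ℕ} (s : Fin n → Ix Θ m) (I J : Ix Θ n) (K : Ix Θ (n + 1)) :
    subst s (fc I J K) = fc (subst s I) (subst s J) (subst (liftSub s) K) := rfl

@[simp] theorem subst_zero {n m : ℕ} (s : Fin n → Ix Θ m) : subst s (0 : Ix Θ n) = 0 := by
  show app _ _ = app _ _
  congr 1; ext i; exact i.elim0
@[simp] theorem subst_one {n m : ℕ} (s : Fin n → Ix Θ m) : subst s (1 : Ix Θ n) = 1 := by
  show app _ _ = app _ _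
  congr 1; ext i; exact i.elim0
@[simp] theorem subst_add {n m : ℕ} (s : Fin n → Ix Θ m) (I J : Ix Θ n) :
    subst s (I + J) = subst s I + subst s J := by
  show app _ _ = app _ _
  congr 1; ext i; fin_cases i <;> rfl
@[simp] theorem subst_sub {n m : ℕ} (s : Fin n → Ix Θ m) (I J : Ix Θ n) :
    subst s (I - J) = subst s I - subst s J := by
  show app _ _ = app _ _
  congr 1; ext i; fin_cases i <;> rfl

@[simp] theorem subst_numeral {n m : ℕ} (s : Fin n → Ix Θ m) (k : ℕ) :
    subst s (numeral k) = numeral k := by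
  induction k using Nat.twoStepInduction with
  | zero => exact subst_zero s
  | one => exact subst_one s
  | more k _ ih => rw [numeral, numeral, subst_add, ih, subst_one]

theorem liftSub_var_comp {n m : ℕ} (r : Fin n → Fin m) :
    liftSub (fun i => (var (r i) : Ix Θ m)) = fun i => var (liftRen r i) := by
  funext i; cases i using Fin.cases <;> rfl

theorem rename_eq_subst {n m : ℕ} (r : Fin n → Fin m) (I : Ix Θ n) :
    rename r I = subst (fun i => var (r i)) I := by
  induction I generalizing m with
  | var i => rfl
  | app f v ih => simp only [rename, subst, ih]
  | sum I J ihI ihJ => simp only [rename, subst, ihI, ihJ, liftSub_var_comp]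
  | fc I J K ihI ihJ ihK => simp only [rename, subst, ihI, ihJ, ihK, liftSub_var_comp]

theorem subst_rename {n m k : ℕ} (s : Fin m → Ix Θ k) (r : Fin n → Fin m) (I : Ix Θ n) :
    subst s (rename r I) = subst (fun i => s (r i)) I := by
  have key : ∀ {n m k : ℕ} (s : Fin m → Ix Θ k) (r : Fin n → Fin m),
      (fun i => liftSub s (liftRen r i)) = liftSub (fun i => s (r i)) := by
    intro n m k s r; funext i; cases i using Fin.cases <;> rfl
  induction I generalizing m k with
  | var i => rfl
  | app f v ih => simp only [rename, subst, ih]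
  | sum I J ihI ihJ => simp only [rename, subst, ihI, ihJ, key]
  | fc I J K ihI ihJ ihK => simp only [rename, subst, ihI, ihJ, ihK, key]

theorem rename_rename {n m k : ℕ} (s : Fin m → Fin k) (r : Fin n → Fin m) (I : Ix Θ n) :
    rename s (rename r I) = rename (fun i => s (r i)) I := by
  rw [rename_eq_subst s, subst_rename, rename_eq_subst]

theorem rename_liftRen_wk {n m : ℕ} (r : Fin n → Fin m) (I : Ix Θ n) :
    rename (liftRen r) I.wk = (rename r I).wk := by
  rw [wk, wk, rename_rename, rename_rename]; rfl

theorem rename_subst {n m k : ℕ} (r : Fin m → Fin k) (s : Fin n → Ix Θ m) (I : Ix Θ n) :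
    rename r (subst s I) = subst (fun i => rename r (s i)) I := by
  have key : ∀ {n m k : ℕ} (r : Fin m → Fin k) (s : Fin n → Ix Θ m),
      (fun i => rename (liftRen r) (liftSub s i)) = liftSub (fun i => rename r (s i)) := by
    intro n m k r s; funext i
    cases i using Fin.cases with
    | zero => rfl
    | succ i => exact rename_liftRen_wk r (s i)
  induction I generalizing m k with
  | var i => rfl
  | app f v ih => simp only [rename, subst, ih]
  | sum I J ihI ihJ => simp only [rename, subst, ihI, ihJ, key]
  | fc I J K ihI ihJ ihK => simp only [rename, subst, ihI, ihJ, ihK, key]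

theorem subst_liftSub_wk {n m : ℕ} (s : Fin n → Ix Θ m) (I : Ix Θ n) :
    subst (liftSub s) I.wk = (subst s I).wk := by
  rw [wk, wk, subst_rename, rename_subst]; rfl

theorem liftSub_comp {n m k : ℕ} (s : Fin m → Ix Θ k) (t : Fin n → Ix Θ m) :
    (fun i => subst (liftSub s) (liftSub t i)) = liftSub (fun i => subst s (t i)) := by
  funext i
  cases i using Fin.cases with
  | zero => rfl
  | succ i => exact subst_liftSub_wk s (t i)

/-- Fusion needs the two mixed laws for renaming and substitution first, because `liftSub` weakens
by a renaming. -/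
theorem subst_subst {n m k : ℕ} (s : Fin m → Ix Θ k) (t : Fin n → Ix Θ m) (I : Ix Θ n) :
    subst s (subst t I) = subst (fun i => subst s (t i)) I := by
  induction I generalizing m k with
  | var i => rfl
  | app f v ih => simp only [subst, ih]
  | sum I J ihI ihJ => simp only [subst, ihI, ihJ, liftSub_comp]
  | fc I J K ihI ihJ ihK => simp only [subst, ihI, ihJ, ihK, liftSub_comp]

theorem liftSub_var {n : ℕ} : liftSub (var : Fin n → Ix Θ n) = var := by
  funext i; cases i using Fin.cases <;> rfl

@[simp] theorem subst_id {n : ℕ} (I : Ix Θ n) : subst var I = I := by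
  induction I with
  | var i => rfl
  | app f v ih => simp only [subst, ih]
  | sum I J ihI ihJ => simp only [subst, liftSub_var, ihI, ihJ]
  | fc I J K ihI ihJ ihK => simp only [subst, liftSub_var, ihI, ihJ, ihK]

theorem wk_eq_subst {n : ℕ} (I : Ix Θ n) : I.wk = subst (fun i => var i.succ) I :=
  rename_eq_subst _ _

@[simp] theorem wk_var {n : ℕ} (i : Fin n) : (var i : Ix Θ n).wk = var i.succ := rfl

@[simp] theorem subst_single_wk {n m : ℕ} (J : Ix Θ m) (r : Fin n → Fin m) (I : Ix Θ n) :
    subst (single J r) I.wk = rename r I := by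
  rw [wk, subst_rename, rename_eq_subst]; rfl

@[simp] theorem rename_id {n : ℕ} (I : Ix Θ n) : rename id I = I := by
  rw [rename_eq_subst]; exact subst_id I

end Ix

/-! ### Substitution in types and in sums of types -/

namespace MTy

theorem subst_subst {n m k : ℕ} (s : Fin m → Ix Θ k) (t : Fin n → Ix Θ m) (σ : MTy Θ n) :
    subst s (subst t σ) = subst (fun i => (t i).subst s) σ := by
  induction σ generalizing m k with
  | nat I J => simp only [subst, Ix.subst_subst]
  | fn I σ τ ihσ ihτ => simp only [subst, Ix.subst_subst, ihσ, ihτ, Ix.liftSub_comp]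

@[simp] theorem subst_id {n : ℕ} (σ : MTy Θ n) : subst Ix.var σ = σ := by
  induction σ with
  | nat I J => simp only [subst, Ix.subst_id]
  | fn I σ τ ihσ ihτ => simp only [subst, Ix.subst_id, Ix.liftSub_var, ihσ, ihτ]

end MTy

namespace LTy

theorem subst_subst {n m k : ℕ} (s : Fin m → Ix Θ k) (t : Fin n → Ix Θ m) (A : LTy Θ n) :
    subst s (subst t A) = subst (fun i => (t i).subst s) A := by
  simp only [subst, MTy.subst_subst]

@[simp] theorem subst_id {n : ℕ} (A : LTy Θ n) : subst Ix.var A = A := by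
  simp only [subst, MTy.subst_id]

end LTy

theorem MTy.subst_bang {n m : ℕ} (s : Fin n → Ix Θ m) (I : Ix Θ n) (A : LTy Θ (n + 1)) :
    (MTy.bang I A).subst s = .bang (I.subst s) (A.subst (Ix.liftSub s)) := rfl

theorem Ix.subst_liftSub_comp_single {n m : ℕ} (s : Fin n → Ix Θ m) (I : Ix Θ n) :
    (fun i => (Ix.single I id i).subst s) =
      fun i => (Ix.liftSub s i).subst (Ix.single (I.subst s) id) := by
  funext i
  cases i using Fin.cases with
  | zero => rfl
  | succ i => simp

theorem MTy.at0_subst {n m : ℕ} (s : Fin n → Ix Θ m) (σ : MTy Θ (n + 1)) :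
    σ.at0.subst s = (σ.subst (Ix.liftSub s)).at0 := by
  simp only [MTy.at0, MTy.subst_subst, Ix.subst_liftSub_comp_single, Ix.subst_zero]

theorem LTy.at0_subst {n m : ℕ} (s : Fin n → Ix Θ m) (A : LTy Θ (n + 1)) :
    A.at0.subst s = (A.subst (Ix.liftSub s)).at0 := by
  simp only [LTy.at0, LTy.subst_subst, Ix.subst_liftSub_comp_single, Ix.subst_zero]

/-- Sums are relations between syntactic types, so here the composed substitutions must coincide
literally; agreement of values would not suffice. -/
theorem MSum.subst {n m : ℕ} (s : Fin n → Ix Θ m) {σ τ υ : MTy Θ n} (h : MSum σ τ υ) :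
    MSum (σ.subst s) (τ.subst s) (υ.subst s) := by
  cases h with
  | nat I J => exact .nat _ _
  | bang I J A =>
    have := MSum.bang (I.subst s) (J.subst s) (A.subst (Ix.liftSub s))
    simp only [MTy.subst_bang, Ix.subst_add]
    convert this using 2
    simp only [LTy.subst_subst]
    congr 1
    funext i
    cases i using Fin.cases with
    | zero => simp [Ix.subst_liftSub_wk]
    | succ i => simp [Ix.wk_eq_subst, Ix.subst_subst]

theorem BSum.subst {n m : ℕ} (s : Fin n → Ix Θ m) {I : Ix Θ n} {σ : MTy Θ (n + 1)}
    {υ : MTy Θ n} (h : BSum I σ υ) :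
    BSum (I.subst s) (σ.subst (Ix.liftSub s)) (υ.subst s) := by
  cases h with
  | nat J K =>
    simp only [MTy.subst, Ix.subst_liftSub_wk]
    exact .nat _ _
  | bang J A =>
    have := BSum.bang (I := I.subst s) (J.subst (Ix.liftSub s)) (A.subst (Ix.liftSub s))
    simp only [MTy.subst_bang, Ix.subst_sum]
    convert this using 2
    simp only [LTy.subst_subst]
    congr 1
    funext i
    cases i using Fin.cases with
    | zero =>
      simp only [Ix.single_zero, Ix.subst_add, Ix.subst_var, Ix.liftSub_zero, Ix.subst_sum,
        Ix.liftSub_one, Ix.wk_var, Ix.rename_eq_subst, Ix.subst_subst]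
      congr 3
      funext i
      cases i using Fin.cases with
      | zero => rfl
      | succ i => simp [Ix.wk_eq_subst, Ix.subst_subst]
    | succ i => simp [Ix.wk_eq_subst, Ix.subst_subst]

/-- Like the law for `fixRoot` below, this lets the fixpoint rule be reapplied verbatim after a
substitution. -/
theorem LTy.fixChild_subst {n m : ℕ} (s : Fin n → Ix Θ m) (B : LTy Θ (n + 2))
    (I : Ix Θ (n + 1)) :
    (B.fixChild I).subst (Ix.liftSub (Ix.liftSub s)) =
      (B.subst (Ix.liftSub (Ix.liftSub s))).fixChild (I.subst (Ix.liftSub s)) := by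
  simp only [LTy.fixChild, ← LTy.at0_subst, LTy.subst_subst]
  congr 1
  funext i
  cases i using Fin.cases with
  | zero =>
    simp only [Ix.single_zero, Ix.subst_add, Ix.subst_var, Ix.liftSub_zero, Ix.subst_fc,
      Ix.liftSub_one, Ix.wk_var, Ix.rename_eq_subst, Ix.subst_subst, Ix.subst_one]
    congr 4
    funext i
    cases i using Fin.cases with
    | zero => rfl
    | succ i => simp [Ix.wk_eq_subst, Ix.subst_subst]
  | succ i => simp [Ix.wk_eq_subst, Ix.subst_subst]

theorem LTy.fixRoot_subst {n m : ℕ} (s : Fin n → Ix Θ m) (B : LTy Θ (n + 2))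
    (I : Ix Θ (n + 1)) :
    (B.fixRoot I).subst (Ix.liftSub s) =
      (B.subst (Ix.liftSub (Ix.liftSub s))).fixRoot (I.subst (Ix.liftSub s)) := by
  simp only [LTy.fixRoot, ← LTy.at0_subst, LTy.subst_subst]
  congr 1
  funext i
  cases i using Fin.cases with
  | zero =>
    simp only [Ix.single_zero, Ix.subst_var, Ix.liftSub_zero, Ix.subst_fc, Ix.subst_zero,
      Ix.rename_eq_subst, Ix.subst_subst]
    congr 2
    funext i
    cases i using Fin.cases with
    | zero => rfl
    | succ i => simp [Ix.wk_eq_subst, Ix.subst_subst]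
  | succ i => simp [Ix.wk_eq_subst, Ix.subst_subst]

/-! ## Forest cardinalities -/

namespace ForestCard

variable {K : ℕ → ℕ → Prop}

theorem det (hK : ∀ b k k', K b k → K b k' → k = k') {i j r r' : ℕ}
    (h : ForestCard K i j r) (h' : ForestCard K i j r') : r = r' := by
  induction h generalizing r' with
  | zero i => cases h'; rfl
  | succ h₁ hk h₂ ih₁ ih₂ =>
    cases h' with
    | succ h₁' hk' h₂' =>
      obtain rfl := ih₁ h₁'
      obtain rfl := hK _ _ _ hk hk'
      obtain rfl := ih₂ h₂'
      rfl

/-- In pre-order the first `j₁` trees occupy an initial segment of the numbering. The induction is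
on `j₂` because the defining equation peels off the last tree. -/
theorem add_iff {i j₁ j₂ r : ℕ} :
    ForestCard K i (j₁ + j₂) r ↔
      ∃ r₁ r₂, ForestCard K i j₁ r₁ ∧ ForestCard K (i + r₁) j₂ r₂ ∧ r = r₁ + r₂ := by
  induction j₂ generalizing r with
  | zero =>
    constructor
    · intro h; exact ⟨r, 0, h, .zero _, rfl⟩
    · rintro ⟨r₁, r₂, h₁, h₂, rfl⟩; cases h₂; exact h₁
  | succ j₂ ih =>
    constructor
    · intro h
      rw [← add_assoc] at h
      cases h with
      | @succ _ _ r k s h hk hs =>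
        obtain ⟨r₁, r₂, h₁, h₂, rfl⟩ := ih.1 h
        refine ⟨r₁, r₂ + 1 + s, h₁, .succ (k := k) h₂ ?_ ?_, by omega⟩
        · rwa [add_assoc]
        · rwa [show i + r₁ + 1 + r₂ = i + 1 + (r₁ + r₂) by omega]
    · rintro ⟨r₁, r₂, h₁, h₂, rfl⟩
      cases h₂ with
      | @succ _ _ r k s h hk hs =>
        have := ForestCard.succ (ih.2 ⟨r₁, r, h₁, h, rfl⟩) (k := k) (s := s)
          (by rwa [← add_assoc]) (by rwa [show i + 1 + (r₁ + r) = i + r₁ + 1 + r by omega])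
        rwa [show r₁ + r + 1 + s = r₁ + (r + 1 + s) by omega] at this

theorem one_iff {i r : ℕ} :
    ForestCard K i 1 r ↔ ∃ k s, K i k ∧ ForestCard K (i + 1) k s ∧ r = 1 + s := by
  constructor
  · intro h
    cases h with
    | @succ _ _ r k s h hk hs => cases h; exact ⟨k, s, hk, hs, by omega⟩
  · rintro ⟨k, s, hk, hs, rfl⟩
    have := ForestCard.succ (.zero i) hk hs
    rwa [zero_add] at this

/-- Renumbering: translating the description of the children by `d` amounts to starting the
numbering `d` later. -/
theorem shift_iff {d i j r : ℕ} :
    ForestCard (fun b => K (d + b)) i j r ↔ ForestCard K (d + i) j r := by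
  constructor
  · intro h
    induction h with
    | zero i => exact .zero _
    | succ h₁ hk h₂ ih₁ ih₂ =>
      refine .succ ih₁ (by rwa [add_assoc]) ?_
      rw [← add_assoc, ← add_assoc] at ih₂
      exact ih₂
  · intro h
    generalize hi : d + i = i' at h
    induction h generalizing i with
    | zero i => exact .zero _
    | succ h₁ hk h₂ ih₁ ih₂ =>
      subst hi
      exact .succ (ih₁ rfl) (by rwa [← add_assoc]) (ih₂ (by omega))

theorem le {i j r : ℕ} (h : ForestCard K i j r) : j ≤ r := by
  induction h with
  | zero => exact le_rfl
  | succ => omega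

/-- The descendants of a node of a forest form a forest. -/
theorem node {i j r b : ℕ} (h : ForestCard K i j r) (h₁ : i ≤ b) (h₂ : b < i + r) :
    ∃ k s, K b k ∧ ForestCard K (b + 1) k s ∧ b + 1 + s ≤ i + r := by
  induction h with
  | zero => omega
  | @succ i j r k s h hk hs ih ih' =>
    by_cases hb : b < i + r
    · obtain ⟨k', s', h⟩ := ih h₁ hb
      exact ⟨k', s', h.1, h.2.1, by omega⟩
    · by_cases hb' : b = i + r
      · subst hb'
        exact ⟨k, s, hk, by rwa [show i + r + 1 = i + 1 + r by omega], by omega⟩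
      · obtain ⟨k', s', h⟩ := ih' (by omega) (by omega)
        exact ⟨k', s', h.1, h.2.1, by omega⟩

/-- An initial segment of a forest is a forest. -/
theorem prefix_lt {i j r j' : ℕ} (h : ForestCard K i j r) (hj : j' < j) :
    ∃ r', ForestCard K i j' r' ∧ r' < r := by
  obtain ⟨c, rfl⟩ := Nat.exists_eq_add_of_lt hj
  rw [add_assoc] at h
  obtain ⟨r₁, r₂, h₁, h₂, rfl⟩ := add_iff.1 h
  have := h₂.le
  exact ⟨r₁, h₁, by omega⟩

theorem prefix_le {i j r j' : ℕ} (h : ForestCard K i j r) (hj : j' ≤ j) :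
    ∃ r', ForestCard K i j' r' ∧ r' ≤ r := by
  rcases hj.lt_or_eq with hj | rfl
  · obtain ⟨r', h₁, h₂⟩ := h.prefix_lt hj; exact ⟨r', h₁, h₂.le⟩
  · exact ⟨r, h, le_rfl⟩

end ForestCard

/-! ## Semantics of index terms -/

theorem Ix.Eval.det {𝓘 : Interp Θ} {n : ℕ} {I : Ix Θ n} {ρ : Fin n → ℕ} {m m' : ℕ}
    (h : I.Eval 𝓘 ρ m) (h' : I.Eval 𝓘 ρ m') : m = m' := by
  induction I generalizing m m' with
  | var i => exact Eq.trans h (Eq.symm h')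
  | app f v ih =>
    obtain ⟨w, hw, hm⟩ := h
    obtain ⟨w', hw', hm'⟩ := h'
    obtain rfl : w = w' := funext fun i => ih i (hw i) (hw' i)
    exact Part.mem_unique hm hm'
  | sum I J ihI ihJ =>
    obtain ⟨k, hk, v, hv, rfl⟩ := h
    obtain ⟨k', hk', v', hv', rfl⟩ := h'
    obtain rfl := ihI hk hk'
    exact Finset.sum_congr rfl fun a ha =>
      ihJ (hv a (Finset.mem_range.1 ha)) (hv' a (Finset.mem_range.1 ha))
  | fc I J K ihI ihJ ihK =>
    obtain ⟨i, j, hi, hj, h⟩ := h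
    obtain ⟨i', j', hi', hj', h'⟩ := h'
    obtain rfl := ihI hi hi'
    obtain rfl := ihJ hj hj'
    exact ForestCard.det (K := fun b k => K.Eval 𝓘 (Fin.cons b ρ) k)
      (fun b k k' hk hk' => ihK hk hk') h h'

theorem Ix.eval_rename {𝓘 : Interp Θ} {n m : ℕ} {r : Fin n → Fin m} {I : Ix Θ n}
    {ρ : Fin m → ℕ} {k : ℕ} : (I.rename r).Eval 𝓘 ρ k ↔ I.Eval 𝓘 (fun i => ρ (r i)) k := by
  have key : ∀ {n m : ℕ} (r : Fin n → Fin m) (ρ : Fin m → ℕ) (a : ℕ),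
      (fun i => (Fin.cons a ρ : Fin (m + 1) → ℕ) (Ix.liftRen r i)) =
        Fin.cons a (fun i => ρ (r i)) := by
    intro n m r ρ a; funext i; cases i using Fin.cases <;> rfl
  induction I generalizing m k with
  | var i => rfl
  | app f v ih => simp only [Ix.rename, Ix.Eval, ih]
  | sum I J ihI ihJ => simp only [Ix.rename, Ix.Eval, ihI, ihJ, key]
  | fc I J K ihI ihJ ihK => simp only [Ix.rename, Ix.Eval, ihI, ihJ, ihK, key]

theorem Ix.eval_wk {𝓘 : Interp Θ} {n : ℕ} {I : Ix Θ n} {ρ : Fin n → ℕ} {a k : ℕ} :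
    I.wk.Eval 𝓘 (Fin.cons a ρ) k ↔ I.Eval 𝓘 ρ k := by
  rw [Ix.wk, Ix.eval_rename]; rfl

/-- Since evaluation is a relation, the equivalence also transports undefinedness of `I`. The
substituted terms themselves must all have values, including those for variables that do not occur.
-/
theorem Ix.eval_subst {𝓘 : Interp Θ} {n m : ℕ} {s : Fin n → Ix Θ m} {I : Ix Θ n}
    {ρ : Fin m → ℕ} {v : Fin n → ℕ} (hs : ∀ i, (s i).Eval 𝓘 ρ (v i)) {k : ℕ} :
    (I.subst s).Eval 𝓘 ρ k ↔ I.Eval 𝓘 v k := by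
  have key : ∀ {n m : ℕ} {s : Fin n → Ix Θ m} {ρ : Fin m → ℕ} {v : Fin n → ℕ}
      (_ : ∀ i, (s i).Eval 𝓘 ρ (v i)) (a : ℕ) (i : Fin (n + 1)),
      (Ix.liftSub s i).Eval 𝓘 (Fin.cons a ρ) ((Fin.cons a v : Fin (n + 1) → ℕ) i) := by
    intro n m s ρ v hs a i
    cases i using Fin.cases with
    | zero => rfl
    | succ i => exact Ix.eval_wk.2 (hs i)
  induction I generalizing m k with
  | var i => exact ⟨fun h => h.det (hs i), fun h => by rw [show k = v i from h]; exact hs i⟩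
  | app f w ih => simp only [Ix.subst, Ix.Eval, ih _ hs]
  | sum I J ihI ihJ => simp only [Ix.subst, Ix.Eval, ihI hs, fun a => ihJ (key hs a)]
  | fc I J K ihI ihJ ihK =>
    have := fun a k => propext (ihK (key hs a) (k := k))
    simp only [Ix.subst, Ix.Eval, ihI hs, ihJ hs, this]

/-- `I` has a value under the assignment `ρ`. -/
def Ix.Dfd (𝓘 : Interp Θ) {n : ℕ} (I : Ix Θ n) (ρ : Fin n → ℕ) : Prop := ∃ m, I.Eval 𝓘 ρ m

open Classical in
/-- The value of `I` under the assignment `ρ`, and `0` if there is none. -/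
noncomputable def Ix.ev (𝓘 : Interp Θ) {n : ℕ} (I : Ix Θ n) (ρ : Fin n → ℕ) : ℕ :=
  if h : I.Dfd 𝓘 ρ then h.choose else 0

namespace Ix

variable {𝓘 : Interp Θ} {n m : ℕ} {I J : Ix Θ n} {ρ : Fin n → ℕ}

theorem Dfd.eval (h : I.Dfd 𝓘 ρ) : I.Eval 𝓘 ρ (I.ev 𝓘 ρ) := by
  rw [Ix.ev, dif_pos h]; exact h.choose_spec

theorem Eval.dfd {k : ℕ} (h : I.Eval 𝓘 ρ k) : I.Dfd 𝓘 ρ := ⟨k, h⟩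

theorem Eval.ev_eq {k : ℕ} (h : I.Eval 𝓘 ρ k) : I.ev 𝓘 ρ = k := h.dfd.eval.det h

theorem dfd_ev_congr {n' : ℕ} {I' : Ix Θ n'} {ρ' : Fin n' → ℕ}
    (h : ∀ k, I.Eval 𝓘 ρ k ↔ I'.Eval 𝓘 ρ' k) :
    (I.Dfd 𝓘 ρ ↔ I'.Dfd 𝓘 ρ') ∧ I.ev 𝓘 ρ = I'.ev 𝓘 ρ' := by
  have h₁ : I.Dfd 𝓘 ρ ↔ I'.Dfd 𝓘 ρ' := exists_congr h
  refine ⟨h₁, ?_⟩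
  by_cases hd : I.Dfd 𝓘 ρ
  · exact ((h _).2 (h₁.1 hd).eval).ev_eq
  · rw [ev, ev, dif_neg hd, dif_neg (h₁.not.1 hd)]

@[simp] theorem dfd_var {i : Fin n} : (var i : Ix Θ n).Dfd 𝓘 ρ := ⟨_, rfl⟩
@[simp] theorem ev_var {i : Fin n} : (var i : Ix Θ n).ev 𝓘 ρ = ρ i :=
  Eval.ev_eq (I := var i) rfl

theorem eval_zero : (0 : Ix Θ n).Eval 𝓘 ρ 0 :=
  ⟨![], fun i => i.elim0, by rw [𝓘.fn_zero]; exact Part.mem_some _⟩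
theorem eval_one : (1 : Ix Θ n).Eval 𝓘 ρ 1 :=
  ⟨![], fun i => i.elim0, by rw [𝓘.fn_one]; exact Part.mem_some _⟩

theorem eval_add {k : ℕ} : (I + J).Eval 𝓘 ρ k ↔
    ∃ p q, I.Eval 𝓘 ρ p ∧ J.Eval 𝓘 ρ q ∧ k = p + q := by
  constructor
  · rintro ⟨v, hv, hk⟩
    rw [𝓘.fn_add] at hk
    exact ⟨v 0, v 1, hv 0, hv 1, Part.mem_some_iff.1 hk⟩
  · rintro ⟨p, q, hp, hq, rfl⟩
    refine ⟨![p, q], fun i => ?_, by rw [𝓘.fn_add]; exact Part.mem_some _⟩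
    fin_cases i
    exacts [hp, hq]

theorem eval_sub {k : ℕ} : (I - J).Eval 𝓘 ρ k ↔
    ∃ p q, I.Eval 𝓘 ρ p ∧ J.Eval 𝓘 ρ q ∧ k = p - q := by
  constructor
  · rintro ⟨v, hv, hk⟩
    rw [𝓘.fn_monus] at hk
    exact ⟨v 0, v 1, hv 0, hv 1, Part.mem_some_iff.1 hk⟩
  · rintro ⟨p, q, hp, hq, rfl⟩
    refine ⟨![p, q], fun i => ?_, by rw [𝓘.fn_monus]; exact Part.mem_some _⟩
    fin_cases i
    exacts [hp, hq]

@[simp] theorem dfd_zero : (0 : Ix Θ n).Dfd 𝓘 ρ := eval_zero.dfd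
@[simp] theorem ev_zero : (0 : Ix Θ n).ev 𝓘 ρ = 0 := eval_zero.ev_eq
@[simp] theorem dfd_one : (1 : Ix Θ n).Dfd 𝓘 ρ := eval_one.dfd
@[simp] theorem ev_one : (1 : Ix Θ n).ev 𝓘 ρ = 1 := eval_one.ev_eq

@[simp] theorem dfd_add : (I + J).Dfd 𝓘 ρ ↔ I.Dfd 𝓘 ρ ∧ J.Dfd 𝓘 ρ :=
  ⟨fun ⟨_, h⟩ => let ⟨_, _, hp, hq, _⟩ := eval_add.1 h; ⟨hp.dfd, hq.dfd⟩,
    fun ⟨h, h'⟩ => ⟨_, eval_add.2 ⟨_, _, h.eval, h'.eval, rfl⟩⟩⟩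
@[simp] theorem dfd_sub : (I - J).Dfd 𝓘 ρ ↔ I.Dfd 𝓘 ρ ∧ J.Dfd 𝓘 ρ :=
  ⟨fun ⟨_, h⟩ => let ⟨_, _, hp, hq, _⟩ := eval_sub.1 h; ⟨hp.dfd, hq.dfd⟩,
    fun ⟨h, h'⟩ => ⟨_, eval_sub.2 ⟨_, _, h.eval, h'.eval, rfl⟩⟩⟩
theorem ev_add (h : I.Dfd 𝓘 ρ) (h' : J.Dfd 𝓘 ρ) :
    (I + J).ev 𝓘 ρ = I.ev 𝓘 ρ + J.ev 𝓘 ρ :=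
  (eval_add.2 ⟨_, _, h.eval, h'.eval, rfl⟩).ev_eq
theorem ev_sub (h : I.Dfd 𝓘 ρ) (h' : J.Dfd 𝓘 ρ) :
    (I - J).ev 𝓘 ρ = I.ev 𝓘 ρ - J.ev 𝓘 ρ :=
  (eval_sub.2 ⟨_, _, h.eval, h'.eval, rfl⟩).ev_eq

theorem eval_numeral (k : ℕ) : (numeral k : Ix Θ n).Eval 𝓘 ρ k := by
  induction k using Nat.twoStepInduction with
  | zero => exact eval_zero
  | one => exact eval_one
  | more k _ ih => exact eval_add.2 ⟨_, _, ih, eval_one, rfl⟩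

@[simp] theorem dfd_numeral {k : ℕ} : (numeral k : Ix Θ n).Dfd 𝓘 ρ := (eval_numeral k).dfd
@[simp] theorem ev_numeral {k : ℕ} : (numeral k : Ix Θ n).ev 𝓘 ρ = k := (eval_numeral k).ev_eq

@[simp] theorem dfd_wk {a : ℕ} : I.wk.Dfd 𝓘 (Fin.cons a ρ) ↔ I.Dfd 𝓘 ρ :=
  (dfd_ev_congr fun _ => eval_wk).1
@[simp] theorem ev_wk {a : ℕ} : I.wk.ev 𝓘 (Fin.cons a ρ) = I.ev 𝓘 ρ :=
  (dfd_ev_congr fun _ => eval_wk).2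
theorem dfd_rename {r : Fin m → Fin n} {I : Ix Θ m} :
    (I.rename r).Dfd 𝓘 ρ ↔ I.Dfd 𝓘 (fun i => ρ (r i)) :=
  (dfd_ev_congr fun _ => eval_rename).1
theorem ev_rename {r : Fin m → Fin n} {I : Ix Θ m} :
    (I.rename r).ev 𝓘 ρ = I.ev 𝓘 (fun i => ρ (r i)) :=
  (dfd_ev_congr fun _ => eval_rename).2
theorem dfd_subst {s : Fin m → Ix Θ n} {I : Ix Θ m} {v : Fin m → ℕ}
    (hs : ∀ i, (s i).Eval 𝓘 ρ (v i)) : (I.subst s).Dfd 𝓘 ρ ↔ I.Dfd 𝓘 v :=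
  (dfd_ev_congr fun _ => eval_subst hs).1
theorem ev_subst {s : Fin m → Ix Θ n} {I : Ix Θ m} {v : Fin m → ℕ}
    (hs : ∀ i, (s i).Eval 𝓘 ρ (v i)) : (I.subst s).ev 𝓘 ρ = I.ev 𝓘 v :=
  (dfd_ev_congr fun _ => eval_subst hs).2

theorem eval_sum {K : Ix Θ (n + 1)} {k : ℕ} : (sum I K).Eval 𝓘 ρ k ↔
    I.Dfd 𝓘 ρ ∧ (∀ a < I.ev 𝓘 ρ, K.Dfd 𝓘 (Fin.cons a ρ)) ∧
      k = ∑ a ∈ Finset.range (I.ev 𝓘 ρ), K.ev 𝓘 (Fin.cons a ρ) := by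
  constructor
  · rintro ⟨l, hl, v, hv, rfl⟩
    obtain rfl := hl.ev_eq
    exact ⟨hl.dfd, fun a ha => (hv a ha).dfd,
      Finset.sum_congr rfl fun a ha => (hv a (Finset.mem_range.1 ha)).ev_eq.symm⟩
  · rintro ⟨h, h', rfl⟩
    exact ⟨_, h.eval, _, fun a ha => (h' a ha).eval, rfl⟩

theorem dfd_sum {K : Ix Θ (n + 1)} : (sum I K).Dfd 𝓘 ρ ↔
    I.Dfd 𝓘 ρ ∧ ∀ a < I.ev 𝓘 ρ, K.Dfd 𝓘 (Fin.cons a ρ) :=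
  ⟨fun ⟨_, h⟩ => ⟨(eval_sum.1 h).1, (eval_sum.1 h).2.1⟩,
    fun h => ⟨_, eval_sum.2 ⟨h.1, h.2, rfl⟩⟩⟩

theorem ev_sum {K : Ix Θ (n + 1)} (h : (sum I K).Dfd 𝓘 ρ) :
    (sum I K).ev 𝓘 ρ = ∑ a ∈ Finset.range (I.ev 𝓘 ρ), K.ev 𝓘 (Fin.cons a ρ) :=
  (eval_sum.2 ⟨(dfd_sum.1 h).1, (dfd_sum.1 h).2, rfl⟩).ev_eq

theorem eval_fc {K : Ix Θ (n + 1)} {k : ℕ} : (fc I J K).Eval 𝓘 ρ k ↔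
    I.Dfd 𝓘 ρ ∧ J.Dfd 𝓘 ρ ∧
      ForestCard (fun b k => K.Eval 𝓘 (Fin.cons b ρ) k) (I.ev 𝓘 ρ) (J.ev 𝓘 ρ) k := by
  constructor
  · rintro ⟨i, j, hi, hj, h⟩
    obtain rfl := hi.ev_eq
    obtain rfl := hj.ev_eq
    exact ⟨hi.dfd, hj.dfd, h⟩
  · rintro ⟨hi, hj, h⟩
    exact ⟨_, _, hi.eval, hj.eval, h⟩

end Ix

/-! ## Satisfaction and entailment -/

/-- The assignment `ρ` satisfies `Φ`. -/
def Sat (ℰ : EqProgram Θ) {n : ℕ} (Φ : ICtx Θ n) (ρ : Fin n → ℕ) : Prop :=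
  ∀ d ∈ Φ, d.Holds ℰ ρ

variable {ℰ : EqProgram Θ} {n : ℕ} {Φ Ψ : ICtx Θ n} {I J : Ix Θ n} {ρ : Fin n → ℕ}

theorem holds_cle : (cle I J).Holds ℰ ρ ↔
    I.Dfd ℰ.sem ρ ∧ J.Dfd ℰ.sem ρ ∧ I.ev ℰ.sem ρ ≤ J.ev ℰ.sem ρ := by
  constructor
  · rintro ⟨p, q, hp, hq, h⟩
    exact ⟨hp.dfd, hq.dfd, hp.ev_eq.trans_le (h.trans_eq hq.ev_eq.symm)⟩
  · rintro ⟨hp, hq, h⟩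
    exact ⟨_, _, hp.eval, hq.eval, h⟩

theorem holds_clt : (clt I J).Holds ℰ ρ ↔
    I.Dfd ℰ.sem ρ ∧ J.Dfd ℰ.sem ρ ∧ I.ev ℰ.sem ρ < J.ev ℰ.sem ρ := by
  rw [show clt I J = cle (I + 1) J from rfl, holds_cle]
  constructor
  · rintro ⟨h, h', h''⟩
    have hI := (Ix.dfd_add.1 h).1
    rw [Ix.ev_add hI Ix.dfd_one, Ix.ev_one] at h''
    exact ⟨hI, h', h''⟩
  · rintro ⟨h, h', h''⟩
    refine ⟨Ix.dfd_add.2 ⟨h, Ix.dfd_one⟩, h', ?_⟩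
    rwa [Ix.ev_add h Ix.dfd_one, Ix.ev_one]

theorem entails_cle : Entails ℰ Φ (cle I J) ↔ ∀ ρ, Sat ℰ Φ ρ →
    I.Dfd ℰ.sem ρ ∧ J.Dfd ℰ.sem ρ ∧ I.ev ℰ.sem ρ ≤ J.ev ℰ.sem ρ :=
  forall_congr' fun _ => imp_congr Iff.rfl holds_cle

theorem entails_clt : Entails ℰ Φ (clt I J) ↔ ∀ ρ, Sat ℰ Φ ρ →
    I.Dfd ℰ.sem ρ ∧ J.Dfd ℰ.sem ρ ∧ I.ev ℰ.sem ρ < J.ev ℰ.sem ρ :=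
  forall_congr' fun _ => imp_congr Iff.rfl holds_clt

theorem ixDefined_iff : IxDefined ℰ Φ I ↔ ∀ ρ, Sat ℰ Φ ρ → I.Dfd ℰ.sem ρ := by
  rw [IxDefined, entails_cle]
  exact forall_congr' fun _ => imp_congr_right fun _ => ⟨fun h => h.1, fun h => ⟨h, h, le_rfl⟩⟩

theorem sat_insert {c : Constraint Θ n} : Sat ℰ (insert c Φ) ρ ↔ c.Holds ℰ ρ ∧ Sat ℰ Φ ρ :=
  Set.forall_mem_insert

theorem sat_below {a : ℕ} : Sat ℰ (Φ.below I) (Fin.cons a ρ) ↔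
    (I.Dfd ℰ.sem ρ ∧ a < I.ev ℰ.sem ρ) ∧ Sat ℰ Φ ρ := by
  rw [ICtx.below, sat_insert, holds_clt, Ix.dfd_wk, Ix.ev_wk, Ix.ev_var, Fin.cons_zero]
  refine and_congr (by simp) ?_
  rw [Sat, Set.forall_mem_image]
  refine forall_congr' fun d => imp_congr_right fun _ => ?_
  exact (holds_cle (I := d.lhs.wk) (J := d.rhs.wk)).trans
    (by rw [Ix.dfd_wk, Ix.dfd_wk, Ix.ev_wk, Ix.ev_wk]; exact holds_cle.symm)

theorem sat_below' {ρ : Fin (n + 1) → ℕ} : Sat ℰ (Φ.below I) ρ ↔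
    ∃ a ρ', ρ = Fin.cons a ρ' ∧ I.Dfd ℰ.sem ρ' ∧ a < I.ev ℰ.sem ρ' ∧ Sat ℰ Φ ρ' := by
  constructor
  · intro h
    rw [← Fin.cons_self_tail ρ, sat_below] at h
    exact ⟨ρ 0, Fin.tail ρ, (Fin.cons_self_tail ρ).symm, h.1.1, h.1.2, h.2⟩
  · rintro ⟨a, ρ', rfl, h, h', h''⟩
    exact sat_below.2 ⟨⟨h, h'⟩, h''⟩

/-! ## Substitution in subtyping and typing judgements -/

/-- Under `Φ`, the substitutions `s` and `s'` are defined and have the same values, and these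
satisfy `Ψ`. -/
def SubstAgree (ℰ : EqProgram Θ) {n m : ℕ} (Φ : ICtx Θ m) (Ψ : ICtx Θ n) (s s' : Fin n → Ix Θ m) :
    Prop :=
  ∀ ρ, Sat ℰ Φ ρ →
    ∃ v, (∀ i, (s i).Eval ℰ.sem ρ (v i)) ∧ (∀ i, (s' i).Eval ℰ.sem ρ (v i)) ∧ Sat ℰ Ψ v

section

variable {ℰ : EqProgram Θ} {n m : ℕ} {Φ : ICtx Θ m} {Ψ : ICtx Θ n} {s s' : Fin n → Ix Θ m}

theorem SubstAgree.symm (h : SubstAgree ℰ Φ Ψ s s') : SubstAgree ℰ Φ Ψ s' s := fun ρ hρ =>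
  let ⟨v, h₁, h₂, h₃⟩ := h ρ hρ
  ⟨v, h₂, h₁, h₃⟩

theorem SubstAgree.left (h : SubstAgree ℰ Φ Ψ s s') : SubstAgree ℰ Φ Ψ s s := fun ρ hρ =>
  let ⟨v, h₁, _, h₃⟩ := h ρ hρ
  ⟨v, h₁, h₁, h₃⟩

theorem SubstAgree.of_sat {Φ Ψ : ICtx Θ n} (h : ∀ ρ, Sat ℰ Φ ρ → Sat ℰ Ψ ρ) :
    SubstAgree ℰ Φ Ψ Ix.var Ix.var := fun ρ hρ => ⟨ρ, fun _ => rfl, fun _ => rfl, h ρ hρ⟩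

theorem eval_liftSub {s : Fin n → Ix Θ m} {ρ : Fin m → ℕ} {v : Fin n → ℕ}
    (hs : ∀ i, (s i).Eval ℰ.sem ρ (v i)) (a : ℕ) (i : Fin (n + 1)) :
    (Ix.liftSub s i).Eval ℰ.sem (Fin.cons a ρ) ((Fin.cons a v : Fin (n + 1) → ℕ) i) := by
  cases i using Fin.cases with
  | zero => rfl
  | succ i => exact Ix.eval_wk.2 (hs i)

theorem SubstAgree.lift (h : SubstAgree ℰ Φ Ψ s s') (I : Ix Θ n) :
    SubstAgree ℰ (Φ.below (I.subst s)) (Ψ.below I) (Ix.liftSub s) (Ix.liftSub s') := by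
  intro ρ hρ
  obtain ⟨a, ρ, rfl, hI, ha, hΦ⟩ := sat_below'.1 hρ
  obtain ⟨v, h₁, h₂, h₃⟩ := h ρ hΦ
  refine ⟨Fin.cons a v, eval_liftSub h₁ a, eval_liftSub h₂ a, sat_below.2 ⟨⟨?_, ?_⟩, h₃⟩⟩
  · exact (Ix.dfd_subst h₁).1 hI
  · rwa [← Ix.ev_subst h₁]

theorem SubstAgree.insert (h : SubstAgree ℰ Φ Ψ s s') (I J : Ix Θ n) :
    SubstAgree ℰ (insert (cle (I.subst s) (J.subst s)) Φ) (insert (cle I J) Ψ) s s' := by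
  intro ρ hρ
  rw [sat_insert, holds_cle] at hρ
  obtain ⟨v, h₁, h₂, h₃⟩ := h ρ hρ.2
  refine ⟨v, h₁, h₂, sat_insert.2 ⟨holds_cle.2 ?_, h₃⟩⟩
  simpa only [Ix.dfd_subst h₁, Ix.ev_subst h₁] using hρ.1

theorem Entails.subst₂ {I J : Ix Θ n} (h : Entails ℰ Ψ (cle I J)) (hs : SubstAgree ℰ Φ Ψ s s') :
    Entails ℰ Φ (cle (I.subst s) (J.subst s')) := by
  rw [entails_cle] at h ⊢
  intro ρ hρ
  obtain ⟨v, h₁, h₂, h₃⟩ := hs ρ hρ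
  rw [Ix.dfd_subst h₁, Ix.dfd_subst h₂, Ix.ev_subst h₁, Ix.ev_subst h₂]
  exact h v h₃

/-- Allowing different substitutions on the two sides is what later identifies types whose indices
are equal in value but not in syntax. -/
theorem Subty.subst₂ {σ τ : MTy Θ n} (h : Subty ℰ Ψ σ τ) (hs : SubstAgree ℰ Φ Ψ s s') :
    Subty ℰ Φ (σ.subst s) (τ.subst s') := by
  induction h generalizing m with
  | nat h₁ h₂ => exact .nat (h₁.subst₂ hs.symm) (h₂.subst₂ hs)
  | @fn _ _ I J _ _ _ _ _ _ hJ ih₁ ih₂ =>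
    -- The bound `J` belongs to the right-hand type and is substituted by `s'`, so the lift starts
    -- from `hs.symm`; the contravariant domain uses it as is, the codomain its symmetric form.
    exact .fn (ih₁ (hs.symm.lift J)) (ih₂ (hs.symm.lift J).symm) (hJ.subst₂ hs.symm)

theorem Subty.mono {Φ Ψ : ICtx Θ n} {σ τ : MTy Θ n} (h : Subty ℰ Ψ σ τ)
    (hs : ∀ ρ, Sat ℰ Φ ρ → Sat ℰ Ψ ρ) : Subty ℰ Φ σ τ := by
  simpa using h.subst₂ (SubstAgree.of_sat hs)

theorem sat_below_mono {Φ Ψ : ICtx Θ n} {I J : Ix Θ n}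
    (h : ∀ ρ, Sat ℰ Φ ρ → Sat ℰ Ψ ρ) (hIJ : Entails ℰ Φ (cle I J)) :
    ∀ ρ, Sat ℰ (Φ.below I) ρ → Sat ℰ (Ψ.below J) ρ := by
  intro ρ hρ
  obtain ⟨a, ρ, rfl, hI, ha, hΦ⟩ := sat_below'.1 hρ
  have := entails_cle.1 hIJ ρ hΦ
  exact sat_below.2 ⟨⟨this.2.1, by omega⟩, h ρ hΦ⟩

theorem Entails.trans {Φ : ICtx Θ n} {I J K : Ix Θ n} (h₁ : Entails ℰ Φ (cle I J))
    (h₂ : Entails ℰ Φ (cle J K)) : Entails ℰ Φ (cle I K) := by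
  rw [entails_cle] at *
  intro ρ hρ
  have := h₁ ρ hρ
  have := h₂ ρ hρ
  exact ⟨by tauto, by tauto, by omega⟩

/-- Induction on the middle type. The two premises live under different bounds, and the one with the
larger bound restricts to the smaller. -/
theorem Subty.trans {Φ : ICtx Θ n} {σ τ υ : MTy Θ n} (h₁ : Subty ℰ Φ σ τ)
    (h₂ : Subty ℰ Φ τ υ) : Subty ℰ Φ σ υ := by
  induction τ with
  | nat I J =>
    cases h₁ with
    | nat h h' => cases h₂ with
      | nat k k' => exact .nat (k.trans h) (h'.trans k')
  | fn I σ τ ihσ ihτ =>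
    cases h₁ with
    | fn h h' hI => cases h₂ with
      | fn k k' hJ =>
        have := sat_below_mono (ℰ := ℰ) (Φ := Φ) (fun _ h => h) hJ
        exact .fn (ihσ k (h.mono this)) (ihτ (h'.mono this) k') (hJ.trans hI)

/-- Under inconsistent constraints all types are defined. -/
theorem TyDefined.of_not_sat {Φ : ICtx Θ n} (h : ∀ ρ, ¬ Sat ℰ Φ ρ) (σ : MTy Θ n) :
    TyDefined ℰ Φ σ := by
  induction σ with
  | nat I J => exact .nat (fun ρ hρ => (h ρ hρ).elim) (fun ρ hρ => (h ρ hρ).elim)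
  | fn I σ τ ihσ ihτ =>
    have : ∀ ρ, ¬ Sat ℰ (Φ.below I) ρ := fun ρ hρ => by
      obtain ⟨_, _, _, _, _, h'⟩ := sat_below'.1 hρ
      exact h _ h'
    exact .fn (ihσ this) (ihτ this) (fun ρ hρ => (h ρ hρ).elim)

end

/-- Substitution of index terms in contexts. -/
def Ctx.subst {n m : ℕ} (s : Fin n → Ix Θ m) (Γ : Ctx Θ n) : Ctx Θ m :=
  fun x => (Γ x).map (MTy.subst s)

@[simp] theorem Ctx.subst_var {n : ℕ} (Γ : Ctx Θ n) : Γ.subst Ix.var = Γ := by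
  funext x
  have : (MTy.subst Ix.var : MTy Θ n → MTy Θ n) = id := funext MTy.subst_id
  rw [Ctx.subst, this, Option.map_id, id]

theorem Ctx.subst_cons {n m : ℕ} (s : Fin n → Ix Θ m) (σ : MTy Θ n) (Γ : Ctx Θ n) :
    (Ctx.cons σ Γ).subst s = Ctx.cons (σ.subst s) (Γ.subst s) := by
  funext x; cases x <;> rfl

theorem Ctx.subst_eq_some {n m : ℕ} {s : Fin n → Ix Θ m} {Γ : Ctx Θ n} {x : ℕ} {τ : MTy Θ m} :
    Γ.subst s x = some τ ↔ ∃ σ, Γ x = some σ ∧ σ.subst s = τ := Option.map_eq_some_iff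

theorem Ctx.IsSum.subst {n m : ℕ} (s : Fin n → Ix Θ m) {Γ Δ Ξ : Ctx Θ n}
    (h : Ctx.IsSum Γ Δ Ξ) : Ctx.IsSum (Γ.subst s) (Δ.subst s) (Ξ.subst s) := by
  intro x
  have := h x
  simp only [Ctx.subst]
  generalize Γ x = o₁, Δ x = o₂, Ξ x = o₃ at this
  cases this with
  | none => exact .none
  | left σ => exact .left _
  | right σ => exact .right _
  | both h => exact .both (h.subst s)

theorem Ctx.IsBSum.subst {n m : ℕ} (s : Fin n → Ix Θ m) {I : Ix Θ n} {Γ : Ctx Θ (n + 1)}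
    {Ξ : Ctx Θ n} (h : Ctx.IsBSum I Γ Ξ) :
    Ctx.IsBSum (I.subst s) (Γ.subst (Ix.liftSub s)) (Ξ.subst s) := by
  intro x
  have := h x
  simp only [Ctx.subst]
  generalize Γ x = o₁, Ξ x = o₂ at this
  cases this with
  | none => exact .none
  | some h => exact .some (h.subst s)

/-! ### Typing under substitution of index terms -/

section

variable {ℰ : EqProgram Θ} {n m : ℕ} {Φ : ICtx Θ m} {Ψ : ICtx Θ n} {s : Fin n → Ix Θ m}

theorem CSubty.subst {Γ Δ : Ctx Θ n} (h : CSubty ℰ Ψ Δ Γ) (hs : SubstAgree ℰ Φ Ψ s s) :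
    CSubty ℰ Φ (Δ.subst s) (Γ.subst s) := by
  intro x τ hτ
  obtain ⟨τ, h₁, rfl⟩ := Ctx.subst_eq_some.1 hτ
  obtain ⟨σ, h₂, h₃⟩ := h x τ h₁
  exact ⟨_, Ctx.subst_eq_some.2 ⟨σ, h₂, rfl⟩, h₃.subst₂ hs⟩

theorem WellDefined.subst {Γ : Ctx Θ n} {K : Ix Θ n} {τ : MTy Θ n} (h : WellDefined ℰ Ψ Γ K τ)
    (hs : SubstAgree ℰ Φ Ψ s s) : WellDefined ℰ Φ (Γ.subst s) (K.subst s) (τ.subst s) where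
  ctx x σ hσ := by
    obtain ⟨σ, h₁, rfl⟩ := Ctx.subst_eq_some.1 hσ
    exact (h.ctx x σ h₁).subst₂ hs
  weight := h.weight.subst₂ hs
  type := h.type.subst₂ hs

/-- Only one substitution is allowed here, unlike for subtyping, because the typing rules compare
types and contexts syntactically. The constraints are not substituted: it is enough that values
under `Φ` satisfy `Ψ`. -/
theorem HasTy.subst {Γ : Ctx Θ n} {K : Ix Θ n} {t : Tm} {τ : MTy Θ n} (h : HasTy ℰ Ψ Γ K t τ)
    (hs : SubstAgree ℰ Φ Ψ s s) : HasTy ℰ Φ (Γ.subst s) (K.subst s) t (τ.subst s) := by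
  induction h generalizing m with
  | ax h hw =>
    have := hw.subst hs
    rw [Ix.subst_zero] at this ⊢
    exact .ax (Ctx.subst_eq_some.2 ⟨_, h, rfl⟩) this
  | subs _ h₁ h₂ h₃ hw ih =>
    exact .subs (ih hs) (h₁.subst hs) (h₂.subst₂ hs) (h₃.subst₂ hs) (hw.subst hs)
  | @lam _ _ _ _ I _ _ _ _ _ hΞ hw ih =>
    have ih := ih (hs.lift I)
    have := hw.subst hs
    rw [Ix.subst_add, Ix.subst_sum] at this ⊢
    rw [Ctx.subst_cons] at ih
    exact .lam ih (hΞ.subst s) this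
  | @app _ _ _ _ _ _ _ _ _ σ τ _ _ hΞ hw ih₁ ih₂ =>
    have ih₁ := ih₁ hs
    have ih₂ := ih₂ hs
    have := hw.subst hs
    rw [MTy.at0_subst, Ix.subst_add] at this
    rw [MTy.at0_subst] at ih₂
    rw [MTy.at0_subst, Ix.subst_add]
    rw [MTy.subst, Ix.subst_one] at ih₁
    exact .app ih₁ ih₂ (hΞ.subst s) this
  | @ifz _ _ _ _ _ _ _ J K _ _ _ _ _ _ _ hΞ hw ih₁ ih₂ ih₃ =>
    have ih₂ := ih₂ (hs.insert J 0)
    have ih₃ := ih₃ (hs.insert 1 K)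
    have := hw.subst hs
    rw [Ix.subst_add] at this ⊢
    rw [Ix.subst_zero] at ih₂
    rw [Ix.subst_one] at ih₃
    exact .ifz (ih₁ hs) ih₂ ih₃ (hΞ.subst s) this
  | num hw =>
    have := hw.subst hs
    rw [Ix.subst_zero, MTy.subst, Ix.subst_numeral] at this
    rw [Ix.subst_zero, MTy.subst, Ix.subst_numeral]
    exact .num this
  | succ _ hw ih =>
    have := hw.subst hs
    simp only [MTy.subst, Ix.subst_add, Ix.subst_one] at this ⊢
    exact .succ (ih hs) this
  | pred _ hw ih =>
    have := hw.subst hs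
    simp only [MTy.subst, Ix.subst_sub, Ix.subst_one] at this ⊢
    exact .pred (ih hs) this
  | @fix _ _ Γ Ξ K H I J A B t hH _ hA hΞ hw ih =>
    have ih := ih (hs.lift H)
    have := hw.subst hs
    rw [MTy.subst_bang, LTy.fixRoot_subst, Ix.subst_add, Ix.subst_sum] at this ⊢
    rw [Ctx.subst_cons, MTy.subst_bang, MTy.subst_bang, Ix.subst_one] at ih
    have hA' : LSubty ℰ _ ((B.fixChild I).subst (Ix.liftSub (Ix.liftSub s)))
        (A.subst (Ix.liftSub (Ix.liftSub s))) :=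
      ⟨hA.1.subst₂ ((hs.lift H).lift I), hA.2.subst₂ ((hs.lift H).lift I)⟩
    refine .fix (by rw [hH, Ix.subst_fc, Ix.subst_zero]) ih (A := A.subst _) ?_ (hΞ.subst s) this
    rw [← LTy.fixChild_subst]
    exact hA'

theorem HasTy.mono {Φ Ψ : ICtx Θ n} {Γ : Ctx Θ n} {K : Ix Θ n} {t : Tm} {τ : MTy Θ n}
    (h : HasTy ℰ Ψ Γ K t τ) (hs : ∀ ρ, Sat ℰ Φ ρ → Sat ℰ Ψ ρ) : HasTy ℰ Φ Γ K t τ := by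
  simpa using h.subst (SubstAgree.of_sat hs)

theorem HasTy.wellDefined {Γ : Ctx Θ n} {K : Ix Θ n} {t : Tm} {τ : MTy Θ n}
    (h : HasTy ℰ Ψ Γ K t τ) : WellDefined ℰ Ψ Γ K τ := by
  cases h <;> assumption

end

/-! ## Generation lemmas for terms -/

section

variable {ℰ : EqProgram Θ} {n : ℕ} {Φ : ICtx Θ n} {Γ Δ Ξ : Ctx Θ n} {K : Ix Θ n} {σ : MTy Θ n}
  {t u r : Tm}

theorem WellDefined.refl_ctx (h : WellDefined ℰ Φ Γ K σ) : CSubty ℰ Φ Γ Γ :=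
  fun x τ hτ => ⟨τ, hτ, h.ctx x τ hτ⟩

theorem CSubty.trans (h₁ : CSubty ℰ Φ Γ Δ) (h₂ : CSubty ℰ Φ Δ Ξ) : CSubty ℰ Φ Γ Ξ := by
  intro x τ hτ
  obtain ⟨σ, hσ, h⟩ := h₂ x τ hτ
  obtain ⟨υ, hυ, h'⟩ := h₁ x σ hσ
  exact ⟨υ, hυ, h'.trans h⟩

/-- The judgement `Γ ⊢_K t : σ` follows from `Δ ⊢_L t : τ` by subsumption. -/
structure Subsumes (ℰ : EqProgram Θ) {n : ℕ} (Φ : ICtx Θ n) (Γ : Ctx Θ n) (K : Ix Θ n)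
    (σ : MTy Θ n) (Δ : Ctx Θ n) (L : Ix Θ n) (τ : MTy Θ n) : Prop where
  ctx : CSubty ℰ Φ Γ Δ
  type : Subty ℰ Φ τ σ
  weight : Entails ℰ Φ (cle L K)
  source : WellDefined ℰ Φ Δ L τ

theorem WellDefined.subsumes (h : WellDefined ℰ Φ Γ K σ) : Subsumes ℰ Φ Γ K σ Γ K σ :=
  ⟨h.refl_ctx, h.type, h.weight, h⟩

theorem Subsumes.trans {Δ : Ctx Θ n} {L M : Ix Θ n} {τ υ : MTy Θ n} (hc : CSubty ℰ Φ Γ Δ)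
    (ht : Subty ℰ Φ τ σ) (hw : Entails ℰ Φ (cle L K)) (h : Subsumes ℰ Φ Δ L τ Ξ M υ) :
    Subsumes ℰ Φ Γ K σ Ξ M υ :=
  ⟨hc.trans h.ctx, h.type.trans ht, h.weight.trans hw, h.source⟩

/-- Subsumption is the only rule not directed by the term. Each generation lemma is an induction
that absorbs a chain of subsumptions by transitivity. -/
theorem HasTy.var_inv {x : ℕ} (h : HasTy ℰ Φ Γ K (.var x) σ) :
    ∃ τ, Γ x = some τ ∧ Subty ℰ Φ τ σ := by
  generalize ht : Tm.var x = t at h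
  induction h with
  | ax h hw => cases ht; exact ⟨_, h, hw.type⟩
  | subs _ h₁ h₂ _ _ ih =>
    obtain ⟨τ, hτ, h⟩ := ih ht
    obtain ⟨υ, hυ, h'⟩ := h₁ _ _ hτ
    exact ⟨υ, hυ, h'.trans (h.trans h₂)⟩
  | _ => cases ht

theorem HasTy.num_inv {k : ℕ} (h : HasTy ℰ Φ Γ K (.num k) σ) :
    Subty ℰ Φ (.nat (.numeral k) (.numeral k)) σ := by
  generalize ht : Tm.num k = t at h
  induction h with
  | num hw => cases ht; exact hw.type
  | subs _ _ h₂ _ _ ih => exact (ih ht).trans h₂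
  | _ => cases ht

theorem HasTy.succ_inv (h : HasTy ℰ Φ Γ K (.succ t) σ) :
    ∃ M I J, HasTy ℰ Φ Γ M t (.nat I J) ∧ Entails ℰ Φ (cle M K) ∧
      Subty ℰ Φ (.nat (I + 1) (J + 1)) σ := by
  generalize ht : Tm.succ t = t' at h
  induction h with
  | succ h hw => cases ht; exact ⟨_, _, _, h, hw.weight, hw.type⟩
  | subs _ h₁ h₂ h₃ hw ih =>
    obtain ⟨M, I, J, h, h', h''⟩ := ih ht
    exact ⟨M, I, J, .subs h h₁ h.wellDefined.type h.wellDefined.weight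
      ⟨hw.ctx, h.wellDefined.weight, h.wellDefined.type⟩, h'.trans h₃, h''.trans h₂⟩
  | _ => cases ht

theorem HasTy.pred_inv (h : HasTy ℰ Φ Γ K (.pred t) σ) :
    ∃ M I J, HasTy ℰ Φ Γ M t (.nat I J) ∧ Entails ℰ Φ (cle M K) ∧
      Subty ℰ Φ (.nat (I - 1) (J - 1)) σ := by
  generalize ht : Tm.pred t = t' at h
  induction h with
  | pred h hw => cases ht; exact ⟨_, _, _, h, hw.weight, hw.type⟩
  | subs _ h₁ h₂ h₃ hw ih =>
    obtain ⟨M, I, J, h, h', h''⟩ := ih ht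
    exact ⟨M, I, J, .subs h h₁ h.wellDefined.type h.wellDefined.weight
      ⟨hw.ctx, h.wellDefined.weight, h.wellDefined.type⟩, h'.trans h₃, h''.trans h₂⟩
  | _ => cases ht

/-- The context of the premises is fixed by a syntactic sum, so a subsumption on the context cannot
be pushed into them; it is kept aside as `Subsumes`. -/
theorem HasTy.app_inv (h : HasTy ℰ Φ Γ K (.app t u) σ) :
    ∃ (Γ₁ Γ₂ Ξ : Ctx Θ n) (M N : Ix Θ n) (σ₀ τ₀ : MTy Θ (n + 1)),
      HasTy ℰ Φ Γ₁ M t (.fn 1 σ₀ τ₀) ∧ HasTy ℰ Φ Γ₂ N u σ₀.at0 ∧ Ctx.IsSum Γ₁ Γ₂ Ξ ∧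
      Subsumes ℰ Φ Γ K σ Ξ (M + N) τ₀.at0 := by
  generalize ht : Tm.app t u = t' at h
  induction h with
  | app h h' hΞ hw => cases ht; exact ⟨_, _, _, _, _, _, _, h, h', hΞ, hw.subsumes⟩
  | subs _ h₁ h₂ h₃ hw ih =>
    obtain ⟨Γ₁, Γ₂, Ξ, M, N, σ₀, τ₀, h, h', hΞ, hs⟩ := ih ht
    exact ⟨Γ₁, Γ₂, Ξ, M, N, σ₀, τ₀, h, h', hΞ, hs.trans h₁ h₂ h₃⟩
  | _ => cases ht

theorem HasTy.ifz_inv (h : HasTy ℰ Φ Γ K (.ifz t u r) σ) :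
    ∃ (Γ₁ Γ₂ Ξ : Ctx Θ n) (M N I J : Ix Θ n) (τ : MTy Θ n),
      HasTy ℰ Φ Γ₁ M t (.nat I J) ∧ HasTy ℰ (insert (cle I 0) Φ) Γ₂ N u τ ∧
      HasTy ℰ (insert (cle 1 J) Φ) Γ₂ N r τ ∧ Ctx.IsSum Γ₁ Γ₂ Ξ ∧
      Subsumes ℰ Φ Γ K σ Ξ (M + N) τ := by
  generalize ht : Tm.ifz t u r = t' at h
  induction h with
  | ifz h h' h'' hΞ hw => cases ht; exact ⟨_, _, _, _, _, _, _, _, h, h', h'', hΞ, hw.subsumes⟩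
  | subs _ h₁ h₂ h₃ hw ih =>
    obtain ⟨Γ₁, Γ₂, Ξ, M, N, I, J, τ, h, h', h'', hΞ, hs⟩ := ih ht
    exact ⟨Γ₁, Γ₂, Ξ, M, N, I, J, τ, h, h', h'', hΞ, hs.trans h₁ h₂ h₃⟩
  | _ => cases ht

theorem HasTy.lam_inv (h : HasTy ℰ Φ Γ K (.lam t) σ) :
    ∃ (Γ₀ : Ctx Θ (n + 1)) (Ξ : Ctx Θ n) (I : Ix Θ n) (K₀ : Ix Θ (n + 1)) (σ₀ τ₀ : MTy Θ (n + 1)),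
      HasTy ℰ (Φ.below I) (Ctx.cons σ₀ Γ₀) K₀ t τ₀ ∧ Ctx.IsBSum I Γ₀ Ξ ∧
      Subsumes ℰ Φ Γ K σ Ξ (I + .sum I K₀) (.fn I σ₀ τ₀) := by
  generalize ht : Tm.lam t = t' at h
  induction h with
  | lam h hΞ hw => cases ht; exact ⟨_, _, _, _, _, _, h, hΞ, hw.subsumes⟩
  | subs _ h₁ h₂ h₃ hw ih =>
    obtain ⟨Γ₀, Ξ, I, K₀, σ₀, τ₀, h, hΞ, hs⟩ := ih ht
    exact ⟨Γ₀, Ξ, I, K₀, σ₀, τ₀, h, hΞ, hs.trans h₁ h₂ h₃⟩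
  | _ => cases ht

theorem HasTy.fix_inv (h : HasTy ℰ Φ Γ K (.fix t) σ) :
    ∃ (Γ₀ : Ctx Θ (n + 1)) (Ξ : Ctx Θ n) (L : Ix Θ n) (I J : Ix Θ (n + 1)) (A B : LTy Θ (n + 2)),
      HasTy ℰ (Φ.below (.fc 0 L I)) (Ctx.cons (.bang I A) Γ₀) J t (.bang 1 B) ∧
      LSubty ℰ ((Φ.below (.fc 0 L I)).below I) (B.fixChild I) A ∧
      Ctx.IsBSum (.fc 0 L I) Γ₀ Ξ ∧
      Subsumes ℰ Φ Γ K σ Ξ (.fc 0 L I + .sum (.fc 0 L I) J) (.bang L (B.fixRoot I)) := by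
  generalize ht : Tm.fix t = t' at h
  induction h with
  | fix hH h hA hΞ hw => cases ht; subst hH; exact ⟨_, _, _, _, _, _, _, h, hA, hΞ, hw.subsumes⟩
  | subs _ h₁ h₂ h₃ hw ih =>
    obtain ⟨Γ₀, Ξ, L, I, J, A, B, h, hA, hΞ, hs⟩ := ih ht
    exact ⟨Γ₀, Ξ, L, I, J, A, B, h, hA, hΞ, hs.trans h₁ h₂ h₃⟩
  | _ => cases ht

end

/-! ## Shifts of an index variable -/

/-- The substitution `{D + a / a}` for the variable `a` of index `0`. -/
abbrev Ix.shift {n : ℕ} (D : Ix Θ n) : Fin (n + 1) → Ix Θ (n + 1) :=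
  Ix.single (D.wk + .var 0) Fin.succ

theorem cons_comp_liftRen {n m : ℕ} (r : Fin n → Fin m) (ρ : Fin m → ℕ) (a : ℕ) :
    (fun i => (Fin.cons a ρ : Fin (m + 1) → ℕ) (Ix.liftRen r i)) =
      Fin.cons a (fun i => ρ (r i)) := by
  funext i; cases i using Fin.cases <;> rfl

section

variable {𝓘 : Interp Θ} {n m : ℕ}

theorem Ix.eval_var_zero {ρ : Fin n → ℕ} {a : ℕ} :
    (Ix.var 0 : Ix Θ (n + 1)).Eval 𝓘 (Fin.cons a ρ) a := rfl

theorem eval_single {I : Ix Θ m} {r : Fin n → Fin m} {ρ : Fin m → ℕ} {a : ℕ}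
    (h : I.Eval 𝓘 ρ a) (i : Fin (n + 1)) :
    (Ix.single I r i).Eval 𝓘 ρ ((Fin.cons a (fun i => ρ (r i)) : Fin (n + 1) → ℕ) i) := by
  cases i using Fin.cases with
  | zero => exact h
  | succ i => rfl

theorem eval_single_zero {ρ : Fin n → ℕ} (i : Fin (n + 1)) :
    (Ix.single (0 : Ix Θ n) id i).Eval 𝓘 ρ ((Fin.cons 0 ρ : Fin (n + 1) → ℕ) i) :=
  eval_single Ix.eval_zero i

theorem eval_shift {D : Ix Θ n} {ρ : Fin n → ℕ} (h : D.Dfd 𝓘 ρ) (a : ℕ) (i : Fin (n + 1)) :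
    (D.shift i).Eval 𝓘 (Fin.cons a ρ) ((Fin.cons (D.ev 𝓘 ρ + a) ρ : Fin (n + 1) → ℕ) i) :=
  eval_single (Ix.eval_add.2 ⟨_, a, Ix.eval_wk.2 h.eval, Ix.eval_var_zero, rfl⟩) i

theorem eval_subst_shift {D : Ix Θ n} {J : Ix Θ (n + 1)} {ρ : Fin n → ℕ} (h : D.Dfd 𝓘 ρ)
    {a k : ℕ} :
    (J.subst D.shift).Eval 𝓘 (Fin.cons a ρ) k ↔ J.Eval 𝓘 (Fin.cons (D.ev 𝓘 ρ + a) ρ) k :=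
  Ix.eval_subst (eval_shift h a)

theorem Ix.dfd_subst_shift {D : Ix Θ n} {J : Ix Θ (n + 1)} {ρ : Fin n → ℕ} (h : D.Dfd 𝓘 ρ)
    {a : ℕ} :
    (J.subst D.shift).Dfd 𝓘 (Fin.cons a ρ) ↔ J.Dfd 𝓘 (Fin.cons (D.ev 𝓘 ρ + a) ρ) :=
  Ix.dfd_subst (eval_shift h a)

theorem Ix.ev_subst_shift {D : Ix Θ n} {J : Ix Θ (n + 1)} {ρ : Fin n → ℕ} (h : D.Dfd 𝓘 ρ)
    {a : ℕ} :
    (J.subst D.shift).ev 𝓘 (Fin.cons a ρ) = J.ev 𝓘 (Fin.cons (D.ev 𝓘 ρ + a) ρ) :=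
  Ix.ev_subst (eval_shift h a)

/-- The range of summation is cut at `D`. Terms beyond `D + I₂` are discarded, whence an inequality,
and only the definedness of the large sum is needed. -/
theorem sum_shift {D I₂ I : Ix Θ n} {J : Ix Θ (n + 1)} {ρ : Fin n → ℕ} (hD : D.Dfd 𝓘 ρ)
    (h₂ : I₂.Dfd 𝓘 ρ) (hJ : (Ix.sum I J).Dfd 𝓘 ρ) (hle : D.ev 𝓘 ρ + I₂.ev 𝓘 ρ ≤ I.ev 𝓘 ρ) :
    (Ix.sum D J).Dfd 𝓘 ρ ∧ (Ix.sum I₂ (J.subst D.shift)).Dfd 𝓘 ρ ∧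
      (Ix.sum D J).ev 𝓘 ρ + (Ix.sum I₂ (J.subst D.shift)).ev 𝓘 ρ ≤ (Ix.sum I J).ev 𝓘 ρ := by
  have hJ' := Ix.dfd_sum.1 hJ
  have h₃ : (Ix.sum D J).Dfd 𝓘 ρ := Ix.dfd_sum.2 ⟨hD, fun a ha => hJ'.2 a (by omega)⟩
  have h₄ : (Ix.sum I₂ (J.subst D.shift)).Dfd 𝓘 ρ :=
    Ix.dfd_sum.2 ⟨h₂, fun a ha => (Ix.dfd_subst_shift hD).2 (hJ'.2 _ (by omega))⟩
  refine ⟨h₃, h₄, ?_⟩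
  rw [Ix.ev_sum h₃, Ix.ev_sum h₄, Ix.ev_sum hJ]
  simp only [Ix.ev_subst_shift hD]
  rw [← Finset.sum_range_add (fun a => J.ev 𝓘 (Fin.cons a ρ))]
  exact Finset.sum_le_sum_of_subset (Finset.range_mono hle)

end

/-! ### Reindexing in entailments and subtyping -/

section

variable {ℰ : EqProgram Θ} {n m : ℕ} {Φ : ICtx Θ n}

theorem Entails.sum_shift {D I₂ I : Ix Θ n} {J : Ix Θ (n + 1)}
    (h : Entails ℰ Φ (cle (D + I₂) I)) (hJ : IxDefined ℰ Φ (.sum I J)) :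
    Entails ℰ Φ (cle (.sum D J + .sum I₂ (J.subst D.shift)) (.sum I J)) := by
  rw [entails_cle] at h ⊢
  rw [ixDefined_iff] at hJ
  intro ρ hρ
  obtain ⟨h₁, h₂, h₃⟩ := h ρ hρ
  rw [Ix.dfd_add] at h₁
  rw [Ix.ev_add h₁.1 h₁.2] at h₃
  obtain ⟨h₄, h₅, h₆⟩ := DlPCF.sum_shift h₁.1 h₁.2 (hJ ρ hρ) h₃
  exact ⟨Ix.dfd_add.2 ⟨h₄, h₅⟩, hJ ρ hρ, by rwa [Ix.ev_add h₄ h₅]⟩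

theorem Entails.left_of_add {I J K : Ix Θ n} (h : Entails ℰ Φ (cle (I + J) K)) :
    Entails ℰ Φ (cle I K) := by
  rw [entails_cle] at h ⊢
  intro ρ hρ
  obtain ⟨h₁, h₂, h₃⟩ := h ρ hρ
  rw [Ix.dfd_add] at h₁
  rw [Ix.ev_add h₁.1 h₁.2] at h₃
  exact ⟨h₁.1, h₂, by omega⟩

theorem Entails.right_of_add {I J K : Ix Θ n} (h : Entails ℰ Φ (cle (I + J) K)) :
    Entails ℰ Φ (cle J K) := by
  rw [entails_cle] at h ⊢
  intro ρ hρ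
  obtain ⟨h₁, h₂, h₃⟩ := h ρ hρ
  rw [Ix.dfd_add] at h₁
  rw [Ix.ev_add h₁.1 h₁.2] at h₃
  exact ⟨h₁.2, h₂, by omega⟩

theorem Entails.refl_left {I J : Ix Θ n} (h : Entails ℰ Φ (cle I J)) : IxDefined ℰ Φ I :=
  ixDefined_iff.2 fun ρ hρ => (entails_cle.1 h ρ hρ).1

theorem Entails.refl_right {I J : Ix Θ n} (h : Entails ℰ Φ (cle I J)) : IxDefined ℰ Φ J :=
  ixDefined_iff.2 fun ρ hρ => (entails_cle.1 h ρ hρ).2.1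

theorem SubstAgree.shift {D I₂ I : Ix Θ n} (h : Entails ℰ Φ (cle (D + I₂) I)) :
    SubstAgree ℰ (Φ.below I₂) (Φ.below I) D.shift D.shift := by
  rw [entails_cle] at h
  intro ρ hρ
  obtain ⟨a, ρ, rfl, -, ha, hΦ⟩ := sat_below'.1 hρ
  obtain ⟨h₁, h₂, h₃⟩ := h ρ hΦ
  rw [Ix.dfd_add] at h₁
  rw [Ix.ev_add h₁.1 h₁.2] at h₃
  exact ⟨_, eval_shift h₁.1 a, eval_shift h₁.1 a, sat_below.2 ⟨⟨h₂, by omega⟩, hΦ⟩⟩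

theorem SubstAgree.single_zero {I : Ix Θ n} (h : Entails ℰ Φ (cle 1 I)) :
    SubstAgree ℰ Φ (Φ.below I) (Ix.single 0 id) (Ix.single 0 id) := by
  rw [entails_cle] at h
  intro ρ hρ
  obtain ⟨-, h₂, h₃⟩ := h ρ hρ
  rw [Ix.ev_one] at h₃
  exact ⟨_, eval_single_zero, eval_single_zero, sat_below.2 ⟨⟨h₂, h₃⟩, hρ⟩⟩

theorem LSubty.subst₂ {Ψ : ICtx Θ m} {s s' : Fin n → Ix Θ m} {A B : LTy Θ n}
    (h : LSubty ℰ Φ A B) (hs : SubstAgree ℰ Ψ Φ s s') : LSubty ℰ Ψ (A.subst s) (B.subst s') :=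
  ⟨h.1.subst₂ hs.symm, h.2.subst₂ hs⟩

theorem LSubty.mono {Ψ : ICtx Θ n} {A B : LTy Θ n} (h : LSubty ℰ Φ A B)
    (hs : ∀ ρ, Sat ℰ Ψ ρ → Sat ℰ Φ ρ) : LSubty ℰ Ψ A B := ⟨h.1.mono hs, h.2.mono hs⟩

theorem LSubty.trans {A B C : LTy Θ n} (h : LSubty ℰ Φ A B) (h' : LSubty ℰ Φ B C) :
    LSubty ℰ Φ A C := ⟨h'.1.trans h.1, h.2.trans h'.2⟩

theorem subty_bang_iff {I J : Ix Θ n} {A B : LTy Θ (n + 1)} :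
    Subty ℰ Φ (.bang I A) (.bang J B) ↔
      LSubty ℰ (Φ.below J) A B ∧ Entails ℰ Φ (cle J I) :=
  ⟨fun h => by cases h with | fn h₁ h₂ h₃ => exact ⟨⟨h₁, h₂⟩, h₃⟩,
    fun h => .fn h.1.1 h.1.2 h.2⟩

theorem tyDefined_bang_iff {I : Ix Θ n} {A : LTy Θ (n + 1)} :
    TyDefined ℰ Φ (.bang I A) ↔ LSubty ℰ (Φ.below I) A A ∧ IxDefined ℰ Φ I := subty_bang_iff

theorem Subty.at0 {I : Ix Θ n} {σ τ : MTy Θ (n + 1)} (h : Subty ℰ (Φ.below I) σ τ)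
    (hI : Entails ℰ Φ (cle 1 I)) : Subty ℰ Φ σ.at0 τ.at0 := h.subst₂ (.single_zero hI)

theorem LSubty.at0 {I : Ix Θ n} {A B : LTy Θ (n + 1)} (h : LSubty ℰ (Φ.below I) A B)
    (hI : Entails ℰ Φ (cle 1 I)) : LSubty ℰ Φ A.at0 B.at0 := h.subst₂ (.single_zero hI)

theorem ixDefined_one : IxDefined ℰ Φ (1 : Ix Θ n) := ixDefined_iff.2 fun _ _ => Ix.dfd_one

/-- The substitution `{b + ∑_{d < a} J{d/a} / c}` occurring in bounded sums, under variables
`b, a`. -/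
abbrev Ix.bsumSubst {n : ℕ} (J : Ix Θ (n + 1)) : Fin (n + 1) → Ix Θ (n + 2) :=
  Ix.single (.var 0 + .sum (.var 1) (J.rename (Ix.liftRen (fun i => i.succ.succ))))
    (fun i => i.succ.succ)

/-- The offset of the `a`-th block is the total length of the blocks before it, so `J` need only be
defined below `a`. -/
theorem eval_bsumSubst {𝓘 : Interp Θ} {J : Ix Θ (n + 1)} {ρ : Fin n → ℕ} {a b : ℕ}
    (h : ∀ x < a, J.Dfd 𝓘 (Fin.cons x ρ)) (i : Fin (n + 1)) :
    (J.bsumSubst i).Eval 𝓘 (Fin.cons b (Fin.cons a ρ))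
      ((Fin.cons (b + ∑ x ∈ Finset.range a, J.ev 𝓘 (Fin.cons x ρ)) ρ : Fin (n + 1) → ℕ) i) := by
  refine eval_single (r := fun i : Fin n => i.succ.succ)
    (Ix.eval_add.2 ⟨b, _, Ix.eval_var_zero, Ix.eval_sum.2 ⟨Ix.dfd_var, ?_, rfl⟩, ?_⟩) i
  · intro x hx
    rw [Ix.dfd_rename, cons_comp_liftRen]
    exact h x (by simpa using hx)
  · simp only [Ix.ev_rename, cons_comp_liftRen, Ix.ev_var]
    rfl

/-! ## Splitting types along sums -/

/-- `σ` is a subtype of a sum of two types, which are subtypes of `σ₁` and `σ₂`. -/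
structure Split (ℰ : EqProgram Θ) (Φ : ICtx Θ n) (σ σ₁ σ₂ : MTy Θ n) : Prop where
  left : TyDefined ℰ Φ σ₁
  right : TyDefined ℰ Φ σ₂
  sum : ∃ τ₁ τ₂ υ, MSum τ₁ τ₂ υ ∧ Subty ℰ Φ σ υ ∧ Subty ℰ Φ τ₁ σ₁ ∧ Subty ℰ Φ τ₂ σ₂

theorem Split.subty {σ τ σ₁ σ₂ : MTy Θ n} (h : Split ℰ Φ τ σ₁ σ₂) (h' : Subty ℰ Φ σ τ) :
    Split ℰ Φ σ σ₁ σ₂ :=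
  let ⟨τ₁, τ₂, υ, h₁, h₂, h₃⟩ := h.sum
  ⟨h.left, h.right, τ₁, τ₂, υ, h₁, h'.trans h₂, h₃⟩

/-- The constraint `a < 0` is unsatisfiable, so `A` is irrelevant: zero copies of any type are well
defined. -/
theorem LSubty.bang_zero (A : LTy Θ (n + 1)) : TyDefined ℰ Φ (.bang 0 A) := by
  have : ∀ ρ, ¬ Sat ℰ (Φ.below 0) ρ := fun ρ hρ => by
    obtain ⟨_, _, _, _, h, _⟩ := sat_below'.1 hρ
    simp at h
  exact tyDefined_bang_iff.2 ⟨⟨TyDefined.of_not_sat this _, TyDefined.of_not_sat this _⟩,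
    ixDefined_iff.2 fun _ _ => Ix.dfd_zero⟩

/-- Serves variables declared in only one summand of a context sum: the other side receives zero
copies, or a duplicate of a `Nat` type. -/
theorem exists_split_left {τ : MTy Θ n} (h : TyDefined ℰ Φ τ) : ∃ σ₂, Split ℰ Φ τ τ σ₂ := by
  cases τ with
  | nat I J => exact ⟨_, h, h, _, _, _, .nat I J, h, h, h⟩
  | fn J σ τ =>
    have h' := tyDefined_bang_iff (A := ⟨σ, τ⟩).1 h
    have hJ := ixDefined_iff.1 h'.2
    have hle : Entails ℰ Φ (cle (J + 0) J) := entails_cle.2 fun ρ hρ =>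
      ⟨Ix.dfd_add.2 ⟨hJ ρ hρ, Ix.dfd_zero⟩, hJ ρ hρ, by
        rw [Ix.ev_add (hJ ρ hρ) Ix.dfd_zero, Ix.ev_zero, add_zero]⟩
    refine ⟨_, h, LSubty.bang_zero _, _, _, _, .bang J 0 ⟨σ, τ⟩, ?_, h, LSubty.bang_zero _⟩
    exact subty_bang_iff.2 ⟨h'.1.mono (sat_below_mono (fun _ h => h) hle), hle⟩

theorem exists_split_right {τ : MTy Θ n} (h : TyDefined ℰ Φ τ) : ∃ σ₁, Split ℰ Φ τ σ₁ τ := by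
  cases τ with
  | nat I J => exact ⟨_, h, h, _, _, _, .nat I J, h, h, h⟩
  | fn J σ τ =>
    have h' := tyDefined_bang_iff (A := ⟨σ, τ⟩).1 h
    have hJ := ixDefined_iff.1 h'.2
    have hle : Entails ℰ Φ (cle (0 + J) J) := entails_cle.2 fun ρ hρ =>
      ⟨Ix.dfd_add.2 ⟨Ix.dfd_zero, hJ ρ hρ⟩, hJ ρ hρ, by
        rw [Ix.ev_add Ix.dfd_zero (hJ ρ hρ), Ix.ev_zero, zero_add]⟩
    refine ⟨_, LSubty.bang_zero _, h, _, _, _, .bang 0 J ⟨σ, τ⟩, ?_, LSubty.bang_zero _, ?_⟩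
    · exact subty_bang_iff.2 ⟨h'.1.mono (sat_below_mono (fun _ h => h) hle), hle⟩
    · refine (subty_bang_iff (B := ⟨σ, τ⟩)).2 ⟨?_, h'.2⟩
      -- The second summand of `MSum` carries `A{0 + a/a}`, which agrees with `A` only in value.
      have : SubstAgree ℰ (Φ.below J) (Φ.below J) (Ix.shift 0) Ix.var := by
        intro ρ hρ
        obtain ⟨a, ρ, rfl, -, ha, hΦ⟩ := sat_below'.1 hρ
        refine ⟨Fin.cons a ρ, fun i => ?_, fun i => rfl, hρ⟩
        have := eval_shift (𝓘 := ℰ.sem) (D := (0 : Ix Θ n)) (ρ := ρ) Ix.dfd_zero a i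
        rwa [Ix.ev_zero, zero_add] at this
      have := h'.1.subst₂ this
      rwa [LTy.subst_id] at this

/-- The blocks `a < I` are cut at `D`: the first `D` blocks form an initial interval of copies, the
next `I₂` an interval starting at `∑_{a<D} J`. The summand of the second part is a type `σ₂` below
the shifted `σ`, since the shift of `σ` does not itself have the syntactic shape required by `BSum`.
-/
theorem bsum_split {D I₂ I : Ix Θ n} {σ : MTy Θ (n + 1)} {υ : MTy Θ n} (h : BSum I σ υ)
    (hυ : TyDefined ℰ Φ υ) (hI : Entails ℰ Φ (cle (D + I₂) I)) :
    ∃ υ₁ σ₂ υ₂, BSum D σ υ₁ ∧ BSum I₂ σ₂ υ₂ ∧ Subty ℰ (Φ.below I₂) σ₂ (σ.subst D.shift) ∧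
      TyDefined ℰ (Φ.below I₂) σ₂ ∧ Split ℰ Φ υ υ₁ υ₂ := by
  cases h with
  | nat J K =>
    have h : TyDefined ℰ (Φ.below I₂) (.nat J.wk K.wk) := by
      have hs : SubstAgree ℰ (Φ.below I₂) Φ (fun i => .var i.succ) (fun i => .var i.succ) := by
        intro ρ hρ
        obtain ⟨a, ρ, rfl, -, -, hΦ⟩ := sat_below'.1 hρ
        exact ⟨ρ, fun i => rfl, fun i => rfl, hΦ⟩
      rw [Ix.wk_eq_subst, Ix.wk_eq_subst]
      exact Subty.subst₂ hυ hs
    refine ⟨_, _, _, .nat J K, .nat J K, ?_, h, hυ, hυ, _, _, _, .nat J K, hυ, hυ, hυ⟩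
    rw [MTy.subst, Ix.subst_single_wk, Ix.subst_single_wk]
    exact h
  | bang J A =>
    obtain ⟨hA, hS⟩ := tyDefined_bang_iff.1 hυ
    have hsum := hI.sum_shift hS
    have hmono := sat_below_mono (ℰ := ℰ) (Φ := Φ) (fun _ h => h) hsum
    have hmono' := sat_below_mono (ℰ := ℰ) (Φ := Φ) (fun _ h => h) hsum.left_of_add
    have hA₂ := hA.subst₂ (.shift hsum)
    have h₂ : TyDefined ℰ Φ (.bang (.sum I₂ (J.subst D.shift)) (A.subst (Ix.sum D J).shift)) :=
      tyDefined_bang_iff.2 ⟨hA₂, hsum.right_of_add.refl_left⟩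
    have h₁ : TyDefined ℰ Φ (.bang (.sum D J) A) :=
      tyDefined_bang_iff.2 ⟨hA.mono hmono', hsum.left_of_add.refl_left⟩
    have hJ₂ : IxDefined ℰ (Φ.below I₂) (J.subst D.shift) := by
      refine ixDefined_iff.2 fun ρ hρ => ?_
      obtain ⟨a, ρ, rfl, -, ha, hΦ⟩ := sat_below'.1 hρ
      exact (Ix.dfd_sum.1 (ixDefined_iff.1 hsum.right_of_add.refl_left ρ hΦ)).2 a ha
    -- The same copy is addressed in two ways: by the offset `∑_{x<D} J` followed by the offset
    -- inside the second part, or by the single offset `∑_{x<D+a} J`.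
    have agree : SubstAgree ℰ ((Φ.below I₂).below (J.subst D.shift)) (Φ.below (.sum I J))
        (fun i => ((Ix.sum D J).shift i).subst (J.subst D.shift).bsumSubst)
        (fun i => (J.bsumSubst i).subst (Ix.liftSub D.shift)) := by
      intro ρ hρ
      obtain ⟨b, ρ, rfl, -, hb, hρ⟩ := sat_below'.1 hρ
      obtain ⟨a, ρ, rfl, -, ha, hΦ⟩ := sat_below'.1 hρ
      have hS' := ixDefined_iff.1 hS ρ hΦ
      have hJ := Ix.dfd_sum.1 hS'
      obtain ⟨hD, -, hle⟩ := entails_cle.1 hI ρ hΦ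
      rw [Ix.dfd_add] at hD
      rw [Ix.ev_add hD.1 hD.2] at hle
      have hD := hD.1
      have hSD : (Ix.sum D J).Dfd ℰ.sem ρ := Ix.dfd_sum.2 ⟨hD, fun x hx => hJ.2 x (by omega)⟩
      rw [Ix.ev_subst_shift hD] at hb
      have h₁ := fun i => (Ix.eval_subst (eval_bsumSubst (J := J.subst D.shift) (a := a) (b := b)
        fun x hx => (Ix.dfd_subst_shift hD).2 (hJ.2 _ (by omega)))).2 (eval_shift hSD _ i)
      have h₂ := fun i => (Ix.eval_subst (eval_liftSub (eval_shift hD a) b)).2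
        (eval_bsumSubst (J := J) (fun x hx => hJ.2 x (by omega)) i)
      rw [Ix.ev_sum hSD] at h₁
      simp only [Ix.ev_subst_shift hD] at h₁
      rw [show ∀ p q : ℕ, p + (b + q) = b + (p + q) by omega,
        ← Finset.sum_range_add (fun x => J.ev ℰ.sem (Fin.cons x ρ))] at h₁
      refine ⟨_, h₁, h₂, sat_below.2 ⟨⟨hS', ?_⟩, hΦ⟩⟩
      rw [Ix.ev_sum hS']
      -- The position lies inside block `D + a`, because `b` is below its length, and this block
      -- ends within the sum because `D + a < D + I₂ ≤ I`.
      calc _ < ∑ x ∈ Finset.range (D.ev ℰ.sem ρ + a + 1), J.ev ℰ.sem (Fin.cons x ρ) := by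
            rw [Finset.sum_range_succ]; omega
        _ ≤ _ := Finset.sum_le_sum_of_subset (Finset.range_mono (by omega))
    refine ⟨_, _, _, .bang J A, .bang (J.subst D.shift) (A.subst (Ix.sum D J).shift), ?_, ?_,
      h₁, h₂, _, _, _, .bang (.sum D J) (.sum I₂ (J.subst D.shift)) A, ?_, h₁, h₂⟩
    · rw [MTy.subst_bang, LTy.subst_subst, LTy.subst_subst]
      exact subty_bang_iff.2 ⟨hA.subst₂ agree, hJ₂⟩
    · rw [LTy.subst_subst]
      exact tyDefined_bang_iff.2 ⟨hA.subst₂ agree.left, hJ₂⟩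
    · exact subty_bang_iff.2 ⟨hA.mono hmono, hsum⟩

theorem Entails.at0_le_sum {I : Ix Θ n} {J : Ix Θ (n + 1)} (hI : Entails ℰ Φ (cle 1 I))
    (hS : IxDefined ℰ Φ (.sum I J)) :
    Entails ℰ Φ (cle (J.subst (Ix.single 0 id)) (.sum I J)) := by
  refine entails_cle.2 fun ρ hρ => ?_
  have hS := ixDefined_iff.1 hS ρ hρ
  have hJ := Ix.dfd_sum.1 hS
  have := (entails_cle.1 hI ρ hρ).2.2
  rw [Ix.ev_one] at this
  rw [Ix.dfd_subst eval_single_zero, Ix.ev_subst eval_single_zero]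
  refine ⟨hJ.2 0 this, hS, ?_⟩
  rw [Ix.ev_sum hS]
  exact Finset.single_le_sum (f := fun x => J.ev ℰ.sem (Fin.cons x ρ)) (fun _ _ => Nat.zero_le _)
    (Finset.mem_range.2 this)

/-- Block `0` has the empty sum as offset, so its copies are the initial copies of the whole sum. -/
theorem bsum_at0 {I : Ix Θ n} {σ : MTy Θ (n + 1)} {υ : MTy Θ n} (h : BSum I σ υ)
    (hυ : TyDefined ℰ Φ υ) (hI : Entails ℰ Φ (cle 1 I)) : Subty ℰ Φ υ σ.at0 := by
  cases h with
  | nat J K =>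
    rw [MTy.at0, MTy.subst, Ix.subst_single_wk, Ix.subst_single_wk, Ix.rename_id, Ix.rename_id]
    exact hυ
  | bang J A =>
    obtain ⟨hA, hS⟩ := tyDefined_bang_iff.1 hυ
    have hle := hI.at0_le_sum hS
    have agree : SubstAgree ℰ (Φ.below (J.subst (Ix.single 0 id))) (Φ.below (.sum I J)) Ix.var
        (fun i => (J.bsumSubst i).subst (Ix.liftSub (Ix.single 0 id))) := by
      intro ρ hρ
      obtain ⟨b, ρ, rfl, -, hb, hΦ⟩ := sat_below'.1 hρ
      have h₂ := fun i => (Ix.eval_subst (𝓘 := ℰ.sem) (eval_liftSub eval_single_zero b)).2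
        (eval_bsumSubst (J := J) (ρ := ρ) (fun x hx => absurd hx (Nat.not_lt_zero x)) i)
      rw [Finset.sum_range_zero, add_zero] at h₂
      exact ⟨_, fun _ => rfl, h₂, sat_below.2 ⟨⟨ixDefined_iff.1 hS ρ hΦ,
        hb.trans_le (entails_cle.1 hle ρ hΦ).2.2⟩, hΦ⟩⟩
    rw [MTy.at0, MTy.subst_bang, LTy.subst_subst]
    exact subty_bang_iff.2 ⟨by simpa using hA.subst₂ agree, hle⟩

/-! ## Splitting contexts -/

/-- Any type below `σ` splits into types that can be used where the given optional types are
expected. -/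
def OSplit (ℰ : EqProgram Θ) (Φ : ICtx Θ n) (σ : MTy Θ n) (o₁ o₂ : Option (MTy Θ n)) : Prop :=
  ∃ σ₁ σ₂, Split ℰ Φ σ σ₁ σ₂ ∧ (∀ τ, o₁ = some τ → Subty ℰ Φ σ₁ τ) ∧
    (∀ τ, o₂ = some τ → Subty ℰ Φ σ₂ τ)

theorem OSplit.none {σ : MTy Θ n} (h : TyDefined ℰ Φ σ) : OSplit ℰ Φ σ none none :=
  let ⟨σ₂, h₂⟩ := exists_split_left h
  ⟨σ, σ₂, h₂, nofun, nofun⟩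

theorem Split.oSplit {σ σ₁ σ₂ : MTy Θ n} (h : Split ℰ Φ σ σ₁ σ₂) :
    OSplit ℰ Φ σ (some σ₁) (some σ₂) :=
  ⟨σ₁, σ₂, h, by rintro _ ⟨⟩; exact h.left, by rintro _ ⟨⟩; exact h.right⟩

theorem MSum.defined {τ₁ τ₂ υ : MTy Θ n} (h : MSum τ₁ τ₂ υ) (hυ : TyDefined ℰ Φ υ) :
    TyDefined ℰ Φ τ₁ ∧ TyDefined ℰ Φ τ₂ := by
  cases h with
  | nat I J => exact ⟨hυ, hυ⟩
  | bang I J A =>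
    obtain ⟨hA, hIJ⟩ := tyDefined_bang_iff.1 hυ
    exact ⟨tyDefined_bang_iff.2 ⟨hA.mono (sat_below_mono (fun _ h => h) hIJ.left_of_add),
      hIJ.left_of_add.refl_left⟩,
      tyDefined_bang_iff.2 ⟨hA.subst₂ (.shift hIJ), hIJ.right_of_add.refl_left⟩⟩

/-- The summands of a defined sum are themselves defined; a missing summand is filled in by a type
nobody uses, so that an environment can be split at every variable. -/
theorem OSum.oSplit {σ : MTy Θ n} {o₁ o₂ o : Option (MTy Θ n)} (h : OSum o₁ o₂ o)
    (hσ : TyDefined ℰ Φ σ) (ho : ∀ τ, o = some τ → Subty ℰ Φ σ τ)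
    (hd : ∀ τ, o = some τ → TyDefined ℰ Φ τ) : OSplit ℰ Φ σ o₁ o₂ := by
  cases h with
  | none => exact .none hσ
  | left τ =>
    obtain ⟨σ₂, h⟩ := exists_split_left (hd τ rfl)
    exact ⟨τ, σ₂, h.subty (ho τ rfl), by rintro _ ⟨⟩; exact hd τ rfl, nofun⟩
  | right τ =>
    obtain ⟨σ₁, h⟩ := exists_split_right (hd τ rfl)
    exact ⟨σ₁, τ, h.subty (ho τ rfl), nofun, by rintro _ ⟨⟩; exact hd τ rfl⟩
  | both h =>
    obtain ⟨h₁, h₂⟩ := h.defined (hd _ rfl)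
    exact Split.oSplit ⟨h₁, h₂, _, _, _, h, ho _ rfl, h₁, h₂⟩

/-- A list of types splits into two lists of types. -/
inductive SplitList (ℰ : EqProgram Θ) (Φ : ICtx Θ n) :
    List (MTy Θ n) → List (MTy Θ n) → List (MTy Θ n) → Prop
  | nil : SplitList ℰ Φ [] [] []
  | cons {σ σ₁ σ₂ : MTy Θ n} {σs σs₁ σs₂ : List (MTy Θ n)} :
      Split ℰ Φ σ σ₁ σ₂ → SplitList ℰ Φ σs σs₁ σs₂ →
      SplitList ℰ Φ (σ :: σs) (σ₁ :: σs₁) (σ₂ :: σs₂)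

theorem SplitList.defined {σs σs₁ σs₂ : List (MTy Θ n)} (h : SplitList ℰ Φ σs σs₁ σs₂) :
    (∀ τ ∈ σs₁, TyDefined ℰ Φ τ) ∧ (∀ τ ∈ σs₂, TyDefined ℰ Φ τ) := by
  induction h with
  | nil => exact ⟨nofun, nofun⟩
  | cons h _ ih =>
    exact ⟨List.forall_mem_cons.2 ⟨h.left, ih.1⟩, List.forall_mem_cons.2 ⟨h.right, ih.2⟩⟩

theorem CSubty.mono {Ψ : ICtx Θ n} {Γ Δ : Ctx Θ n} (h : CSubty ℰ Φ Γ Δ)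
    (hs : ∀ ρ, Sat ℰ Ψ ρ → Sat ℰ Φ ρ) : CSubty ℰ Ψ Γ Δ := fun x τ hτ =>
  let ⟨σ, hσ, h⟩ := h x τ hτ
  ⟨σ, hσ, h.mono hs⟩

theorem CSubty.cons {Γ Δ : Ctx Θ n} {σ τ : MTy Θ n} (h : CSubty ℰ Φ Γ Δ) (h' : Subty ℰ Φ σ τ) :
    CSubty ℰ Φ (.cons σ Γ) (.cons τ Δ) := by
  intro x υ hυ
  cases x with
  | zero => cases hυ; exact ⟨σ, rfl, h'⟩
  | succ x => exact h x υ hυ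

theorem Ctx.ofList_cons (σ : MTy Θ n) (σs : List (MTy Θ n)) :
    Ctx.ofList (σ :: σs) = Ctx.cons σ (Ctx.ofList σs) := by
  funext x; cases x <;> rfl

theorem exists_splitList {σs : List (MTy Θ n)} {Γ₁ Γ₂ : Ctx Θ n}
    (h : ∀ x σ, σs[x]? = some σ → OSplit ℰ Φ σ (Γ₁ x) (Γ₂ x))
    (h' : ∀ x, σs[x]? = none → Γ₁ x = none ∧ Γ₂ x = none) :
    ∃ σs₁ σs₂, SplitList ℰ Φ σs σs₁ σs₂ ∧ CSubty ℰ Φ (.ofList σs₁) Γ₁ ∧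
      CSubty ℰ Φ (.ofList σs₂) Γ₂ := by
  induction σs generalizing Γ₁ Γ₂ with
  | nil =>
    refine ⟨[], [], .nil, fun x τ hτ => ?_, fun x τ hτ => ?_⟩
    · rw [(h' x rfl).1] at hτ; cases hτ
    · rw [(h' x rfl).2] at hτ; cases hτ
  | cons σ σs ih =>
    obtain ⟨σs₁, σs₂, h₁, h₂, h₃⟩ := ih (Γ₁ := fun x => Γ₁ (x + 1)) (Γ₂ := fun x => Γ₂ (x + 1))
      (fun x τ hτ => h (x + 1) τ (by simpa using hτ))
      (fun x hx => h' (x + 1) (by simpa using hx))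
    obtain ⟨σ₁, σ₂, k₁, k₂, k₃⟩ := h 0 σ rfl
    refine ⟨_, _, .cons k₁ h₁, fun x τ hτ => ?_, fun x τ hτ => ?_⟩
    · cases x with
      | zero => exact ⟨σ₁, rfl, k₂ τ hτ⟩
      | succ x => exact h₂ x τ hτ
    · cases x with
      | zero => exact ⟨σ₂, rfl, k₃ τ hτ⟩
      | succ x => exact h₃ x τ hτ

theorem exists_splitList_none {σs : List (MTy Θ n)} (h : ∀ σ ∈ σs, TyDefined ℰ Φ σ) :
    ∃ σs₁ σs₂, SplitList ℰ Φ σs σs₁ σs₂ :=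
  let ⟨σs₁, σs₂, h₁, _⟩ := exists_splitList (Γ₁ := fun _ => none) (Γ₂ := fun _ => none)
    (fun _ σ hσ => .none (h σ (List.mem_of_getElem? hσ))) (fun _ _ => ⟨rfl, rfl⟩)
  ⟨σs₁, σs₂, h₁⟩

theorem Ctx.IsSum.splitList {σs : List (MTy Θ n)} {Γ₁ Γ₂ Ξ : Ctx Θ n} (h : Ctx.IsSum Γ₁ Γ₂ Ξ)
    (hσs : ∀ σ ∈ σs, TyDefined ℰ Φ σ) (hΞ : CSubty ℰ Φ (.ofList σs) Ξ)
    (hd : ∀ x τ, Ξ x = some τ → TyDefined ℰ Φ τ) :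
    ∃ σs₁ σs₂, SplitList ℰ Φ σs σs₁ σs₂ ∧ CSubty ℰ Φ (.ofList σs₁) Γ₁ ∧
      CSubty ℰ Φ (.ofList σs₂) Γ₂ := by
  refine exists_splitList (fun x σ hσ => ?_) (fun x hx => ?_)
  · refine (h x).oSplit (hσs σ (List.mem_of_getElem? hσ)) (fun τ hτ => ?_) (hd x)
    obtain ⟨σ', hσ', h⟩ := hΞ x τ hτ
    cases hσ.symm.trans hσ'
    exact h
  · have hΞx : Ξ x = none := by
      by_contra hne
      obtain ⟨τ, hτ⟩ := Option.ne_none_iff_exists'.1 hne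
      obtain ⟨σ, hσ, -⟩ := hΞ x τ hτ
      cases hx.symm.trans hσ
    have := h x
    rw [hΞx] at this
    generalize Γ₁ x = o₁, Γ₂ x = o₂ at this
    cases this
    exact ⟨rfl, rfl⟩

/-- Every type of `Ξ` splits into the types given by `Ξ₁` and `Ξ₂`. -/
def CSplit (ℰ : EqProgram Θ) (Φ : ICtx Θ n) (Ξ Ξ₁ Ξ₂ : Ctx Θ n) : Prop :=
  ∀ x, Ξ x = none ∧ Ξ₁ x = none ∧ Ξ₂ x = none ∨
    ∃ υ υ₁ υ₂, Ξ x = some υ ∧ Ξ₁ x = some υ₁ ∧ Ξ₂ x = some υ₂ ∧ Split ℰ Φ υ υ₁ υ₂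

theorem CSplit.left {Ξ Ξ₁ Ξ₂ : Ctx Θ n} (h : CSplit ℰ Φ Ξ Ξ₁ Ξ₂) (x : ℕ) (τ : MTy Θ n)
    (hτ : Ξ₁ x = some τ) : TyDefined ℰ Φ τ := by
  obtain ⟨-, h₁, -⟩ | ⟨υ, υ₁, υ₂, -, h₁, -, h⟩ := h x
  · cases hτ.symm.trans h₁
  · cases hτ.symm.trans h₁; exact h.left

theorem CSplit.right {Ξ Ξ₁ Ξ₂ : Ctx Θ n} (h : CSplit ℰ Φ Ξ Ξ₁ Ξ₂) (x : ℕ) (τ : MTy Θ n)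
    (hτ : Ξ₂ x = some τ) : TyDefined ℰ Φ τ := by
  obtain ⟨-, -, h₁⟩ | ⟨υ, υ₁, υ₂, -, -, h₁, h⟩ := h x
  · cases hτ.symm.trans h₁
  · cases hτ.symm.trans h₁; exact h.right

/-- The splitting of bounded sums is done variable by variable, and the resulting types are then
collected into contexts by choice. -/
theorem Ctx.IsBSum.split {Γ : Ctx Θ (n + 1)} {Ξ : Ctx Θ n} {D I₂ I : Ix Θ n}
    (h : Ctx.IsBSum I Γ Ξ) (hΞ : ∀ x τ, Ξ x = some τ → TyDefined ℰ Φ τ)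
    (hI : Entails ℰ Φ (cle (D + I₂) I)) :
    ∃ (Ξ₁ : Ctx Θ n) (Γ₂ : Ctx Θ (n + 1)) (Ξ₂ : Ctx Θ n), Ctx.IsBSum D Γ Ξ₁ ∧
      Ctx.IsBSum I₂ Γ₂ Ξ₂ ∧ CSubty ℰ (Φ.below I₂) Γ₂ (Γ.subst D.shift) ∧
      (∀ x τ, Γ₂ x = some τ → TyDefined ℰ (Φ.below I₂) τ) ∧ CSplit ℰ Φ Ξ Ξ₁ Ξ₂ := by
  have key : ∀ x, ∃ o₁ o₂ o₃, OBSum D (Γ x) o₁ ∧ OBSum I₂ o₂ o₃ ∧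
      (∀ τ, (Γ x).map (MTy.subst D.shift) = some τ →
        ∃ σ, o₂ = some σ ∧ Subty ℰ (Φ.below I₂) σ τ) ∧
      (∀ τ, o₂ = some τ → TyDefined ℰ (Φ.below I₂) τ) ∧
      (Ξ x = none ∧ o₁ = none ∧ o₃ = none ∨
        ∃ υ υ₁ υ₂, Ξ x = some υ ∧ o₁ = some υ₁ ∧ o₃ = some υ₂ ∧ Split ℰ Φ υ υ₁ υ₂) := by
    intro x
    have hx := h x
    have hΞ := hΞ x
    generalize Γ x = o, Ξ x = o' at hx hΞ
    cases hx with
    | none => exact ⟨_, _, _, .none, .none, nofun, nofun, .inl ⟨rfl, rfl, rfl⟩⟩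
    | some hx =>
      obtain ⟨υ₁, σ₂, υ₂, h₁, h₂, h₃, h₄, h₅⟩ := bsum_split hx (hΞ _ rfl) hI
      refine ⟨_, _, _, .some h₁, .some h₂, ?_, ?_, .inr ⟨_, _, _, rfl, rfl, rfl, h₅⟩⟩
      · rintro _ ⟨⟩; exact ⟨_, rfl, h₃⟩
      · rintro _ ⟨⟩; exact h₄
  choose Ξ₁ Γ₂ Ξ₂ h₁ h₂ h₃ h₄ h₅ using key
  exact ⟨Ξ₁, Γ₂, Ξ₂, h₁, h₂, h₃, h₄, h₅⟩

theorem CSplit.splitList {σs : List (MTy Θ n)} {Ξ₁ Ξ₂ Ξ : Ctx Θ n} (h : CSplit ℰ Φ Ξ Ξ₁ Ξ₂)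
    (hσs : ∀ σ ∈ σs, TyDefined ℰ Φ σ) (hΞ : CSubty ℰ Φ (.ofList σs) Ξ) :
    ∃ σs₁ σs₂, SplitList ℰ Φ σs σs₁ σs₂ ∧ CSubty ℰ Φ (.ofList σs₁) Ξ₁ ∧
      CSubty ℰ Φ (.ofList σs₂) Ξ₂ := by
  refine exists_splitList (fun x σ hσ => ?_) (fun x hx => ?_)
  · obtain ⟨-, h₁, h₂⟩ | ⟨υ, υ₁, υ₂, h₀, h₁, h₂, hs⟩ := h x
    · rw [h₁, h₂]
      exact .none (hσs σ (List.mem_of_getElem? hσ))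
    · obtain ⟨σ', hσ', h⟩ := hΞ x υ h₀
      cases hσ.symm.trans hσ'
      rw [h₁, h₂]
      exact (hs.subty h).oSplit
  · obtain ⟨-, h₁, h₂⟩ | ⟨υ, υ₁, υ₂, h₀, h₁, h₂, hs⟩ := h x
    · exact ⟨h₁, h₂⟩
    · obtain ⟨σ, hσ, -⟩ := hΞ x υ h₀
      cases hx.symm.trans hσ

theorem Ctx.IsBSum.csubty_at0 {Γ : Ctx Θ (n + 1)} {Ξ : Ctx Θ n} {I : Ix Θ n}
    (h : Ctx.IsBSum I Γ Ξ) (hΞ : ∀ x τ, Ξ x = some τ → TyDefined ℰ Φ τ)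
    (hI : Entails ℰ Φ (cle 1 I)) : CSubty ℰ Φ Ξ (Γ.subst (Ix.single 0 id)) := by
  intro x τ hτ
  obtain ⟨σ, hσ, rfl⟩ := Ctx.subst_eq_some.1 hτ
  have hx := h x
  have hΞ := hΞ x
  rw [hσ] at hx
  generalize Ξ x = o at hx hΞ
  cases hx with
  | some h => exact ⟨_, rfl, bsum_at0 h (hΞ _ rfl) hI⟩

end

/-! ## Forest cardinalities in types -/

/-- `k` is a value of `I` at the node `b`. -/
abbrev Ix.Children (𝓘 : Interp Θ) {n : ℕ} (I : Ix Θ (n + 1)) (ρ : Fin n → ℕ) : ℕ → ℕ → Prop :=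
  fun b k => I.Eval 𝓘 (Fin.cons b ρ) k

/-- The substitution `{fc_b(0, a, I) / b}` occurring in `LTy.fixRoot`. -/
abbrev Ix.rootSubst {n : ℕ} (I : Ix Θ (n + 1)) : Fin (n + 1) → Ix Θ (n + 1) :=
  Ix.single (.fc 0 (.var 0) (I.rename (Ix.liftRen Fin.succ))) Fin.succ

/-- The substitution `{fc_b(b + 1, a, I) + b + 1 / b}` occurring in `LTy.fixChild`. -/
abbrev Ix.childSubst {n : ℕ} (I : Ix Θ (n + 1)) : Fin (n + 1) → Ix Θ (n + 2) :=
  Ix.single (.fc (.var 1 + 1) (.var 0) (I.rename (Ix.liftRen (fun i => i.succ.succ))) + .var 1 + 1)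
    (fun i => i.succ.succ)

section

variable {𝓘 : Interp Θ} {n : ℕ} {I : Ix Θ (n + 1)} {ρ : Fin n → ℕ}

theorem eval_rootSubst {a r : ℕ} (h : ForestCard (I.Children 𝓘 ρ) 0 a r) (i : Fin (n + 1)) :
    (I.rootSubst i).Eval 𝓘 (Fin.cons a ρ) ((Fin.cons r ρ : Fin (n + 1) → ℕ) i) := by
  refine eval_single (r := Fin.succ) (Ix.eval_fc.2 ⟨Ix.dfd_zero, Ix.dfd_var, ?_⟩) i
  simp only [Ix.eval_rename, cons_comp_liftRen, Ix.ev_zero, Ix.ev_var]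
  exact h

theorem eval_childSubst {a b r : ℕ} (h : ForestCard (I.Children 𝓘 ρ) (b + 1) a r)
    (i : Fin (n + 1)) :
    (I.childSubst i).Eval 𝓘 (Fin.cons a (Fin.cons b ρ))
      ((Fin.cons (r + b + 1) ρ : Fin (n + 1) → ℕ) i) := by
  have hb : (Ix.var 1 : Ix Θ (n + 2)).Eval 𝓘 (Fin.cons a (Fin.cons b ρ)) b := rfl
  refine eval_single (r := fun i : Fin n => i.succ.succ) (Ix.eval_add.2 ⟨_, _, Ix.eval_add.2
    ⟨_, _, Ix.eval_fc.2 ⟨Ix.dfd_add.2 ⟨Ix.dfd_var, Ix.dfd_one⟩, Ix.dfd_var, ?_⟩, hb, rfl⟩,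
    Ix.eval_one, rfl⟩) i
  simp only [Ix.eval_rename, cons_comp_liftRen, Ix.ev_add Ix.dfd_var Ix.dfd_one, Ix.ev_one,
    hb.ev_eq, Ix.ev_var]
  exact h

theorem children_subst_shift {D : Ix Θ n} (hD : D.Dfd 𝓘 ρ) :
    (I.subst D.shift).Children 𝓘 ρ = fun b => I.Children 𝓘 ρ (D.ev 𝓘 ρ + b) := by
  funext b k
  exact propext (eval_subst_shift hD)

theorem eval_fc_zero {K : Ix Θ n} {r : ℕ} : (Ix.fc 0 K I).Eval 𝓘 ρ r ↔
    K.Dfd 𝓘 ρ ∧ ForestCard (I.Children 𝓘 ρ) 0 (K.ev 𝓘 ρ) r := by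
  rw [Ix.eval_fc, Ix.ev_zero]
  exact and_iff_right Ix.dfd_zero

end

/-! ### Agreement of substitutions under renumbering of forests -/

section

variable {ℰ : EqProgram Θ} {n : ℕ} {Φ : ICtx Θ n} {I J : Ix Θ (n + 1)} {D K L K₁ K₂ : Ix Θ n}
  {A B : LTy Θ (n + 2)} {Γ Γ₂ : Ctx Θ (n + 1)} {Ξ Ξ₂ : Ctx Θ n} {t : Tm}

theorem SubstAgree.root (h : IxDefined ℰ Φ (.fc 0 K I)) :
    SubstAgree ℰ (Φ.below K) (Φ.below (.fc 0 K I)) I.rootSubst I.rootSubst := by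
  intro ρ hρ
  obtain ⟨a, ρ, rfl, -, ha, hΦ⟩ := sat_below'.1 hρ
  have h := ixDefined_iff.1 h ρ hΦ
  obtain ⟨r, hr, hlt⟩ := (eval_fc_zero.1 h.eval).2.prefix_lt ha
  exact ⟨_, eval_rootSubst hr, eval_rootSubst hr, sat_below.2 ⟨⟨h, hlt⟩, hΦ⟩⟩

/-- Renumbering commutes with passing to a child: child `a` of node `b` in the shifted forest,
translated by `D`, is child `a` of node `D + b` in the original forest. -/
theorem SubstAgree.child_shift (h : Entails ℰ Φ (cle (D + .fc 0 K (I.subst D.shift)) (.fc 0 L I))) :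
    SubstAgree ℰ ((Φ.below (.fc 0 K (I.subst D.shift))).below (I.subst D.shift))
      (Φ.below (.fc 0 L I)) (fun i => (D.shift i).subst (I.subst D.shift).childSubst)
      (fun i => (I.childSubst i).subst (Ix.liftSub D.shift)) := by
  intro ρ hρ
  obtain ⟨a, ρ, rfl, -, ha, hρ⟩ := sat_below'.1 hρ
  obtain ⟨b, ρ, rfl, -, hb, hΦ⟩ := sat_below'.1 hρ
  obtain ⟨hD, hH, hle⟩ := entails_cle.1 h ρ hΦ
  rw [Ix.dfd_add] at hD
  rw [Ix.ev_add hD.1 hD.2] at hle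
  have hD := hD.1
  rw [Ix.ev_subst_shift hD] at ha
  -- The large forest is finite, so node `D + b` has a finite forest of descendants; this makes the
  -- child's number defined and keeps it below the total.
  obtain ⟨k, s, hk, hs, hks⟩ := (eval_fc_zero.1 hH.eval).2.node (b := D.ev ℰ.sem ρ + b)
    (by omega) (by omega)
  rw [Ix.Eval.ev_eq hk] at ha
  obtain ⟨r, hr, hlt⟩ := hs.prefix_lt ha
  have hr' : ForestCard ((I.subst D.shift).Children ℰ.sem ρ) (b + 1) a r := by
    rw [children_subst_shift hD]
    exact ForestCard.shift_iff.2 hr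
  have h₁ := fun i => (Ix.eval_subst (eval_childSubst hr')).2 (eval_shift hD _ i)
  have h₂ := fun i => (Ix.eval_subst (eval_liftSub (eval_shift hD b) a)).2 (eval_childSubst hr i)
  rw [show D.ev ℰ.sem ρ + (r + b + 1) = r + (D.ev ℰ.sem ρ + b) + 1 by omega] at h₁
  exact ⟨_, h₁, h₂, sat_below.2 ⟨⟨hH, by omega⟩, hΦ⟩⟩

/-- Root `a` among the last `K₂` trees is root `K₁ + a` of the whole forest: its number is the
cardinality of the first `K₁` trees plus its number in the renumbered rest. -/
theorem SubstAgree.root_shift (h : Entails ℰ Φ (cle (K₁ + K₂) L))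
    (hH : IxDefined ℰ Φ (.fc 0 L I)) :
    SubstAgree ℰ (Φ.below K₂) (Φ.below (.fc 0 L I))
      (fun i => ((Ix.fc 0 K₁ I).shift i).subst (I.subst (Ix.fc 0 K₁ I).shift).rootSubst)
      (fun i => (I.rootSubst i).subst K₁.shift) := by
  intro ρ hρ
  obtain ⟨a, ρ, rfl, -, ha, hΦ⟩ := sat_below'.1 hρ
  obtain ⟨hK, -, hle⟩ := entails_cle.1 h ρ hΦ
  rw [Ix.dfd_add] at hK
  rw [Ix.ev_add hK.1 hK.2] at hle
  have hH := ixDefined_iff.1 hH ρ hΦ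
  obtain ⟨r, hr, hlt⟩ := (eval_fc_zero.1 hH.eval).2.prefix_lt (j' := K₁.ev ℰ.sem ρ + a) (by omega)
  obtain ⟨r₁, r₂, h₁, h₂, rfl⟩ := ForestCard.add_iff.1 hr
  have hD := eval_fc_zero.2 ⟨hK.1, h₁⟩
  have hr₂ : ForestCard ((I.subst (Ix.fc 0 K₁ I).shift).Children ℰ.sem ρ) 0 a r₂ := by
    rw [children_subst_shift hD.dfd, hD.ev_eq]
    exact ForestCard.shift_iff.2 (by rwa [add_zero, ← zero_add r₁])
  have k₁ := fun i => (Ix.eval_subst (eval_rootSubst hr₂)).2 (eval_shift hD.dfd _ i)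
  have k₂ := fun i => (Ix.eval_subst (eval_shift hK.1 a)).2 (eval_rootSubst hr i)
  rw [hD.ev_eq] at k₁
  exact ⟨_, k₁, k₂, sat_below.2 ⟨⟨hH, hlt⟩, hΦ⟩⟩

theorem Entails.fc_shift (h : Entails ℰ Φ (cle (K₁ + K₂) L)) (hH : IxDefined ℰ Φ (.fc 0 L I)) :
    Entails ℰ Φ (cle (.fc 0 K₁ I + .fc 0 K₂ (I.subst (Ix.fc 0 K₁ I).shift)) (.fc 0 L I)) := by
  refine entails_cle.2 fun ρ hΦ => ?_
  obtain ⟨hK, -, hle⟩ := entails_cle.1 h ρ hΦ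
  rw [Ix.dfd_add] at hK
  rw [Ix.ev_add hK.1 hK.2] at hle
  have hH := ixDefined_iff.1 hH ρ hΦ
  obtain ⟨r, hr, hle'⟩ := (eval_fc_zero.1 hH.eval).2.prefix_le hle
  obtain ⟨r₁, r₂, h₁, h₂, rfl⟩ := ForestCard.add_iff.1 hr
  have hD := eval_fc_zero.2 ⟨hK.1, h₁⟩
  have hH₂ : (Ix.fc 0 K₂ (I.subst (Ix.fc 0 K₁ I).shift)).Eval ℰ.sem ρ r₂ := by
    refine eval_fc_zero.2 ⟨hK.2, ?_⟩
    rw [children_subst_shift hD.dfd, hD.ev_eq]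
    exact ForestCard.shift_iff.2 (by rwa [add_zero, ← zero_add r₁])
  refine ⟨Ix.dfd_add.2 ⟨hD.dfd, hH₂.dfd⟩, hH, ?_⟩
  rwa [Ix.ev_add hD.dfd hH₂.dfd, hD.ev_eq, hH₂.ev_eq]

/-- The first tree consists of its root, numbered `0`, and the forest of its children, numbered from
`1`; any further trees are dropped. -/
theorem Entails.fc_unfold (h : Entails ℰ Φ (cle 1 L)) (hH : IxDefined ℰ Φ (.fc 0 L I)) :
    Entails ℰ Φ (cle (1 + .fc 0 (I.subst (Ix.single 0 id)) (I.subst (Ix.shift 1))) (.fc 0 L I)) := by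
  refine entails_cle.2 fun ρ hΦ => ?_
  obtain ⟨-, -, hle⟩ := entails_cle.1 h ρ hΦ
  rw [Ix.ev_one] at hle
  have hH := ixDefined_iff.1 hH ρ hΦ
  obtain ⟨r, hr, hle'⟩ := (eval_fc_zero.1 hH.eval).2.prefix_le hle
  obtain ⟨k, s, hk, hs, rfl⟩ := ForestCard.one_iff.1 hr
  have hK := (Ix.eval_subst (𝓘 := ℰ.sem) eval_single_zero).2 hk
  have hH₂ : (Ix.fc 0 (I.subst (Ix.single 0 id)) (I.subst (Ix.shift 1))).Eval ℰ.sem ρ s := by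
    refine eval_fc_zero.2 ⟨hK.dfd, ?_⟩
    rw [children_subst_shift Ix.dfd_one, Ix.ev_one, hK.ev_eq]
    exact ForestCard.shift_iff.2 hs
  refine ⟨Ix.dfd_add.2 ⟨Ix.dfd_one, hH₂.dfd⟩, hH, ?_⟩
  rwa [Ix.ev_add Ix.dfd_one hH₂.dfd, Ix.ev_one, hH₂.ev_eq]

/-- The roots of the forest left after removing node `0` are exactly the children of node `0`, so
root types of the one are child types of the other. -/
theorem SubstAgree.root_unfold (h : Entails ℰ Φ (cle 1 L)) (hH : IxDefined ℰ Φ (.fc 0 L I)) :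
    SubstAgree ℰ (Φ.below (I.subst (Ix.single 0 id))) (Φ.below (.fc 0 L I))
      (fun i => (Ix.shift 1 i).subst (I.subst (Ix.shift 1)).rootSubst)
      (fun i => (I.childSubst i).subst (Ix.liftSub (Ix.single 0 id))) := by
  intro ρ hρ
  obtain ⟨a, ρ, rfl, -, ha, hΦ⟩ := sat_below'.1 hρ
  obtain ⟨-, -, hle⟩ := entails_cle.1 h ρ hΦ
  rw [Ix.ev_one] at hle
  have hH := ixDefined_iff.1 hH ρ hΦ
  obtain ⟨r, hr, hle'⟩ := (eval_fc_zero.1 hH.eval).2.prefix_le hle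
  obtain ⟨k, s, hk, hs, rfl⟩ := ForestCard.one_iff.1 hr
  rw [Ix.ev_subst eval_single_zero, Ix.Eval.ev_eq hk] at ha
  obtain ⟨r, hr, hlt⟩ := hs.prefix_lt ha
  have hr' : ForestCard ((I.subst (Ix.shift 1)).Children ℰ.sem ρ) 0 a r := by
    rw [children_subst_shift Ix.dfd_one, Ix.ev_one]
    exact ForestCard.shift_iff.2 hr
  have h₁ := fun i => (Ix.eval_subst (𝓘 := ℰ.sem) (eval_rootSubst hr')).2
    (eval_shift Ix.dfd_one _ i)
  have h₂ := fun i => (Ix.eval_subst (𝓘 := ℰ.sem) (eval_liftSub eval_single_zero a)).2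
    (eval_childSubst hr i)
  rw [Ix.ev_one, show 1 + r = r + 0 + 1 by omega] at h₁
  exact ⟨_, h₁, h₂, sat_below.2 ⟨⟨hH, by omega⟩, hΦ⟩⟩

/-! ## Derived typing rules for values -/

theorem IxDefined.add_sum (hH : IxDefined ℰ Φ K) (hJ : IxDefined ℰ (Φ.below K) J) :
    IxDefined ℰ Φ (K + .sum K J) := by
  rw [ixDefined_iff] at *
  exact fun ρ hρ => Ix.dfd_add.2 ⟨hH ρ hρ, Ix.dfd_sum.2 ⟨hH ρ hρ, fun a ha =>
    hJ _ (sat_below.2 ⟨⟨hH ρ hρ, ha⟩, hρ⟩)⟩⟩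

theorem HasTy.sub {Γ Δ : Ctx Θ n} {σ τ : MTy Θ n} (h : HasTy ℰ Φ Γ K t σ) (hΔ : CSubty ℰ Φ Δ Γ)
    (hd : ∀ x τ, Δ x = some τ → TyDefined ℰ Φ τ) (hτ : Subty ℰ Φ σ τ) (hd' : TyDefined ℰ Φ τ) :
    HasTy ℰ Φ Δ K t τ :=
  .subs h hΔ hτ h.wellDefined.weight ⟨hd, h.wellDefined.weight, hd'⟩

theorem HasTy.lam_intro {σ τ : MTy Θ (n + 1)} (h : HasTy ℰ (Φ.below K) (.cons σ Γ) J t τ)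
    (hΞ : Ctx.IsBSum K Γ Ξ) (hd : ∀ x τ, Ξ x = some τ → TyDefined ℰ Φ τ) (hK : IxDefined ℰ Φ K) :
    HasTy ℰ Φ Ξ (K + .sum K J) (.lam t) (.fn K σ τ) :=
  .lam h hΞ ⟨hd, hK.add_sum h.wellDefined.weight,
    .fn (h.wellDefined.ctx 0 σ rfl) h.wellDefined.type hK⟩

theorem HasTy.fix_intro
    (h : HasTy ℰ (Φ.below (.fc 0 K I)) (.cons (.bang I A) Γ) J t (.bang 1 B))
    (hA : LSubty ℰ ((Φ.below (.fc 0 K I)).below I) (B.fixChild I) A)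
    (hΞ : Ctx.IsBSum (.fc 0 K I) Γ Ξ) (hd : ∀ x τ, Ξ x = some τ → TyDefined ℰ Φ τ)
    (hK : IxDefined ℰ Φ K) (hH : IxDefined ℰ Φ (.fc 0 K I)) :
    HasTy ℰ Φ Ξ (.fc 0 K I + .sum (.fc 0 K I) J) (.fix t) (.bang K (B.fixRoot I)) := by
  refine .fix rfl h hA hΞ ⟨hd, hH.add_sum h.wellDefined.weight, tyDefined_bang_iff.2 ⟨?_, hK⟩⟩
  exact ((tyDefined_bang_iff.1 h.wellDefined.type).1.at0 ixDefined_one).subst₂ (.root hH)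

/-- Common to both uses of renumbering: `D` is the cardinality of the first trees when a fixpoint is
split, and `1` when it is unfolded. -/
theorem HasTy.fix_shift
    (h : HasTy ℰ (Φ.below (.fc 0 L I)) (.cons (.bang I A) Γ) J t (.bang 1 B))
    (hA : LSubty ℰ ((Φ.below (.fc 0 L I)).below I) (B.fixChild I) A)
    (hI : Entails ℰ Φ (cle (D + .fc 0 K (I.subst D.shift)) (.fc 0 L I)))
    (hΓ : CSubty ℰ (Φ.below (.fc 0 K (I.subst D.shift))) Γ₂ (Γ.subst D.shift))
    (hΓ₂ : ∀ x τ, Γ₂ x = some τ → TyDefined ℰ (Φ.below (.fc 0 K (I.subst D.shift))) τ)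
    (hΞ : Ctx.IsBSum (.fc 0 K (I.subst D.shift)) Γ₂ Ξ₂)
    (hd : ∀ x τ, Ξ₂ x = some τ → TyDefined ℰ Φ τ) (hK : IxDefined ℰ Φ K) :
    HasTy ℰ Φ Ξ₂
      (.fc 0 K (I.subst D.shift) + .sum (.fc 0 K (I.subst D.shift)) (J.subst D.shift)) (.fix t)
      (.bang K ((B.subst (Ix.liftSub D.shift)).fixRoot (I.subst D.shift))) := by
  have hs := SubstAgree.shift hI
  have h₂ := h.subst hs
  rw [Ctx.subst_cons, MTy.subst_bang, MTy.subst_bang, Ix.subst_one] at h₂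
  have hIA := h₂.wellDefined.ctx 0 _ rfl
  refine HasTy.fix_intro (A := A.subst (Ix.liftSub D.shift)) (h₂.sub (hΓ.cons hIA) ?_
    h₂.wellDefined.type h₂.wellDefined.type) ?_ hΞ hd hK hI.right_of_add.refl_left
  · intro x τ hτ
    cases x with
    | zero => cases hτ; exact hIA
    | succ x => exact hΓ₂ x τ hτ
  -- The child condition for the shifted forest is reduced to the shift of the original child type
  -- by agreement of values; then the original condition applies.
  · have h₁ := ((tyDefined_bang_iff.1 h.wellDefined.type).1.at0 ixDefined_one).subst₂
      (.child_shift hI)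
    rw [← LTy.subst_subst, ← LTy.subst_subst, LTy.at0_subst] at h₁
    exact LSubty.trans h₁ (hA.subst₂ (hs.lift I))

end

section

variable {ℰ : EqProgram Θ} {n : ℕ} {Φ : ICtx Θ n}

/-! ## Splitting values -/

theorem Ctx.ofList_defined {σs : List (MTy Θ n)} :
    (∀ x τ, Ctx.ofList σs x = some τ → TyDefined ℰ Φ τ) ↔ ∀ τ ∈ σs, TyDefined ℰ Φ τ :=
  ⟨fun h τ hτ => let ⟨x, hx⟩ := List.mem_iff_getElem?.1 hτ; h x τ hx,
    fun h _ τ hτ => h τ (List.mem_of_getElem? hτ)⟩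

theorem MSum.bang_inv {I : Ix Θ n} {A : LTy Θ (n + 1)} {τ₁ τ₂ υ : MTy Θ n} (h : MSum τ₁ τ₂ υ)
    (h' : Subty ℰ Φ (.bang I A) υ) :
    ∃ I₁ I₂ B, τ₁ = .bang I₁ B ∧ τ₂ = .bang I₂ (B.subst I₁.shift) ∧
      LSubty ℰ (Φ.below (I₁ + I₂)) A B ∧ Entails ℰ Φ (cle (I₁ + I₂) I) := by
  cases h with
  | nat => cases h'
  | bang I₁ I₂ B => exact ⟨I₁, I₂, B, rfl, rfl, subty_bang_iff.1 h'⟩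

theorem Entails.add_sums {H H₁ H₂ K S S₁ S₂ : Ix Θ n} (hH : Entails ℰ Φ (cle (H₁ + H₂) H))
    (hS : Entails ℰ Φ (cle (S₁ + S₂) S)) (hK : Entails ℰ Φ (cle (H + S) K)) :
    Entails ℰ Φ (cle ((H₁ + S₁) + (H₂ + S₂)) K) := by
  refine entails_cle.2 fun ρ hρ => ?_
  have h₁ := entails_cle.1 hH ρ hρ
  have h₂ := entails_cle.1 hS ρ hρ
  have h₃ := entails_cle.1 hK ρ hρ
  grind [Ix.dfd_add, Ix.ev_add]

/-- Weights divide because the weight of a value is a count plus a sum over that count, both cut at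
the same point. Restricting to values is essential: numerals cost nothing, and the other values
carry an explicit number of copies. -/
theorem HasTy.split_val {v : Val} {σs : List (MTy Θ n)} {K : Ix Θ n} {σ σ₁ σ₂ : MTy Θ n}
    (h : HasTy ℰ Φ (.ofList σs) K v.toTm σ) (hs : Split ℰ Φ σ σ₁ σ₂) :
    ∃ σs₁ σs₂ K₁ K₂, SplitList ℰ Φ σs σs₁ σs₂ ∧ HasTy ℰ Φ (.ofList σs₁) K₁ v.toTm σ₁ ∧
      HasTy ℰ Φ (.ofList σs₂) K₂ v.toTm σ₂ ∧ Entails ℰ Φ (cle (K₁ + K₂) K) := by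
  have hσs := Ctx.ofList_defined.1 h.wellDefined.ctx
  obtain ⟨hd₁, hd₂, τ₁, τ₂, υ, hsum, hυ, hτ₁, hτ₂⟩ := hs
  cases v with
  | num k =>
    obtain ⟨σs₁, σs₂, hσ⟩ := exists_splitList_none hσs
    have hnum : ∀ {Γ : Ctx Θ n}, (∀ x τ, Γ x = some τ → TyDefined ℰ Φ τ) →
        HasTy ℰ Φ Γ 0 (.num k) (.nat (.numeral k) (.numeral k)) := fun hΓ => by
      have : IxDefined ℰ Φ (.numeral k : Ix Θ n) := ixDefined_iff.2 fun _ _ => Ix.dfd_numeral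
      exact .num ⟨hΓ, ixDefined_iff.2 fun _ _ => Ix.dfd_zero, .nat this this⟩
    have hsub := h.num_inv.trans hυ
    -- A supertype of a `Nat` type is a `Nat` type, on which the sum is idempotent.
    have hτ : τ₁ = υ ∧ τ₂ = υ := by
      cases hsum with
      | nat => exact ⟨rfl, rfl⟩
      | bang => cases hsub
    rw [hτ.1] at hτ₁
    rw [hτ.2] at hτ₂
    have hσ₁ := Ctx.ofList_defined.2 hσ.defined.1
    have hσ₂ := Ctx.ofList_defined.2 hσ.defined.2
    refine ⟨σs₁, σs₂, 0, 0, hσ,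
      (hnum hσ₁).sub (hnum hσ₁).wellDefined.refl_ctx hσ₁ (hsub.trans hτ₁) hd₁,
      (hnum hσ₂).sub (hnum hσ₂).wellDefined.refl_ctx hσ₂ (hsub.trans hτ₂) hd₂,
      entails_cle.2 fun ρ hρ => ⟨by simp, ixDefined_iff.1 h.wellDefined.weight ρ hρ, ?_⟩⟩
    rw [Ix.ev_add Ix.dfd_zero Ix.dfd_zero, Ix.ev_zero]
    exact Nat.zero_le _
  | lam t =>
    obtain ⟨Γ₀, Ξ, I, K₀, σ₀, τ₀, h₀, hΞ, hsub⟩ := HasTy.lam_inv h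
    obtain ⟨I₁, I₂, A, rfl, rfl, hA, hI⟩ :=
      hsum.bang_inv (A := ⟨σ₀, τ₀⟩) (hsub.type.trans hυ)
    obtain ⟨Ξ₁, Γ₂, Ξ₂, hΞ₁, hΞ₂, hΓ₂, hdΓ₂, hsplit⟩ := hΞ.split hsub.source.ctx hI
    obtain ⟨σs₁, σs₂, hσ, hσ₁, hσ₂⟩ := hsplit.splitList hσs hsub.ctx
    have k₁ := (h₀.mono (sat_below_mono (fun _ h => h) hI.left_of_add)).lam_intro hΞ₁ hsplit.left
      hI.left_of_add.refl_left
    have k₂ := h₀.subst (.shift hI)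
    rw [Ctx.subst_cons] at k₂
    have hσ₀ := k₂.wellDefined.ctx 0 _ rfl
    have k₂ := (k₂.sub (hΓ₂.cons hσ₀) (by
      intro x τ hτ
      cases x with
      | zero => cases hτ; exact hσ₀
      | succ x => exact hdΓ₂ x τ hτ) k₂.wellDefined.type k₂.wellDefined.type).lam_intro hΞ₂
      hsplit.right hI.right_of_add.refl_left
    refine ⟨σs₁, σs₂, _, _, hσ,
      k₁.sub hσ₁ (Ctx.ofList_defined.2 hσ.defined.1) (.trans ?_ hτ₁) hd₁,
      k₂.sub hσ₂ (Ctx.ofList_defined.2 hσ.defined.2) (.trans ?_ hτ₂) hd₂,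
      hI.add_sums (hI.sum_shift ?_) hsub.weight⟩
    · exact (subty_bang_iff (A := ⟨σ₀, τ₀⟩)).2 ⟨hA.mono (sat_below_mono (fun _ h => h)
        hI.refl_left.left_of_add), hI.left_of_add.refl_left⟩
    · exact (subty_bang_iff (A := ⟨_, _⟩)).2 ⟨hA.subst₂ (.shift hI.refl_left),
        hI.right_of_add.refl_left⟩
    · exact hsub.weight.right_of_add.refl_left
  | fix t =>
    obtain ⟨Γ₀, Ξ, L, I, J, A, B, h₀, hA, hΞ, hsub⟩ := HasTy.fix_inv h
    obtain ⟨K₁, K₂, C, rfl, rfl, hC, hK⟩ := hsum.bang_inv (hsub.type.trans hυ)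
    have hH := hsub.weight.left_of_add.refl_left
    have hI := hK.fc_shift hH
    obtain ⟨Ξ₁, Γ₂, Ξ₂, hΞ₁, hΞ₂, hΓ₂, hdΓ₂, hsplit⟩ := hΞ.split hsub.source.ctx hI
    obtain ⟨σs₁, σs₂, hσ, hσ₁, hσ₂⟩ := hsplit.splitList hσs hsub.ctx
    have hm := sat_below_mono (ℰ := ℰ) (Φ := Φ) (fun _ h => h) hI.left_of_add
    have hB := (tyDefined_bang_iff.1 h₀.wellDefined.type).1.at0 ixDefined_one
    have k₁ := (h₀.mono hm).fix_intro (hA.mono fun ρ hρ => by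
        obtain ⟨a, ρ, rfl, h₁, h₂, h₃⟩ := sat_below'.1 hρ
        exact sat_below.2 ⟨⟨h₁, h₂⟩, hm ρ h₃⟩) hΞ₁ hsplit.left hK.left_of_add.refl_left
      hI.left_of_add.refl_left
    have k₂ := h₀.fix_shift hA hI hΓ₂ hdΓ₂ hΞ₂ hsplit.right hK.right_of_add.refl_left
    refine ⟨σs₁, σs₂, _, _, hσ,
      k₁.sub hσ₁ (Ctx.ofList_defined.2 hσ.defined.1) (.trans ?_ hτ₁) hd₁,
      k₂.sub hσ₂ (Ctx.ofList_defined.2 hσ.defined.2) (.trans ?_ hτ₂) hd₂,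
      hI.add_sums (hI.sum_shift ?_) hsub.weight⟩
    · exact subty_bang_iff.2 ⟨hC.mono (sat_below_mono (fun _ h => h)
        hK.refl_left.left_of_add), hK.left_of_add.refl_left⟩
    · refine subty_bang_iff.2 ⟨?_, hK.right_of_add.refl_left⟩
      have h₁ := hB.subst₂ (.root_shift hK hH)
      rw [← LTy.subst_subst, ← LTy.subst_subst, LTy.at0_subst] at h₁
      exact LSubty.trans h₁ (hC.subst₂ (.shift hK.refl_left))
    · exact hsub.weight.right_of_add.refl_left

/-! ## Contractions -/

/-- The instance `a = 0` of the body is one term of `∑_{a<I} K₀`; the remaining summand `I ≥ 1`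
gives strictness. -/
theorem HasTy.beta {Γ : Ctx Θ n} {K : Ix Θ n} {t : Tm} {σ τ : MTy Θ (n + 1)}
    (h : HasTy ℰ Φ Γ K (.lam t) (.fn 1 σ τ)) :
    ∃ M, HasTy ℰ Φ (.cons σ.at0 Γ) M t τ.at0 ∧ Entails ℰ Φ (clt M K) := by
  obtain ⟨Γ₀, Ξ, I, K₀, σ₀, τ₀, h₀, hΞ, hsub⟩ := h.lam_inv
  obtain ⟨⟨hσ, hτ⟩, hI⟩ := (subty_bang_iff (A := ⟨σ₀, τ₀⟩) (B := ⟨σ, τ⟩)).1 hsub.type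
  have k := h₀.subst (.single_zero hI)
  rw [Ctx.subst_cons] at k
  obtain ⟨⟨hσd, hτd⟩, -⟩ := (tyDefined_bang_iff (A := ⟨σ, τ⟩)).1 h.wellDefined.type
  refine ⟨_, k.sub ((hsub.ctx.trans (hΞ.csubty_at0 hsub.source.ctx hI)).cons
    (hσ.at0 ixDefined_one)) ?_ (hτ.at0 ixDefined_one) (hτd.at0 ixDefined_one), ?_⟩
  · intro x υ hυ
    cases x with
    | zero => cases hυ; exact hσd.at0 ixDefined_one
    | succ x => exact h.wellDefined.ctx x υ hυ
  · refine entails_clt.2 fun ρ hρ => ?_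
    have h₁ := entails_cle.1 (hI.at0_le_sum hsub.weight.right_of_add.refl_left) ρ hρ
    have h₂ := entails_cle.1 hsub.weight ρ hρ
    have h₃ := entails_cle.1 hI ρ hρ
    rw [Ix.ev_one] at h₃
    grind [Ix.dfd_add, Ix.ev_add]

/-- Under `a < 1` one has `a = 0`, and the root of the tree `0` is the node `0`. -/
theorem SubstAgree.root_zero {I : Ix Θ (n + 1)} {L : Ix Θ n} (h : Entails ℰ Φ (cle 1 L))
    (hH : IxDefined ℰ Φ (.fc 0 L I)) :
    SubstAgree ℰ (Φ.below 1) ((Φ.below (.fc 0 L I)).below 1) (Ix.liftSub (Ix.single 0 id))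
      (fun i => (Ix.single 0 id i).subst I.rootSubst) := by
  intro ρ hρ
  obtain ⟨a, ρ, rfl, -, ha, hΦ⟩ := sat_below'.1 hρ
  rw [Ix.ev_one, Nat.lt_one_iff] at ha
  subst ha
  have h₁ := fun i => eval_liftSub (ℰ := ℰ) (eval_single_zero (ρ := ρ)) 0 i
  have h₂ := fun i => (Ix.eval_subst (𝓘 := ℰ.sem) (eval_rootSubst (I := I) (.zero 0))).2
    (eval_single_zero (ρ := Fin.cons 0 ρ) i)
  refine ⟨_, h₁, h₂, sat_below.2 ⟨⟨Ix.dfd_one, by simp⟩, sat_below.2 ⟨⟨?_, ?_⟩, hΦ⟩⟩⟩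
  · exact ixDefined_iff.1 hH ρ hΦ
  · have h₃ := entails_cle.1 h ρ hΦ
    rw [Ix.ev_one] at h₃
    -- A forest has at least as many nodes as trees, so node `0` exists as soon as `1 ≤ L`.
    exact lt_of_lt_of_le h₃.2.2 (eval_fc_zero.1 (ixDefined_iff.1 hH ρ hΦ).eval).2.le

/-- Cutting the node numbers at `1` separates the current call from its recursive calls. The first
part types the body once, the second types the fixpoint at the type the body expects of its
variable, and the node `0` makes the weight drop. -/
theorem HasTy.unfold {σs : List (MTy Θ n)} {K : Ix Θ n} {t : Tm} {C : LTy Θ (n + 1)}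
    (h : HasTy ℰ Φ (.ofList σs) K (.fix t) (.bang 1 C)) :
    ∃ σs₁ σs₂ υ M N, SplitList ℰ Φ σs σs₁ σs₂ ∧
      HasTy ℰ Φ (.ofList (υ :: σs₁)) M t (.bang 1 C) ∧
      HasTy ℰ Φ (.ofList σs₂) N (.fix t) υ ∧ Entails ℰ Φ (clt (M + N) K) := by
  have hσs := Ctx.ofList_defined.1 h.wellDefined.ctx
  obtain ⟨Γ₀, Ξ, L, I, J, A, B, h₀, hA, hΞ, hsub⟩ := h.fix_inv
  obtain ⟨hC, hL⟩ := subty_bang_iff.1 hsub.type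
  have hH := hsub.weight.left_of_add.refl_left
  have hI := hL.fc_unfold hH
  obtain ⟨Ξ₁, Γ₂, Ξ₂, hΞ₁, hΞ₂, hΓ₂, hdΓ₂, hsplit⟩ := hΞ.split hsub.source.ctx hI
  obtain ⟨σs₁, σs₂, hσ, hσ₁, hσ₂⟩ := hsplit.splitList hσs hsub.ctx
  have h1 := hI.left_of_add
  have hB := tyDefined_bang_iff.1 h₀.wellDefined.type
  have k₁ := h₀.subst (.single_zero h1)
  rw [Ctx.subst_cons, MTy.subst_bang, MTy.subst_bang, Ix.subst_one] at k₁
  have hυ := k₁.wellDefined.ctx 0 _ rfl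
  have hK : IxDefined ℰ Φ (I.subst (Ix.single 0 id)) := (tyDefined_bang_iff.1 hυ).2
  have k₂ := h₀.fix_shift hA hI hΓ₂ hdΓ₂ hΞ₂ hsplit.right hK
  refine ⟨σs₁, σs₂, _, _, _, hσ, k₁.sub ?_ ?_ ?_ h.wellDefined.type,
    k₂.sub hσ₂ (Ctx.ofList_defined.2 hσ.defined.2) ?_ hυ, ?_⟩
  · rw [Ctx.ofList_cons]
    exact (hσ₁.trans (hΞ₁.csubty_at0 hsplit.left ixDefined_one)).cons hυ
  · rw [Ctx.ofList_defined]
    exact List.forall_mem_cons.2 ⟨hυ, hσ.defined.1⟩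
  · refine subty_bang_iff.2 ⟨?_, ixDefined_one⟩
    have := hB.1.subst₂ (.root_zero hL hH)
    rw [← LTy.subst_subst] at this
    exact LSubty.trans this hC
  · refine subty_bang_iff.2 ⟨?_, hK⟩
    have h₁ := (hB.1.at0 ixDefined_one).subst₂ (.root_unfold hL hH)
    rw [← LTy.subst_subst, ← LTy.subst_subst, LTy.at0_subst] at h₁
    exact LSubty.trans h₁ (hA.subst₂ ((SubstAgree.single_zero h1).lift I))
  · refine entails_clt.2 fun ρ hρ => ?_
    have hS := hI.sum_shift hsub.weight.right_of_add.refl_left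
    have h₁ := entails_cle.1 (ixDefined_one.at0_le_sum hS.left_of_add.refl_left) ρ hρ
    have h₂ := entails_cle.1 hsub.weight ρ hρ
    have h₃ := entails_cle.1 hI ρ hρ
    have h₄ := entails_cle.1 hS ρ hρ
    have h₅ := Ix.ev_one (𝓘 := ℰ.sem) (ρ := ρ)
    grind [Ix.dfd_add, Ix.ev_add]

end

section

variable {ℰ : EqProgram Θ} {n : ℕ} {Φ Ψ : ICtx Θ n}

/-! ## Environments and closures -/

theorem EnvTy.weight {ρ : Env} {σs : List (MTy Θ n)} {W : Ix Θ n} (h : EnvTy ℰ Φ ρ σs W) :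
    IxDefined ℰ Φ W := by
  induction h with
  | nil => exact ixDefined_iff.2 fun _ _ => Ix.dfd_zero
  | cons h _ _ ih₁ ih₂ =>
    have h := h.wellDefined.weight
    rw [ixDefined_iff] at *
    exact fun ρ hρ => Ix.dfd_add.2 ⟨Ix.dfd_add.2 ⟨h ρ hρ, ih₁ ρ hρ⟩, ih₂ ρ hρ⟩

theorem EnvTy.mono {ρ : Env} {σs : List (MTy Θ n)} {W : Ix Θ n} (h : EnvTy ℰ Ψ ρ σs W)
    (hs : ∀ ρ, Sat ℰ Φ ρ → Sat ℰ Ψ ρ) : EnvTy ℰ Φ ρ σs W := by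
  induction h with
  | nil => exact .nil
  | cons h _ _ ih₁ ih₂ => exact .cons (h.mono hs) ih₁ ih₂

/-- Splitting a value closure splits the types of its captured variables, so the induction descends
into the inner environments too. -/
theorem EnvTy.split {ρ : Env} {σs σs₁ σs₂ : List (MTy Θ n)} {W : Ix Θ n}
    (h : EnvTy ℰ Φ ρ σs W) (hs : SplitList ℰ Φ σs σs₁ σs₂) :
    ∃ W₁ W₂, EnvTy ℰ Φ ρ σs₁ W₁ ∧ EnvTy ℰ Φ ρ σs₂ W₂ ∧ Entails ℰ Φ (cle (W₁ + W₂) W) := by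
  induction h generalizing σs₁ σs₂ with
  | nil =>
    cases hs
    refine ⟨0, 0, .nil, .nil, entails_cle.2 fun ρ _ => ⟨by simp, by simp, ?_⟩⟩
    rw [Ix.ev_add Ix.dfd_zero Ix.dfd_zero, Ix.ev_zero]
  | cons h _ _ ih₁ ih₂ =>
    cases hs with
    | cons hs hs' =>
      obtain ⟨τs₁, τs₂, K₁, K₂, hτ, k₁, k₂, hK⟩ := h.split_val hs
      obtain ⟨W₁', W₂', l₁, l₂, hW'⟩ := ih₁ hτ
      obtain ⟨W₁, W₂, m₁, m₂, hW⟩ := ih₂ hs'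
      refine ⟨_, _, .cons k₁ l₁ m₁, .cons k₂ l₂ m₂, entails_cle.2 fun ρ hρ => ?_⟩
      have h₁ := entails_cle.1 hK ρ hρ
      have h₂ := entails_cle.1 hW' ρ hρ
      have h₃ := entails_cle.1 hW ρ hρ
      grind [Ix.dfd_add, Ix.ev_add]

theorem CloTy.weight {c : Closure} {K : Ix Θ n} {σ : MTy Θ n} (h : CloTy ℰ Φ K c σ) :
    IxDefined ℰ Φ K := by
  cases h with
  | mk h hρ =>
    exact ixDefined_iff.2 fun ρ hΦ => Ix.dfd_add.2
      ⟨ixDefined_iff.1 h.wellDefined.weight ρ hΦ, ixDefined_iff.1 hρ.weight ρ hΦ⟩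

theorem CloTy.type {c : Closure} {K : Ix Θ n} {σ : MTy Θ n} (h : CloTy ℰ Φ K c σ) :
    TyDefined ℰ Φ σ := by
  cases h with
  | mk h hρ => exact h.wellDefined.type

theorem CloTy.mono {c : Closure} {K : Ix Θ n} {σ : MTy Θ n} (h : CloTy ℰ Ψ K c σ)
    (hs : ∀ ρ, Sat ℰ Φ ρ → Sat ℰ Ψ ρ) : CloTy ℰ Φ K c σ := by
  cases h with
  | mk h hρ => exact .mk (h.mono hs) (hρ.mono hs)

theorem CloTy.sub {c : Closure} {K : Ix Θ n} {σ τ : MTy Θ n} (h : CloTy ℰ Φ K c σ)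
    (hτ : Subty ℰ Φ σ τ) (hd : TyDefined ℰ Φ τ) : CloTy ℰ Φ K c τ := by
  cases h with
  | mk h hρ => exact .mk (h.sub h.wellDefined.refl_ctx h.wellDefined.ctx hτ hd) hρ

theorem CloTy.inv {t : Tm} {ρ : Env} {K : Ix Θ n} {σ : MTy Θ n} (h : CloTy ℰ Φ K ⟨t, ρ⟩ σ) :
    ∃ σs L W, K = L + W ∧ HasTy ℰ Φ (.ofList σs) L t σ ∧ EnvTy ℰ Φ ρ σs W := by
  cases h with
  | mk h hρ => exact ⟨_, _, _, rfl, h, hρ⟩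

theorem EnvTy.push {v : VClosure} {ρ : Env} {σs : List (MTy Θ n)} {K W : Ix Θ n} {σ : MTy Θ n}
    (h : CloTy ℰ Φ K v.toClosure σ) (hρ : EnvTy ℰ Φ ρ σs W) :
    EnvTy ℰ Φ (.push v ρ) (σ :: σs) (K + W) := by
  obtain ⟨τs, L, W', rfl, h, hv⟩ := CloTy.inv h
  exact .cons h hv hρ

theorem EnvTy.lookup {ρ : Env} {σs : List (MTy Θ n)} {W : Ix Θ n} {x : ℕ} {v : VClosure}
    {σ : MTy Θ n} (h : EnvTy ℰ Φ ρ σs W) (hv : ρ.lookup x = some v) (hσ : σs[x]? = some σ) :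
    ∃ K, CloTy ℰ Φ K v.toClosure σ ∧ Entails ℰ Φ (cle K W) := by
  induction h generalizing x with
  | nil => cases hv
  | cons h hρ' hρ ih₁ ih₂ =>
    have hw := (EnvTy.cons h hρ' hρ).weight
    cases x with
    | zero => cases hv; cases hσ; exact ⟨_, .mk h hρ', Entails.left_of_add hw⟩
    | succ x =>
      obtain ⟨K, k₁, k₂⟩ := ih₂ hv (by simpa using hσ)
      exact ⟨K, k₁, k₂.trans (Entails.right_of_add hw)⟩

theorem CloTy.num {k : ℕ} {ρ : Env} {K : Ix Θ n} {σ : MTy Θ n}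
    (h : CloTy ℰ Φ K ⟨.num k, ρ⟩ σ) : Subty ℰ Φ (.nat (.numeral k) (.numeral k)) σ := by
  obtain ⟨_, _, _, -, h, -⟩ := h.inv
  exact h.num_inv

theorem subty_numeral {k : ℕ} {M N : Ix Θ n}
    (h : Subty ℰ Φ (.nat (.numeral k) (.numeral k)) (.nat M N)) (ρ : Fin n → ℕ)
    (hρ : Sat ℰ Φ ρ) : M.Dfd ℰ.sem ρ ∧ N.Dfd ℰ.sem ρ ∧ M.ev ℰ.sem ρ ≤ k ∧ k ≤ N.ev ℰ.sem ρ := by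
  cases h with
  | nat h₁ h₂ =>
    have h₁ := entails_cle.1 h₁ ρ hρ
    have h₂ := entails_cle.1 h₂ ρ hρ
    rw [Ix.ev_numeral] at h₁ h₂
    exact ⟨h₁.1, h₂.2.1, h₁.2.2, h₂.2.2⟩

theorem CloTy.num_nil {k : ℕ} {σ : MTy Θ n} (h : Subty ℰ Φ (.nat (.numeral k) (.numeral k)) σ)
    (hd : TyDefined ℰ Φ σ) : CloTy ℰ Φ (0 + 0) ⟨.num k, .nil⟩ σ := by
  have hk : IxDefined ℰ Φ (.numeral k : Ix Θ n) := ixDefined_iff.2 fun _ _ => Ix.dfd_numeral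
  exact CloTy.sub (.mk (.num ⟨(fun _ _ h => by cases h), ixDefined_iff.2 fun _ _ => Ix.dfd_zero,
    .nat hk hk⟩) .nil) h hd

/-! ## Generation lemmas for stacks -/

variable {J : Ix Θ n} {π : Stack} {σ τ : MTy Θ n}

theorem StackTy.wellDefined (h : StackTy ℰ Φ J π σ τ) : StackWellDefined ℰ Φ J σ τ := by
  cases h <;> assumption

theorem StackTy.sub {σ' τ' : MTy Θ n} (h : StackTy ℰ Φ J π σ τ) (hσ : Subty ℰ Φ σ' σ)
    (hσ' : TyDefined ℰ Φ σ') (hτ : Subty ℰ Φ τ τ') (hτ' : TyDefined ℰ Φ τ') :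
    StackTy ℰ Φ J π σ' τ' :=
  .subs h hσ hτ h.wellDefined.weight ⟨h.wellDefined.weight, hσ', hτ'⟩

theorem StackTy.arg_inv {c : Closure} (h : StackTy ℰ Φ J (.arg c π) σ τ) :
    ∃ C S σ₀ τ₀, CloTy ℰ Φ C c σ₀.at0 ∧ StackTy ℰ Φ S π τ₀.at0 τ ∧
      Subty ℰ Φ σ (.fn 1 σ₀ τ₀) ∧ TyDefined ℰ Φ (.fn 1 σ₀ τ₀) ∧ Entails ℰ Φ (cle (C + S) J) := by
  generalize hπ' : Stack.arg c π = π' at h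
  induction h with
  | arg hc hπ hw => cases hπ'; exact ⟨_, _, _, _, hc, hπ, hw.source, hw.source, hw.weight⟩
  | subs _ hσ hτ hI hw ih =>
    obtain ⟨C, S, σ₀, τ₀, h₁, h₂, h₃, h₄, h₅⟩ := ih hπ'
    exact ⟨C, S, σ₀, τ₀, h₁, h₂.sub h₂.wellDefined.source h₂.wellDefined.source hτ hw.target,
      hσ.trans h₃, h₄, h₅.trans hI⟩
  | _ => cases hπ'

theorem StackTy.fn_inv {v : VClosure} (h : StackTy ℰ Φ J (.fn v π) σ τ) :
    ∃ C S σ₀ τ₀, CloTy ℰ Φ C v.toClosure (.fn 1 σ₀ τ₀) ∧ StackTy ℰ Φ S π τ₀.at0 τ ∧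
      Subty ℰ Φ σ σ₀.at0 ∧ TyDefined ℰ Φ σ₀.at0 ∧ Entails ℰ Φ (cle (C + S) J) := by
  generalize hπ' : Stack.fn v π = π' at h
  induction h with
  | fn hc hπ hw => cases hπ'; exact ⟨_, _, _, _, hc, hπ, hw.source, hw.source, hw.weight⟩
  | subs _ hσ hτ hI hw ih =>
    obtain ⟨C, S, σ₀, τ₀, h₁, h₂, h₃, h₄, h₅⟩ := ih hπ'
    exact ⟨C, S, σ₀, τ₀, h₁, h₂.sub h₂.wellDefined.source h₂.wellDefined.source hτ hw.target,
      hσ.trans h₃, h₄, h₅.trans hI⟩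
  | _ => cases hπ'

theorem StackTy.ifz_inv {t u : Tm} {ρ : Env} (h : StackTy ℰ Φ J (.ifz t u ρ π) σ τ) :
    ∃ C S M N σ₀, CloTy ℰ (insert (cle M 0) Φ) C ⟨t, ρ⟩ σ₀ ∧
      CloTy ℰ (insert (cle 1 N) Φ) C ⟨u, ρ⟩ σ₀ ∧ StackTy ℰ Φ S π σ₀ τ ∧
      Subty ℰ Φ σ (.nat M N) ∧ Entails ℰ Φ (cle (C + S) J) := by
  generalize hπ' : Stack.ifz t u ρ π = π' at h
  induction h with
  | ifz hc hc' hπ hw => cases hπ'; exact ⟨_, _, _, _, _, hc, hc', hπ, hw.source, hw.weight⟩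
  | subs _ hσ hτ hI hw ih =>
    obtain ⟨C, S, M, N, σ₀, h₁, h₁', h₂, h₃, h₅⟩ := ih hπ'
    exact ⟨C, S, M, N, σ₀, h₁, h₁', h₂.sub h₂.wellDefined.source h₂.wellDefined.source hτ hw.target,
      hσ.trans h₃, h₅.trans hI⟩
  | _ => cases hπ'

theorem StackTy.succ_inv (h : StackTy ℰ Φ J (.succ π) σ τ) :
    ∃ S M N, StackTy ℰ Φ S π (.nat (M + 1) (N + 1)) τ ∧ Subty ℰ Φ σ (.nat M N) ∧
      Entails ℰ Φ (cle S J) := by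
  generalize hπ' : Stack.succ π = π' at h
  induction h with
  | succ hπ hw => cases hπ'; exact ⟨_, _, _, hπ, hw.source, hw.weight⟩
  | subs _ hσ hτ hI hw ih =>
    obtain ⟨S, M, N, h₂, h₃, h₅⟩ := ih hπ'
    exact ⟨S, M, N, h₂.sub h₂.wellDefined.source h₂.wellDefined.source hτ hw.target,
      hσ.trans h₃, h₅.trans hI⟩
  | _ => cases hπ'

theorem StackTy.pred_inv (h : StackTy ℰ Φ J (.pred π) σ τ) :
    ∃ S M N, StackTy ℰ Φ S π (.nat (M - 1) (N - 1)) τ ∧ Subty ℰ Φ σ (.nat M N) ∧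
      Entails ℰ Φ (cle S J) := by
  generalize hπ' : Stack.pred π = π' at h
  induction h with
  | pred hπ hw => cases hπ'; exact ⟨_, _, _, hπ, hw.source, hw.weight⟩
  | subs _ hσ hτ hI hw ih =>
    obtain ⟨S, M, N, h₂, h₃, h₅⟩ := ih hπ'
    exact ⟨S, M, N, h₂.sub h₂.wellDefined.source h₂.wellDefined.source hτ hw.target,
      hσ.trans h₃, h₅.trans hI⟩
  | _ => cases hπ'

/-! ## Subject reduction -/

theorem Val.msize_toTm (v : Val) : v.toTm.msize = 0 := by cases v <;> rfl

theorem Tm.msize_le_size (t : Tm) : t.msize ≤ t.size := by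
  induction t <;> simp only [Tm.msize, Tm.size] <;> omega

/-- The cost of a stack may be increased so that the weight of a process is as large as wanted. -/
theorem ProcTy.pad {c : Closure} {I S C : Ix Θ n} (hπ : StackTy ℰ Φ S π σ τ)
    (hc : CloTy ℰ Φ C c σ) (h : Entails ℰ Φ (cle (S + C) I)) :
    ∃ J, ProcTy ℰ Φ J ⟨c, π⟩ τ ∧ EntailsEq ℰ Φ I J := by
  have key : ∀ ρ, Sat ℰ Φ ρ → S.Dfd ℰ.sem ρ ∧ C.Dfd ℰ.sem ρ ∧ I.Dfd ℰ.sem ρ ∧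
      S.ev ℰ.sem ρ + C.ev ℰ.sem ρ ≤ I.ev ℰ.sem ρ := by
    intro ρ hρ
    have := entails_cle.1 h ρ hρ
    grind [Ix.dfd_add, Ix.ev_add]
  have hS : Entails ℰ Φ (cle S (I - C)) := entails_cle.2 fun ρ hρ => by
    have := key ρ hρ
    grind [Ix.dfd_sub, Ix.ev_sub]
  -- Truncation is harmless since `C ≤ I`. The slack goes to the stack, whose rules include
  -- subsumption on the cost.
  refine ⟨(I - C) + C, .mk (hπ.subs hπ.wellDefined.source hπ.wellDefined.target hS
    ⟨hS.refl_right, hπ.wellDefined.source, hπ.wellDefined.target⟩) hc, ?_, ?_⟩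
  all_goals
    refine entails_cle.2 fun ρ hρ => ?_
    have := key ρ hρ
    grind [Ix.dfd_sub, Ix.ev_sub, Ix.dfd_add, Ix.ev_add]

theorem weighted_subject_reduction {P R : Proc} {I : Ix Θ n} (hstep : Step P R)
    (hty : ProcTy ℰ Φ I P τ) :
    ∃ J : Ix Θ n, ProcTy ℰ Φ J R τ ∧ ((EntailsEq ℰ Φ I J ∧ R.size < P.size) ∨
      (Entails ℰ Φ (clt J I) ∧ ∃ s ∈ P.terms, R.size < P.size + s.size)) := by
  obtain ⟨hπ, hc⟩ := hty
  rename_i S₀ C₀ c₀ π₀ σ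
  have hS₀ := ixDefined_iff.1 hπ.wellDefined.weight
  have hC₀ := ixDefined_iff.1 hc.weight
  have same : ∀ {R : Proc} {S C : Ix Θ n} {υ : MTy Θ n}, StackTy ℰ Φ S R.stack υ τ →
      CloTy ℰ Φ C R.clo υ → Entails ℰ Φ (cle (S + C) (S₀ + C₀)) →
      R.size < Proc.size ⟨c₀, π₀⟩ → ∃ J : Ix Θ n, ProcTy ℰ Φ J R τ ∧
        ((EntailsEq ℰ Φ (S₀ + C₀) J ∧ R.size < Proc.size ⟨c₀, π₀⟩) ∨
        (Entails ℰ Φ (clt J (S₀ + C₀)) ∧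
          ∃ s ∈ Proc.terms ⟨c₀, π₀⟩, R.size < Proc.size ⟨c₀, π₀⟩ + s.size)) :=
    fun h₁ h₂ h₃ h₄ =>
      let ⟨J, h, h'⟩ := ProcTy.pad h₁ h₂ h₃
      ⟨J, h, .inl ⟨h', h₄⟩⟩
  cases hstep with
  | arg v c π =>
    obtain ⟨C, S, σ₀, τ₀, h₁, h₂, h₃, h₄, h₅⟩ := hπ.arg_inv
    have hv := hc.sub h₃ h₄
    refine same (.fn hv h₂ ⟨?_, h₁.type, h₂.wellDefined.target⟩) h₁ ?_ ?_
    · refine ixDefined_iff.2 fun ρ hρ => ?_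
      have := entails_cle.1 h₅ ρ hρ
      have := hC₀ ρ hρ
      grind [Ix.dfd_add]
    · refine entails_cle.2 fun ρ hρ => ?_
      have := entails_cle.1 h₅ ρ hρ
      have := hC₀ ρ hρ
      grind [Ix.dfd_add, Ix.ev_add]
    · simp only [Proc.size, Stack.size, Closure.size]
      omega
  | beta v t ρ π =>
    obtain ⟨C, S, σ₀, τ₀, h₁, h₂, h₃, h₄, h₅⟩ := hπ.fn_inv
    obtain ⟨σs, L, W, rfl, k, hρ⟩ := CloTy.inv h₁
    obtain ⟨M, k, hM⟩ := HasTy.beta k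
    rw [← Ctx.ofList_cons] at k
    refine ⟨_, .mk h₂ (.mk k (EnvTy.push (hc.sub h₃ h₄) hρ)), .inr ⟨?_, .lam t, ?_, ?_⟩⟩
    · refine entails_clt.2 fun ρ hρ => ?_
      have := entails_cle.1 h₅ ρ hρ
      have := entails_clt.1 hM ρ hρ
      have := hC₀ ρ hρ
      grind [Ix.dfd_add, Ix.ev_add]
    · simp [Proc.terms, Stack.terms, Closure.terms, VClosure.toClosure, Val.toTm]
    · have := t.msize_le_size
      simp only [Proc.size, Stack.size, Closure.size, VClosure.toClosure, Val.msize_toTm, Tm.size]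
      omega
  | unfold v t ρ π =>
    obtain ⟨C, S, σ₀, τ₀, h₁, h₂, h₃, h₄, h₅⟩ := hπ.fn_inv
    have hd := h₁.type
    obtain ⟨σs, L, W, rfl, k, hρ⟩ := CloTy.inv h₁
    obtain ⟨σs₁, σs₂, υ, M, N, hσ, k₁, k₂, hM⟩ := HasTy.unfold (C := ⟨σ₀, τ₀⟩) k
    obtain ⟨W₁, W₂, hρ₁, hρ₂, hW⟩ := hρ.split hσ
    have hfix : CloTy ℰ Φ (N + W₂) (VClosure.toClosure ⟨.fix t, ρ⟩) υ := .mk k₂ hρ₂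
    refine ⟨_, .mk (.arg (hc.sub h₃ h₄) h₂ ⟨?_, hd, h₂.wellDefined.target⟩)
      (.mk k₁ (EnvTy.push hfix hρ₁)), .inr ⟨?_, .fix t, ?_, ?_⟩⟩
    · refine ixDefined_iff.2 fun ρ hρ => ?_
      have := entails_cle.1 h₅ ρ hρ
      have := hC₀ ρ hρ
      grind [Ix.dfd_add]
    · refine entails_clt.2 fun ρ hρ => ?_
      have := entails_cle.1 h₅ ρ hρ
      have := entails_clt.1 hM ρ hρ
      have := entails_cle.1 hW ρ hρ
      have := hC₀ ρ hρ
      grind [Ix.dfd_add, Ix.ev_add]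
    · simp [Proc.terms, Stack.terms, Closure.terms, VClosure.toClosure, Val.toTm]
    · have := t.msize_le_size
      simp only [Proc.size, Stack.size, Closure.size, VClosure.toClosure, Val.msize_toTm, Tm.size]
      omega
  | ifZero ρ' t u ρ π =>
    obtain ⟨C, S, M, N, σ₀, h₁, h₂, h₃, h₄, h₅⟩ := hπ.ifz_inv
    have hnum := subty_numeral (hc.num.trans h₄)
    -- The scrutinee `0` has a type below `Nat[M, N]`, which forces `M ≤ 0`; the constraint guarding
    -- this branch thus already follows from `Φ`.
    refine same h₃ (h₁.mono fun ρ hρ => sat_insert.2 ⟨holds_cle.2 ?_, hρ⟩) ?_ ?_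
    · have := hnum ρ hρ
      exact ⟨this.1, Ix.dfd_zero, by rw [Ix.ev_zero]; exact this.2.2.1⟩
    · refine entails_cle.2 fun ρ hρ => ?_
      have := entails_cle.1 h₅ ρ hρ
      have := hC₀ ρ hρ
      grind [Ix.dfd_add, Ix.ev_add]
    · simp only [Proc.size, Stack.size, Closure.size]
      omega
  | ifSucc ρ' k t u ρ π =>
    obtain ⟨C, S, M, N, σ₀, h₁, h₂, h₃, h₄, h₅⟩ := hπ.ifz_inv
    have hnum := subty_numeral (hc.num.trans h₄)
    refine same h₃ (h₂.mono fun ρ hρ => sat_insert.2 ⟨holds_cle.2 ?_, hρ⟩) ?_ ?_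
    · have := hnum ρ hρ
      exact ⟨Ix.dfd_one, this.2.1, by rw [Ix.ev_one]; omega⟩
    · refine entails_cle.2 fun ρ hρ => ?_
      have := entails_cle.1 h₅ ρ hρ
      have := hC₀ ρ hρ
      grind [Ix.dfd_add, Ix.ev_add]
    · simp only [Proc.size, Stack.size, Closure.size]
      omega
  | numSucc ρ k π =>
    obtain ⟨S, M, N, h₁, h₂, h₃⟩ := hπ.succ_inv
    have hnum := subty_numeral (hc.num.trans h₂)
    refine same h₁ (.num_nil (k := k + 1) (.nat ?_ ?_) h₁.wellDefined.source) ?_ ?_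
    · refine entails_cle.2 fun ρ hρ => ?_
      have := hnum ρ hρ
      rw [Ix.ev_add this.1 Ix.dfd_one, Ix.ev_one, Ix.ev_numeral]
      exact ⟨Ix.dfd_add.2 ⟨this.1, Ix.dfd_one⟩, Ix.dfd_numeral, by omega⟩
    · refine entails_cle.2 fun ρ hρ => ?_
      have := hnum ρ hρ
      rw [Ix.ev_add this.2.1 Ix.dfd_one, Ix.ev_one, Ix.ev_numeral]
      exact ⟨Ix.dfd_numeral, Ix.dfd_add.2 ⟨this.2.1, Ix.dfd_one⟩, by omega⟩
    · refine entails_cle.2 fun ρ hρ => ?_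
      have := entails_cle.1 h₃ ρ hρ
      have := hC₀ ρ hρ
      grind [Ix.dfd_add, Ix.ev_add, Ix.ev_zero, Ix.dfd_zero]
    · simp only [Proc.size, Stack.size, Closure.size, Tm.msize]
      omega
  | numPred ρ k π =>
    obtain ⟨S, M, N, h₁, h₂, h₃⟩ := hπ.pred_inv
    have hnum := subty_numeral (hc.num.trans h₂)
    refine same h₁ (.num_nil (k := k - 1) (.nat ?_ ?_) h₁.wellDefined.source) ?_ ?_
    · refine entails_cle.2 fun ρ hρ => ?_
      have := hnum ρ hρ
      rw [Ix.ev_sub this.1 Ix.dfd_one, Ix.ev_one, Ix.ev_numeral]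
      exact ⟨Ix.dfd_sub.2 ⟨this.1, Ix.dfd_one⟩, Ix.dfd_numeral, by omega⟩
    · refine entails_cle.2 fun ρ hρ => ?_
      have := hnum ρ hρ
      rw [Ix.ev_sub this.2.1 Ix.dfd_one, Ix.ev_one, Ix.ev_numeral]
      exact ⟨Ix.dfd_numeral, Ix.dfd_sub.2 ⟨this.2.1, Ix.dfd_one⟩, by omega⟩
    · refine entails_cle.2 fun ρ hρ => ?_
      have := entails_cle.1 h₃ ρ hρ
      have := hC₀ ρ hρ
      grind [Ix.dfd_add, Ix.ev_add, Ix.ev_zero, Ix.dfd_zero]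
    · simp only [Proc.size, Stack.size, Closure.size, Tm.msize]
      omega
  | @var ρ x v π hx =>
    obtain ⟨σs, L, W, rfl, k, hρ⟩ := hc.inv
    obtain ⟨υ, hυ, hυσ⟩ := k.var_inv
    -- The weights of the other bindings are discarded here.
    obtain ⟨K, hK, hKW⟩ := hρ.lookup hx hυ
    refine same hπ (hK.sub hυσ hc.type) ?_ ?_
    · refine entails_cle.2 fun ρ hρ => ?_
      have := entails_cle.1 hKW ρ hρ
      have := hC₀ ρ hρ
      have := hS₀ ρ hρ
      grind [Ix.dfd_add, Ix.ev_add]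
    · simp only [Proc.size, Closure.size, VClosure.toClosure, Val.msize_toTm, Tm.msize]
      omega
  | app t u ρ π =>
    obtain ⟨σs, L, W, rfl, k, hρ⟩ := hc.inv
    obtain ⟨Γ₁, Γ₂, Ξ, M, N, σ₀, τ₀, k₁, k₂, hΞ, hsub⟩ := k.app_inv
    obtain ⟨σs₁, σs₂, hσ, hσ₁, hσ₂⟩ := hΞ.splitList (Ctx.ofList_defined.1 k.wellDefined.ctx) hsub.ctx
      hsub.source.ctx
    obtain ⟨W₁, W₂, hρ₁, hρ₂, hW⟩ := hρ.split hσ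
    have k₁ := k₁.sub hσ₁ (Ctx.ofList_defined.2 hσ.defined.1) k₁.wellDefined.type
      k₁.wellDefined.type
    have k₂ := k₂.sub hσ₂ (Ctx.ofList_defined.2 hσ.defined.2) k₂.wellDefined.type
      k₂.wellDefined.type
    have c₂ : CloTy ℰ Φ (N + W₂) ⟨u, ρ⟩ σ₀.at0 := .mk k₂ hρ₂
    have hπ' := hπ.sub hsub.type hsub.source.type hπ.wellDefined.target hπ.wellDefined.target
    refine same (.arg c₂ hπ' ⟨?_, k₁.wellDefined.type, hπ.wellDefined.target⟩) (.mk k₁ hρ₁) ?_ ?_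
    · exact ixDefined_iff.2 fun ρ hρ =>
        Ix.dfd_add.2 ⟨ixDefined_iff.1 c₂.weight ρ hρ, hS₀ ρ hρ⟩
    · refine entails_cle.2 fun ρ hρ => ?_
      have := entails_cle.1 hW ρ hρ
      have := entails_cle.1 hsub.weight ρ hρ
      have := hC₀ ρ hρ
      have := hS₀ ρ hρ
      grind [Ix.dfd_add, Ix.ev_add]
    · simp only [Proc.size, Stack.size, Closure.size, Tm.msize]
      omega
  | succ t ρ π =>
    obtain ⟨σs, L, W, rfl, k, hρ⟩ := hc.inv
    obtain ⟨M, I, J, k, hM, hσ⟩ := k.succ_inv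
    refine same (.succ (M := I) (N := J) (hπ.sub hσ ?_ hπ.wellDefined.target hπ.wellDefined.target)
      ⟨hπ.wellDefined.weight, k.wellDefined.type, hπ.wellDefined.target⟩) (.mk k hρ) ?_ ?_
    · cases k.wellDefined.type with
      | nat h₁ h₂ =>
        have h : ∀ {K : Ix Θ n}, IxDefined ℰ Φ K → IxDefined ℰ Φ (K + 1) := fun h =>
          ixDefined_iff.2 fun ρ hρ => Ix.dfd_add.2 ⟨ixDefined_iff.1 h ρ hρ, Ix.dfd_one⟩
        exact .nat (h h₁) (h h₂)
    · refine entails_cle.2 fun ρ hρ => ?_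
      have := entails_cle.1 hM ρ hρ
      have := hC₀ ρ hρ
      have := hS₀ ρ hρ
      grind [Ix.dfd_add, Ix.ev_add]
    · simp only [Proc.size, Stack.size, Closure.size, Tm.msize]
      omega
  | pred t ρ π =>
    obtain ⟨σs, L, W, rfl, k, hρ⟩ := hc.inv
    obtain ⟨M, I, J, k, hM, hσ⟩ := k.pred_inv
    refine same (.pred (M := I) (N := J) (hπ.sub hσ ?_ hπ.wellDefined.target hπ.wellDefined.target)
      ⟨hπ.wellDefined.weight, k.wellDefined.type, hπ.wellDefined.target⟩) (.mk k hρ) ?_ ?_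
    · cases k.wellDefined.type with
      | nat h₁ h₂ =>
        have h : ∀ {K : Ix Θ n}, IxDefined ℰ Φ K → IxDefined ℰ Φ (K - 1) := fun h =>
          ixDefined_iff.2 fun ρ hρ => Ix.dfd_sub.2 ⟨ixDefined_iff.1 h ρ hρ, Ix.dfd_one⟩
        exact .nat (h h₁) (h h₂)
    · refine entails_cle.2 fun ρ hρ => ?_
      have := entails_cle.1 hM ρ hρ
      have := hC₀ ρ hρ
      have := hS₀ ρ hρ
      grind [Ix.dfd_add, Ix.ev_add]
    · simp only [Proc.size, Stack.size, Closure.size, Tm.msize]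
      omega
  | ifz t u s ρ π =>
    obtain ⟨σs, L, W, rfl, k, hρ⟩ := hc.inv
    obtain ⟨Γ₁, Γ₂, Ξ, M, N, I, J, υ, k₁, k₂, k₃, hΞ, hsub⟩ := k.ifz_inv
    obtain ⟨σs₁, σs₂, hσ, hσ₁, hσ₂⟩ := hΞ.splitList (Ctx.ofList_defined.1 k.wellDefined.ctx) hsub.ctx
      hsub.source.ctx
    obtain ⟨W₁, W₂, hρ₁, hρ₂, hW⟩ := hρ.split hσ
    have hσs₂ := Ctx.ofList_defined.2 hσ.defined.2
    have hm : ∀ (c : Constraint Θ n) ρ, Sat ℰ (insert c Φ) ρ → Sat ℰ Φ ρ :=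
      fun c ρ h => (sat_insert.1 h).2
    -- At most one branch will run, so both share the second half of the environment, with typings
    -- weakened to the branch's extra constraint.
    have branch : ∀ {c : Constraint Θ n} {r : Tm}, HasTy ℰ (insert c Φ) Γ₂ N r υ →
        CloTy ℰ (insert c Φ) (N + W₂) ⟨r, ρ⟩ υ := fun {c} _ h =>
      .mk (h.sub (hσ₂.mono (hm c)) (fun x τ hτ => (hσs₂ x τ hτ).mono (hm c)) h.wellDefined.type
        h.wellDefined.type) (hρ₂.mono (hm c))
    have k₁ := k₁.sub hσ₁ (Ctx.ofList_defined.2 hσ.defined.1) k₁.wellDefined.type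
      k₁.wellDefined.type
    have hπ' := hπ.sub hsub.type hsub.source.type hπ.wellDefined.target hπ.wellDefined.target
    refine same (.ifz (branch k₂) (branch k₃) hπ' ⟨?_, k₁.wellDefined.type, hπ.wellDefined.target⟩)
      (.mk k₁ hρ₁) ?_ ?_
    · refine ixDefined_iff.2 fun ρ hρ => ?_
      have := entails_cle.1 hW ρ hρ
      have := entails_cle.1 hsub.weight ρ hρ
      have := hS₀ ρ hρ
      grind [Ix.dfd_add]
    · refine entails_cle.2 fun ρ hρ => ?_
      have := entails_cle.1 hW ρ hρ
      have := entails_cle.1 hsub.weight ρ hρ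
      have := hC₀ ρ hρ
      have := hS₀ ρ hρ
      grind [Ix.dfd_add, Ix.ev_add]
    · simp only [Proc.size, Stack.size, Closure.size, Tm.msize]
      omega

end

end DlPCF

theorem mainTheorem5 {Θ : DlPCF.Signature.{u}} (ℰ : DlPCF.EqProgram Θ) {n : ℕ}
    (Φ : DlPCF.ICtx Θ n) (P R : DlPCF.Proc) (I : DlPCF.Ix Θ n) (τ : DlPCF.MTy Θ n)
    (hstep : DlPCF.Step P R) (hty : DlPCF.ProcTy ℰ Φ I P τ) :
    ∃ J : DlPCF.Ix Θ n, DlPCF.ProcTy ℰ Φ J R τ ∧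
      ((DlPCF.EntailsEq ℰ Φ I J ∧ R.size < P.size) ∨
        (DlPCF.Entails ℰ Φ (DlPCF.clt J I) ∧ ∃ s ∈ P.terms, R.size < P.size + s.size)) := by
  exact DlPCF.weighted_subject_reduction hstep hty
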